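/- **Conventions.** A (finite) graph $\Gamma$ consists of a finite set of half-edges with surjections onto a set $E(\Gamma)$ of edges and a set of vertices, every edge consisting of one half-edge (external edge) or two half-edges (internal edge). A graph is a topological space, $h_1(\Gamma)=\dim H_1(\Gamma,\mathbb Q)$. A subgraph $\gamma\subset\Gamma$ is given by a subset of $E(\Gamma)$; $\Gamma/\!/\gamma$ is the graph obtained by contracting every edge of $\gamma$ to a point (so every connected component of $\gamma$ becomes a vertex). $\Gamma$ is *core* if removing any edge lowers $h_1$, and a *forest* if $h_1=0$. Fix a field $K$ (for instance $\mathbb Q$ or $\mathbb C$). For a graph $G$, $\mathbb P(G)$ is the projective space over $K$ with homogeneous coordinates $A_e$, $e\in E(G)$, and $T(G)=\mathbb G_m^{E(G)}/\mathbb G_m\subset\mathbb P(G)$ is the open torus where no coordinate vanishes. Let $\Gamma$ be a core graph with at least one edge. Let $L(\Gamma)$ be the set of linear spaces $L_\gamma=\{A_e=0,\ e\in\gamma\}\subset\mathbb P(\Gamma)$ for the non-empty core subgraphs $\gamma\subsetneq\Gamma$. Let $L(\Gamma)_1$ be the set of minimal elements of $L(\Gamma)$ with respect to inclusion and $L(\Gamma)_{i+1}$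 the set of minimal elements of $L(\Gamma)\setminus(L(\Gamma)_1\cup\dots\cup L(\Gamma)_i)$. Let $\pi:P(\Gamma)\to\mathbb P(\Gamma)$ be the iterated blow-up in which one blows up first the (union of the) elements of $L(\Gamma)_1$, then the strict transforms of the elements of $L(\Gamma)_2$, and so on. **Proposition.** The iterated blow-up $P(\Gamma)$ exists, and: (i) $P(\Gamma)$ is a smooth toric variety for $T=T(\Gamma)$: it is a smooth (integral, separated, finite type) variety over $K$ with an open immersion $T\hookrightarrow P(\Gamma)$, lifting the inclusion $T\subset\mathbb P(\Gamma)$, such that the multiplication of $T$ extends to an action of $T$ on $P(\Gamma)$. (ii) The orbits of $T$ on $P(\Gamma)$ are in one-to-one correspondence with the pairs $(F,\ \Gamma_p\subsetneq\dots\subsetneq\Gamma_1\subsetneq\Gamma)$, $p\ge 0$, where $F\subset\Gamma$ is a (possibly empty) subforest, the $\Gamma_i$ are non-empty core subgraphs, and, with $\Gamma_0=\Gamma$, $\Gamma_{p+1}=\emptyset$ and $F_i=F\cap\Gamma_i$, the image of $F_i$ in $\Gamma_i/\!/\Gamma_{i+1}$ is a subforest for every $0\le i\le p$. The orbit $O$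 (with its reduced structure) associated to such a pair is canonically identified with the open orbit $$\prod_{i=0}^{p}T\bigl((\Gamma_i/\!/\Gamma_{i+1})/\!/F_i\bigr)\ \subset\ \prod_{i=0}^{p}\mathbb P\bigl((\Gamma_i/\!/\Gamma_{i+1})/\!/F_i\bigr),$$ where each $(\Gamma_i/\!/\Gamma_{i+1})/\!/F_i$ has at least one edge. The identification is $T$-equivariant, where $T$ acts on the $i$-th factor through the homomorphism that forgets coordinates; and it is given by coordinates: for each $i$ the coordinate projection $T(\Gamma)\to T(\Gamma_i)\subset\mathbb P(\Gamma_i)$ extends to a morphism $P(\Gamma)\to\mathbb P(\Gamma_i)$, whose restriction to $O$ is the projection to the $i$-th factor followed by the inclusion of $T((\Gamma_i/\!/\Gamma_{i+1})/\!/F_i)$ into $\mathbb P(\Gamma_i)$ as the stratum where exactly the coordinates of edges in $\Gamma_{i+1}\cup F_i$ vanish. -/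

import Mathlib

open CategoryTheory CategoryTheory.Limits AlgebraicGeometry TopologicalSpace
open MonoidalCategory CartesianMonoidalCategory

universe u

noncomputable section

/-! ### Graphs -/

/-- A finite graph given by half-edges: surjections from a finite set of half-edges to the set of
edges and to the set of vertices. An edge consists of two half-edges (internal edge) or of one
half-edge (external edge); there are no isolated vertices. -/
structure HEGraph where
  HE : Type u
  E : Type u
  V : Type u
  pE : HE → E
  pV : HE → V
  finite_HE : Finite HE
  pE_surjective : Function.Surjective pE
  pV_surjective : Function.Surjective pV
  card_fibre_le : ∀ e, Nat.card {h // pE h = e} ≤ 2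

namespace HEGraph

variable (Γ : HEGraph.{u})

/-- The cellular boundary map of the graph, viewed as a topological space: every half-edge `h` is
a segment joining the vertex `pV h` to the midpoint of the edge `pE h`. -/
def boundary : (Γ.HE →₀ ℚ) →ₗ[ℚ] (Γ.V ⊕ Γ.E →₀ ℚ) :=
  Finsupp.linearCombination ℚ fun h =>
    Finsupp.single (Sum.inr (Γ.pE h)) (1 : ℚ) - Finsupp.single (Sum.inl (Γ.pV h)) (1 : ℚ)

/-- The loop number `h₁(Γ) = dim H₁(Γ, ℚ)`. -/
def h1 : ℕ := Module.finrank ℚ (LinearMap.ker Γ.boundary)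

/-- The subgraph with edge set `A` (vertices that become isolated are removed). -/
@[reducible] def sub (A : Set Γ.E) : HEGraph.{u} where
  HE := {h : Γ.HE // Γ.pE h ∈ A}
  E := {e : Γ.E // e ∈ A}
  V := {v : Γ.V // ∃ h, Γ.pE h ∈ A ∧ Γ.pV h = v}
  pE h := ⟨Γ.pE h.1, h.2⟩
  pV h := ⟨Γ.pV h.1, h.1, h.2, rfl⟩
  finite_HE := by
    have := Γ.finite_HE
    infer_instance
  pE_surjective := by
    rintro ⟨e, he⟩
    obtain ⟨h, rfl⟩ := Γ.pE_surjective e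
    exact ⟨⟨h, he⟩, rfl⟩
  pV_surjective := by
    rintro ⟨v, h, hA, rfl⟩
    exact ⟨⟨h, hA⟩, rfl⟩
  card_fibre_le := by
    intro e
    have := Γ.finite_HE
    refine le_trans (Nat.card_le_card_of_injective
      (fun h : {h : {h : Γ.HE // Γ.pE h ∈ A} // (⟨Γ.pE h.1, h.2⟩ : {e : Γ.E // e ∈ A}) = e} =>
        (⟨h.1.1, congrArg Subtype.val h.2⟩ : {h // Γ.pE h = e.1})) ?_) (Γ.card_fibre_le e.1)
    intro a b hab
    exact Subtype.ext (Subtype.ext (congrArg (fun h => h.1) hab))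

/-- Two vertices are linked by `A` if they are the end points of an edge in `A`. -/
def Linked (A : Set Γ.E) (v w : Γ.V) : Prop :=
  ∃ h h', Γ.pE h ∈ A ∧ Γ.pE h' = Γ.pE h ∧ Γ.pV h = v ∧ Γ.pV h' = w

/-- The quotient graph `Γ // A`: every edge in `A` is contracted to a point, that is, each connected
component of the subgraph `A` becomes one vertex (vertices left isolated are removed). -/
@[reducible] def contract (A : Set Γ.E) : HEGraph.{u} where
  HE := {h : Γ.HE // Γ.pE h ∉ A}
  E := {e : Γ.E // e ∉ A}
  V := {v : Quot (Γ.Linked A) // ∃ h, Γ.pE h ∉ A ∧ Quot.mk _ (Γ.pV h) = v}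
  pE h := ⟨Γ.pE h.1, h.2⟩
  pV h := ⟨Quot.mk _ (Γ.pV h.1), h.1, h.2, rfl⟩
  finite_HE := by
    have := Γ.finite_HE
    infer_instance
  pE_surjective := by
    rintro ⟨e, he⟩
    obtain ⟨h, rfl⟩ := Γ.pE_surjective e
    exact ⟨⟨h, he⟩, rfl⟩
  pV_surjective := by
    rintro ⟨v, h, hA, rfl⟩
    exact ⟨⟨h, hA⟩, rfl⟩
  card_fibre_le := by
    intro e
    have := Γ.finite_HE
    refine le_trans (Nat.card_le_card_of_injective
      (fun h : {h : {h : Γ.HE // Γ.pE h ∉ A} // (⟨Γ.pE h.1, h.2⟩ : {e : Γ.E // e ∉ A}) = e} =>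
        (⟨h.1.1, congrArg Subtype.val h.2⟩ : {h // Γ.pE h = e.1})) ?_) (Γ.card_fibre_le e.1)
    intro a b hab
    exact Subtype.ext (Subtype.ext (congrArg (fun h => h.1) hab))

/-- `Γ` is a core graph: removing any edge lowers the loop number. -/
def IsCore : Prop := ∀ e : Γ.E, (Γ.sub {e}ᶜ).h1 < Γ.h1

/-- `Γ` is a forest: its loop number is zero. -/
def IsForest : Prop := Γ.h1 = 0

/-- A pair `(F, Γ_p ⊊ ⋯ ⊊ Γ_1 ⊊ Γ)` of a subforest and a flag of core subgraphs. The flag is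
extended by `Γ_0 = Γ` and `Γ_{p+1} = ∅`, so strict monotonicity says that the core subgraphs
`Γ_1, …, Γ_p` are non-empty and proper. -/
structure FlaggedForest where
  p : ℕ
  flag : Fin (p + 2) → Set Γ.E
  flag_zero : flag 0 = Set.univ
  flag_last : flag (Fin.last (p + 1)) = ∅
  strictAnti : StrictAnti flag
  core : ∀ i, i ≠ 0 → i ≠ Fin.last (p + 1) → (Γ.sub (flag i)).IsCore
  F : Set Γ.E
  forest : (Γ.sub F).IsForest
  /-- The image of `F_i = F ∩ Γ_i` in `Γ_i // Γ_{i+1}` is a subforest, for `0 ≤ i ≤ p`. -/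
  compatible : ∀ i : Fin (p + 1),
    (((Γ.sub (flag i.castSucc)).contract {e | e.1 ∈ flag i.succ}).sub {e | e.1.1 ∈ F}).IsForest

/-- The graph `(Γ_i // Γ_{i+1}) // F_i`, for `0 ≤ i ≤ p`. -/
@[reducible] def FlaggedForest.piece {Γ : HEGraph.{u}} (d : Γ.FlaggedForest) (i : Fin (d.p + 1)) :
    HEGraph.{u} :=
  ((Γ.sub (d.flag i.castSucc)).contract {e | e.1 ∈ d.flag i.succ}).contract {e | e.1.1 ∈ d.F}

end HEGraph

/-! ### Projective spaces and tori -/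

attribute [local instance] MvPolynomial.gradedAlgebra

/-- The projective space over `K` with homogeneous coordinates labelled by `A`. -/
@[reducible] def PSpace (K A : Type u) [Field K] : Scheme.{u} :=
  Proj (MvPolynomial.homogeneousSubmodule A K)

/-- The structure morphism of projective space. -/
def PSpace.toSpec (K A : Type u) [Field K] : PSpace K A ⟶ Spec (.of K) :=
  Proj.toSpecZero (MvPolynomial.homogeneousSubmodule A K) ≫
    Spec.map (CommRingCat.ofHom (algebraMap K (MvPolynomial.homogeneousSubmodule A K 0)))

/-- The coordinate linear space `X_a = 0, a ∈ S` in projective space. -/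
def PSpace.linearSpace (K : Type u) [Field K] {A : Type u} (S : Set A) : Closeds (PSpace K A) :=
  ⟨ProjectiveSpectrum.zeroLocus (MvPolynomial.homogeneousSubmodule A K)
      ((fun a => (MvPolynomial.X a : MvPolynomial A K)) '' S),
    ProjectiveSpectrum.isClosed_zeroLocus _ _⟩

/-- The morphism `Spec R ⟶ PSpace K A` with homogeneous coordinates `[u_a]_a`, one of which is a
unit of the `K`-algebra `R`. -/
def PSpace.ofCoords {K A : Type u} [Field K] {R : Type u} [CommRing R] [Algebra K R] (w : A → R)
    (h : ∃ a, IsUnit (w a)) : Spec (.of R) ⟶ PSpace K A :=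
  Proj.fromOfGlobalSections (MvPolynomial.homogeneousSubmodule A K)
    ((Scheme.ΓSpecIso (.of R)).inv.hom.comp (MvPolynomial.aeval w : _ →ₐ[K] R).toRingHom) <| by
    obtain ⟨a, ha⟩ := h
    refine Ideal.eq_top_of_isUnit_mem _ (Ideal.mem_map_of_mem _ ?_)
      (x := ((Scheme.ΓSpecIso (.of R)).inv.hom.comp
        (MvPolynomial.aeval w : _ →ₐ[K] R).toRingHom) (MvPolynomial.X a)) ?_
    · have hX : (MvPolynomial.X a : MvPolynomial A K) ∈ MvPolynomial.homogeneousSubmodule A K 1 :=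
        MvPolynomial.isHomogeneous_X K a
      rw [HomogeneousIdeal.mem_iff]
      rw [HomogeneousIdeal.mem_irrelevant_iff, GradedRing.proj_apply,
        DirectSum.decompose_of_mem_ne _ hX one_ne_zero]
    · simpa using ha.map (Scheme.ΓSpecIso (.of R)).inv.hom

/-- The character lattice `{m ∈ ℤ^A | ∑ m_a = 0}`, dual to `ℤ^A / ℤ·(1,…,1)`. -/
@[reducible] def charLattice (A : Type u) : AddSubgroup (A →₀ ℤ) :=
  (Finsupp.degree : (A →₀ ℤ) →+ ℤ).ker

/-- The character `X_a / X_b`, that is, `e_a - e_b`. -/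
def charLattice.ratio {A : Type u} (a b : A) : charLattice A :=
  ⟨Finsupp.single a 1 - Finsupp.single b 1, by
    rw [AddMonoidHom.mem_ker, map_sub, Finsupp.degree_single, Finsupp.degree_single, sub_self]⟩

/-- The map of character lattices induced by a map of index sets. -/
def charLattice.map {B A : Type u} (φ : B → A) : charLattice B →+ charLattice A where
  toFun m := ⟨Finsupp.mapDomain φ m.1, by
    have h := m.2
    rw [AddMonoidHom.mem_ker] at h ⊢
    rw [Finsupp.degree_mapDomain, h]⟩
  map_zero' := by ext; simp
  map_add' x y := by ext; simp [Finsupp.mapDomain_add]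

/-- The coordinate ring of the torus `𝔾ₘ^A / 𝔾ₘ` over `K`. -/
@[reducible] def TorusRing (K A : Type u) [Field K] : Type u := AddMonoidAlgebra K (charLattice A)

/-- The torus `𝔾ₘ^A / 𝔾ₘ` over `K`. -/
@[reducible] def torus (K A : Type u) [Field K] : Over (Spec (CommRingCat.of K)) :=
  (Spec (CommRingCat.of (TorusRing K A))).asOver (Spec (CommRingCat.of K))

instance torus.grpObj (K A : Type u) [Field K] : GrpObj (torus K A) :=
  instGrpObjSpecAsOverSpec (R := .of K) (A := .of (TorusRing K A))

/-- The homomorphism `𝔾ₘ^A / 𝔾ₘ ⟶ 𝔾ₘ^B / 𝔾ₘ`, `(t_a) ↦ (t_{φ b})`, for a map `φ : B → A`. -/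
def torus.proj (K : Type u) [Field K] {B A : Type u} (φ : B → A) : torus K A ⟶ torus K B :=
  Over.homMk (Spec.map (CommRingCat.ofHom
    (AddMonoidAlgebra.mapDomainAlgHom K K (charLattice.map φ)).toRingHom)) (by
      refine (Spec.map_comp _ _).symm.trans (congrArg Spec.map ?_)
      rw [← CommRingCat.ofHom_comp]
      exact congrArg CommRingCat.ofHom
        (AddMonoidAlgebra.mapDomainAlgHom K K (charLattice.map φ)).comp_algebraMap)

open Classical in
/-- The coordinates of the morphism `torus.toPSpace`: `X_a` is `t_b / t_{b₀}` if `a = φ b`, and `0`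
if `a` is not in the range of `φ`. -/
def torus.coords (K : Type u) [Field K] {B A : Type u} (φ : B → A) (b₀ : B) (a : A) :
    TorusRing K B :=
  if h : ∃ b, φ b = a then AddMonoidAlgebra.single (charLattice.ratio h.choose b₀) 1 else 0

/-- For an injection `φ : B → A`, the immersion of the torus `𝔾ₘ^B / 𝔾ₘ` into the projective space
with coordinates `A`, as the stratum where exactly the coordinates in the range of `φ` do not
vanish. It does not depend on `b₀`, which only serves to dehomogenise the coordinates. -/
def torus.toPSpace (K : Type u) [Field K] {B A : Type u} (φ : B ↪ A) (b₀ : B) :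
    (torus K B).left ⟶ PSpace K A :=
  PSpace.ofCoords (torus.coords K φ b₀) ⟨φ b₀, by
    have h : ∃ b, φ b = φ b₀ := ⟨b₀, rfl⟩
    have h' : h.choose = b₀ := φ.injective h.choose_spec
    have h0 : charLattice.ratio b₀ b₀ = 0 := Subtype.ext (sub_self _)
    rw [torus.coords, dif_pos h, h', h0, ← AddMonoidAlgebra.one_def]
    exact isUnit_one⟩

/-! ### Blow-ups -/

namespace AlgebraicGeometry.Scheme

variable {X Y : Scheme.{u}}

/-- An ideal sheaf is invertible if it is locally generated by one non-zero-divisor. -/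
def IdealSheafData.IsInvertible (I : X.IdealSheafData) : Prop :=
  ∀ x : X, ∃ U : X.affineOpens, x ∈ U.1 ∧
    ∃ t ∈ nonZeroDivisors Γ(X, U.1), I.ideal U = Ideal.span {t}

/-- `f : Y ⟶ X` is the blow-up of `X` along the ideal sheaf `I`, by its universal property. -/
structure IsBlowup (f : Y ⟶ X) (I : X.IdealSheafData) : Prop where
  isInvertible : (I.comap f).IsInvertible
  existsUnique_lift : ∀ (W : Scheme.{u}) (g : W ⟶ X), (I.comap g).IsInvertible →
    ∃! l : W ⟶ Y, l ≫ f = g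

/-- The strict transform in `Y` of the closed subset `Z` of `X`, where `f : Y ⟶ X` is the blow-up
with centre `C`: the closure of the preimage of `Z \ C`. -/
def strictTransform (f : Y ⟶ X) (C Z : Closeds X) : Closeds Y :=
  Closeds.closure (f ⁻¹' ((Z : Set X) \ C))

/-- `f : Y ⟶ X` is the iterated blow-up of the given list of (finite) sets of reduced closed
subschemes of `X`: first blow up the union of the members of the first set, then the union of the
strict transforms of the members of the second set, and so on. -/
inductive IsIteratedBlowup : ∀ {Y X : Scheme.{u}}, (Y ⟶ X) → List (Set (Closeds X)) → Prop
  | nil {Y X : Scheme.{u}} (f : Y ⟶ X) [IsIso f] : IsIteratedBlowup f []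
  | cons {Z Y X : Scheme.{u}} (f : Y ⟶ X) (g : Z ⟶ Y) (S : Set (Closeds X))
      (L : List (Set (Closeds X))) (hf : IsBlowup f (IdealSheafData.vanishingIdeal (sSup S)))
      (hg : IsIteratedBlowup g (L.map fun S' => strictTransform f (sSup S) '' S')) :
      IsIteratedBlowup (g ≫ f) (S :: L)

end AlgebraicGeometry.Scheme

/-- What is left of `S` after removing, `i` times, all minimal elements. -/
def withoutMinimal {α : Type*} [PartialOrder α] (S : Set α) : ℕ → Set α
  | 0 => S
  | i + 1 => withoutMinimal S i \ {a | Minimal (· ∈ withoutMinimal S i) a}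

/-- The `i`-th stratum of `S`: the minimal elements of what is left after removing the strata
`0, …, i - 1`. -/
def stratum {α : Type*} [PartialOrder α] (S : Set α) (i : ℕ) : Set α :=
  {a | Minimal (· ∈ withoutMinimal S i) a}

namespace HEGraph

/-- The set of the coordinate linear spaces `X_e = 0, e ∈ γ` in the projective space of `Γ` for the
non-empty proper core subgraphs `γ` of `Γ`. -/
def coreLinearSpaces (K : Type u) [Field K] (Γ : HEGraph.{u}) : Set (Closeds (PSpace K Γ.E)) :=
  {L | ∃ γ : Set Γ.E, γ.Nonempty ∧ γ ≠ Set.univ ∧ (Γ.sub γ).IsCore ∧ L = PSpace.linearSpace K γ}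

/-- `π : P ⟶ PSpace K Γ.E` is the iterated blow-up of the projective space of `Γ` along the
coordinate linear spaces of core subgraphs: one blows up the minimal ones, then the strict
transforms of the minimal ones among the others, and so on. (A chain of core subgraphs that are
non-empty and proper has less than `Nat.card Γ.E` members, so that further strata are empty.) -/
def IsCoreBlowup (K : Type u) [Field K] (Γ : HEGraph.{u}) {P : Scheme.{u}}
    (π : P ⟶ PSpace K Γ.E) : Prop :=
  Scheme.IsIteratedBlowup π
    ((List.range (Nat.card Γ.E)).map (stratum (Γ.coreLinearSpaces K)))

end HEGraph

/-! ### Toric varieties -/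

/-- The structure of a toric variety for the torus (or group scheme) `T` on the `K`-scheme `P`:
`P` is a variety which contains `T` as an open subscheme, and the multiplication of `T` extends to
an action of `T` on `P`. -/
structure ToricStructure {K : Type u} [Field K] (T P : Over (Spec (CommRingCat.of K)))
    [GrpObj T] where
  isIntegral : IsIntegral P.left
  isSeparated : IsSeparated P.hom
  locallyOfFiniteType : LocallyOfFiniteType P.hom
  quasiCompact : QuasiCompact P.hom
  /-- the inclusion of the torus -/
  incl : T ⟶ P
  isOpenImmersion : IsOpenImmersion incl.left
  /-- the action -/
  act : T ⊗ P ⟶ P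
  one_act : (MonObj.one (X := T) ▷ P) ≫ act = (λ_ P).hom
  mul_act : (MonObj.mul (X := T) ▷ P) ≫ act = (α_ T T P).hom ≫ (T ◁ act) ≫ act
  act_incl : (T ◁ incl) ≫ act = MonObj.mul (X := T) ≫ incl

namespace ToricStructure

variable {K : Type u} [Field K] {T P : Over (Spec (CommRingCat.of K))} [GrpObj T]

/-- The orbit of a point `x` of the scheme `P`: the image under the action `T × P ⟶ P` of the
fibre over `x` of the projection `T × P ⟶ P`. -/
def orbit (s : ToricStructure T P) (x : P.left) : Set P.left :=
  s.act.left '' ((snd T P).left ⁻¹' {x})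

/-- The set of orbits. -/
def orbits (s : ToricStructure T P) : Set (Set P.left) := Set.range s.orbit

end ToricStructure

namespace HEGraph.FlaggedForest

variable {Γ : HEGraph.{u}} (d : Γ.FlaggedForest)

/-- The edges of `(Γ_i // Γ_{i+1}) // F_i` as edges of `Γ_i`. -/
def pieceEdge (i : Fin (d.p + 1)) : (d.piece i).E ↪ (Γ.sub (d.flag i.castSucc)).E :=
  ⟨fun e => e.1.1, fun _ _ h => Subtype.ext (Subtype.ext h)⟩

/-- The product over `0 ≤ i ≤ p` of the tori of the projective spaces with homogeneous coordinates
labelled by the edges of `(Γ_i // Γ_{i+1}) // F_i`. -/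
def pieceTorus (K : Type u) [Field K] : Over (Spec (CommRingCat.of K)) :=
  ∏ᶜ fun i : Fin (d.p + 1) => torus K (d.piece i).E

/-- The action of the torus of `Γ` on `pieceTorus` through the homomorphisms that forget
coordinates. -/
def pieceAct (K : Type u) [Field K] : torus K Γ.E ⊗ d.pieceTorus K ⟶ d.pieceTorus K :=
  Pi.lift fun i => (torus.proj K (fun e => (d.pieceEdge i e).1) ⊗ₘ Pi.π _ i) ≫
    MonObj.mul (X := torus K (d.piece i).E)

end HEGraph.FlaggedForest

end

/-!
The iterated blow-up is described by explicit toric charts, and everything is read off from them.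

Let `E` be a finite set and `G` a family of non-empty subsets of `E`. For a choice `c` of an element
`c S ∈ S` for each `S ∈ G`, let `chartMonoid c` be the monoid of Laurent monomials generated by the
ratios `X_a / X_{c S}` with `a ∈ S ∈ G`. The affine toric schemes `Spec K[chartMonoid c]` are the charts
of the toric variety `X(G)` whose polytope is the sum of the simplices with vertices in the members of
`G`; they meet in the expected way, and `Atlas G X` is the structure of such an atlas on `X`. It exists
(`exists_atlas`), being the standard cover of a projective spectrum. If `G = {E}`, one gets the
projective space `PSpace K E`. At a point `x` of `X(G)`, the homogeneous coordinates indexed by `S ∈ G`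
do not all vanish; `Atlas.nz S x` is the set of those that do not.

Suppose that `E ∈ G` and that `G` is closed under unions. Then `X(G)` is covered by the charts of nested
choices (`Atlas.exists_isNested`), and their monoids are free (`IsNested.exists_equiv`), because a nested
choice determines a rooted tree on `E`; so `X(G)` is smooth. Let `𝒮` be a family of new
sets whose unions with the members of `G`, and with each other, belong to `G`. In a nested chart at most
one of the strict transforms of the linear spaces `X_a = 0, a ∈ γ`, for `γ ∈ 𝒮`, is visible, and it is a
coordinate subspace. Hence `X(G ∪ 𝒮)` is the blow-up of `X(G)` along the union of these strict transforms:
a morphism that makes the ideal of the centre invertible lifts locally to the chart in which the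
coordinate that generates the ideal is chosen (`IsRefinement.isBlowup`). Strict transforms with respect
to `X(G)` become strict transforms with respect to `X(G ∪ 𝒮)` (`IsRefinement.strictTransform_center`).
The set of core subgraphs of a core graph is closed under unions, and the strata of linear spaces
satisfy the condition on `𝒮` at every step (`IsUnionFamily.isStep`). By induction, the iterated blow-up
is `X(G)`, where `G` consists of the non-empty core subgraphs, including the whole graph
(`exists_atlas_of_isIteratedBlowup_pspace`).

The torus acts on the charts by weights, which gives the toric structure (`Atlas.toricStructure`), and
it does not change the sets `Atlas.nz S x`. To a point `x` belongs the flag that starts with `Γ₀ = Γ`,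
where `Γᵢ₊₁` is the union of the core subgraphs of `Γᵢ` on which all the coordinates relative to `Γᵢ`
vanish at `x`. The non-vanishing coordinates relative to `Γᵢ` then form a subset of `Γᵢ \ Γᵢ₊₁` which
meets every core subgraph of `Γᵢ` that is not contained in `Γᵢ₊₁` (`OrbitDatum`), and conversely the
points which belong to such data form one orbit: it is the torus of a face of a chart, so that it is
immersed (`OrbitDatum.immersion`), and the coordinates relative to `Γᵢ` restrict to it as the coordinates
of the `i`-th factor (`OrbitDatum.immersion_comp_projection`). Let `F` be the set of the edges which are
not among these non-vanishing coordinates for any `i`. As the cycles of a contraction are the restrictions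
of cycles (`HEGraph.exists_lift_of_contract`), the condition that core subgraphs be met says that `F` and
its images in the graphs `Γᵢ // Γᵢ₊₁` are forests (`HEGraph.isForest_contract_iff`).
-/

set_option linter.unusedSectionVars false

noncomputable section

/-! ### Morphisms to affine schemes -/

/-- The ring homomorphism `R ⟶ Γ(Z)` of a morphism `Z ⟶ Spec R`. -/
def specHom {Z : Scheme.{u}} {R : CommRingCat.{u}} (g : Z ⟶ Spec R) : R →+* Γ(Z, ⊤) :=
  ((Scheme.ΓSpecIso R).inv ≫ g.appTop).hom

lemma specHom_comp {Z W : Scheme.{u}} {R : CommRingCat.{u}} (h : W ⟶ Z) (g : Z ⟶ Spec R) :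
    specHom (h ≫ g) = h.appTop.hom.comp (specHom g) := by
  simp only [specHom, Scheme.Hom.comp_appTop, CommRingCat.hom_comp, RingHom.comp_assoc]

lemma specHom_map {Z : Scheme.{u}} {R R' : CommRingCat.{u}} (g : Z ⟶ Spec R) (φ : R' ⟶ R) :
    specHom (g ≫ Spec.map φ) = (specHom g).comp φ.hom := by
  rw [specHom, specHom, ← CommRingCat.hom_comp, Scheme.Hom.comp_appTop,
    ← Scheme.ΓSpecIso_inv_naturality_assoc]

lemma specHom_id (R : CommRingCat.{u}) : specHom (𝟙 (Spec R)) = (Scheme.ΓSpecIso R).inv.hom := by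
  simp [specHom]

lemma specHom_injective {Z : Scheme.{u}} {R : CommRingCat.{u}} :
    Function.Injective (specHom : (Z ⟶ Spec R) → _) := by
  intro f g h
  apply ext_of_isAffine
  have : (Scheme.ΓSpecIso R).inv ≫ f.appTop = (Scheme.ΓSpecIso R).inv ≫ g.appTop := by
    ext1; exact h
  exact (cancel_epi _).1 this

/-- The morphism `Z ⟶ Spec R` of a ring homomorphism `R ⟶ Γ(Z)`. -/
def toSpecOf {Z : Scheme.{u}} {R : CommRingCat.{u}} (φ : R →+* Γ(Z, ⊤)) : Z ⟶ Spec R :=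
  Z.toSpecΓ ≫ Spec.map (CommRingCat.ofHom φ)

@[simp] lemma specHom_toSpecOf {Z : Scheme.{u}} {R : CommRingCat.{u}} (φ : R →+* Γ(Z, ⊤)) :
    specHom (toSpecOf φ) = φ := by
  have : specHom Z.toSpecΓ = RingHom.id _ := by
    have h : (Scheme.ΓSpecIso Γ(Z, ⊤)).inv ≫ Z.toSpecΓ.appTop = 𝟙 _ := by
      rw [Scheme.toSpecΓ_appTop, Iso.inv_hom_id]
    rw [specHom, h]; rfl
  rw [toSpecOf, specHom_map, this]; rfl

/-! ### Affine toric schemes -/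

/-- The affine toric scheme `Spec K[N]` over `K` of a commutative monoid `N`. -/
@[reducible] def toricSpec (K N : Type u) [Field K] [AddCommMonoid N] :
    Over (Spec (CommRingCat.of K)) :=
  (Spec (CommRingCat.of (AddMonoidAlgebra K N))).asOver (Spec (CommRingCat.of K))

namespace toricSpec

variable {K : Type u} [Field K] {N N' : Type u} [AddCommMonoid N] [AddCommMonoid N']
  {Z W : Over (Spec (CommRingCat.of K))}

/-- The ring homomorphism `K[N] ⟶ Γ(Z)` of a morphism `Z ⟶ Spec K[N]`. -/
def ringHom (f : Z ⟶ toricSpec K N) : AddMonoidAlgebra K N →+* Γ(Z.left, ⊤) :=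
  specHom (R := .of (AddMonoidAlgebra K N)) f.left

/-- The function on `Z` that is the pull-back of the monomial `n` along `Z ⟶ Spec K[N]`. -/
def char (f : Z ⟶ toricSpec K N) (n : N) : Γ(Z.left, ⊤) :=
  ringHom f (AddMonoidAlgebra.single n 1)

/-- The structure homomorphism of the ring of functions of a `K`-scheme. -/
def scalars (Z : Over (Spec (CommRingCat.of K))) : K →+* Γ(Z.left, ⊤) :=
  specHom (R := .of K) Z.hom

lemma ringHom_algebraMap (f : Z ⟶ toricSpec K N) (r : K) :
    ringHom f (algebraMap K _ r) = scalars Z r := by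
  have h : f.left ≫ (toricSpec K N).hom = Z.hom := Over.w f
  rw [scalars, ← h]
  exact (congrArg (fun φ => φ r) (specHom_map (R := .of (AddMonoidAlgebra K N)) f.left
    (CommRingCat.ofHom (algebraMap K (AddMonoidAlgebra K N))))).symm

lemma ringHom_comp (g : W ⟶ Z) (f : Z ⟶ toricSpec K N) :
    ringHom (g ≫ f) = g.left.appTop.hom.comp (ringHom f) :=
  specHom_comp g.left _

@[simp] lemma char_comp (g : W ⟶ Z) (f : Z ⟶ toricSpec K N) (n : N) :
    char (g ≫ f) n = g.left.appTop.hom (char f n) := by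
  rw [char, ringHom_comp]; rfl

@[simp] lemma char_zero (f : Z ⟶ toricSpec K N) : char f 0 = 1 := by
  rw [char, ← AddMonoidAlgebra.one_def, map_one]

@[simp] lemma char_add (f : Z ⟶ toricSpec K N) (m n : N) :
    char f (m + n) = char f m * char f n := by
  rw [char, char, char, ← map_mul, AddMonoidAlgebra.single_mul_single, one_mul]

lemma hom_ext' {f g : Z ⟶ toricSpec K N} (h : ringHom f = ringHom g) : f = g :=
  Over.OverMorphism.ext (specHom_injective h)

/-- A morphism to `Spec K[N]` is determined by the pull-backs of the monomials. -/
lemma hom_ext {f g : Z ⟶ toricSpec K N} (h : ∀ n, char f n = char g n) : f = g := by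
  apply hom_ext'
  refine AddMonoidAlgebra.ringHom_ext (fun r => ?_) h
  have := (ringHom_algebraMap f r).trans (ringHom_algebraMap g r).symm
  exact this

/-- The morphism to `Spec K[N]` given by a monoid homomorphism from `N` to the functions on `Z`. -/
def lift (φ : Multiplicative N →* Γ(Z.left, ⊤)) : Z ⟶ toricSpec K N :=
  letI : Algebra K Γ(Z.left, ⊤) := (scalars Z).toAlgebra
  Over.homMk (toSpecOf (R := .of (AddMonoidAlgebra K N))
    (AddMonoidAlgebra.lift K Γ(Z.left, ⊤) N φ).toRingHom) (by
    apply specHom_injective (R := .of K)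
    refine (specHom_map (R := .of (AddMonoidAlgebra K N)) _ _).trans ?_
    rw [specHom_toSpecOf]
    exact (AddMonoidAlgebra.lift K Γ(Z.left, ⊤) N φ).comp_algebraMap)

@[simp] lemma char_lift (φ : Multiplicative N →* Γ(Z.left, ⊤)) (n : N) :
    char (lift φ) n = φ (Multiplicative.ofAdd n) := by
  let _ : Algebra K Γ(Z.left, ⊤) := (scalars Z).toAlgebra
  have h2 : ringHom (lift φ) = (AddMonoidAlgebra.lift K Γ(Z.left, ⊤) N φ).toRingHom :=
    specHom_toSpecOf (R := .of (AddMonoidAlgebra K N)) _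
  rw [char, h2]
  change AddMonoidAlgebra.lift K Γ(Z.left, ⊤) N φ (AddMonoidAlgebra.single n 1) = _
  simp

/-- The pull-backs of the monomials along a morphism to `Spec K[N]`, as a homomorphism. -/
def charHom (f : Z ⟶ toricSpec K N) : Multiplicative N →* Γ(Z.left, ⊤) where
  toFun n := char f n.toAdd
  map_one' := char_zero f
  map_mul' m n := char_add f m.toAdd n.toAdd

/-- The morphism `Spec K[N] ⟶ Spec K[N']` of a homomorphism `N' ⟶ N`. -/
def map (K : Type u) [Field K] (h : N' →+ N) : toricSpec K N ⟶ toricSpec K N' :=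
  Over.homMk (Spec.map (CommRingCat.ofHom (AddMonoidAlgebra.mapDomainAlgHom K K h).toRingHom)) (by
      refine (Spec.map_comp _ _).symm.trans (congrArg Spec.map ?_)
      rw [← CommRingCat.ofHom_comp]
      exact congrArg CommRingCat.ofHom (AddMonoidAlgebra.mapDomainAlgHom K K h).comp_algebraMap)

@[simp] lemma char_map (f : Z ⟶ toricSpec K N) (h : N' →+ N) (n : N') :
    char (f ≫ map K h) n = char f (h n) := by
  have h2 : ringHom (f ≫ map K h) = (ringHom f).comp
      (AddMonoidAlgebra.mapDomainAlgHom K K h).toRingHom :=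
    specHom_map (R := .of (AddMonoidAlgebra K N)) _ _
  rw [char, char, h2, RingHom.comp_apply]
  congr 1
  change AddMonoidAlgebra.mapDomain h (AddMonoidAlgebra.single n (1 : K)) = _
  simp

lemma char_id (n : N) : char (𝟙 (toricSpec K N)) n =
    (Scheme.ΓSpecIso (.of (AddMonoidAlgebra K N))).inv.hom (AddMonoidAlgebra.single n 1) :=
  congrArg (fun φ : AddMonoidAlgebra K N →+* _ => φ (AddMonoidAlgebra.single n 1))
    (specHom_id (.of (AddMonoidAlgebra K N)))

lemma map_comp_map {N'' : Type u} [AddCommMonoid N''] (h : N' →+ N) (h' : N'' →+ N') :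
    map K h ≫ map K h' = map K (h.comp h') := by
  refine hom_ext fun n => ?_
  rw [char_map, ← Category.id_comp (map K h), char_map, ← Category.id_comp (map K (h.comp h')),
    char_map]
  rfl

lemma map_comp_map_assoc {N'' : Type u} [AddCommMonoid N''] (h : N' →+ N) (h' : N'' →+ N')
    (f : toricSpec K N'' ⟶ Z) : map K h ≫ map K h' ≫ f = map K (h.comp h') ≫ f := by
  rw [← Category.assoc, map_comp_map]

section group

variable {M : Type u} [AddCommGroup M]

open TensorProduct

@[simp] lemma char_one (n : M) : char (MonObj.one (X := toricSpec K M)) n = 1 := by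
  have h2 : ringHom (MonObj.one (X := toricSpec K M)) =
      (Scheme.ΓSpecIso (.of K)).inv.hom.comp
        (Bialgebra.counitAlgHom K (AddMonoidAlgebra K M)).toRingHom := by
    refine (specHom_map (R := .of K) (𝟙 _) (CommRingCat.ofHom
      (Bialgebra.counitAlgHom K (AddMonoidAlgebra K M)).toRingHom)).trans ?_
    rw [specHom_id]; rfl
  rw [char, h2, RingHom.comp_apply]
  refine (congrArg _ ?_).trans (map_one _)
  change Coalgebra.counit (R := K) (AddMonoidAlgebra.single n (1 : K)) = (1 : K)
  simp

lemma char_mul' (n : M) : char (MonObj.mul (X := toricSpec K M)) n =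
    char (fst (toricSpec K M) (toricSpec K M)) n * char (snd (toricSpec K M) (toricSpec K M)) n := by
  let A := AddMonoidAlgebra K M
  let p : (toricSpec K M ⊗ toricSpec K M).left ⟶ Spec (.of (A ⊗[K] A)) := (pullbackSpecIso K A A).hom
  have h2 : ringHom (MonObj.mul (X := toricSpec K M)) =
      (specHom p).comp (Bialgebra.comulAlgHom K A).toRingHom := specHom_map p (CommRingCat.ofHom
      (Bialgebra.comulAlgHom K A).toRingHom)
  have h3 : ringHom (fst (toricSpec K M) (toricSpec K M)) =
      (specHom p).comp (algebraMap A (A ⊗[K] A)) := by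
    refine Eq.trans ?_ (specHom_map p (CommRingCat.ofHom (algebraMap A (A ⊗[K] A))))
    exact congrArg (specHom (R := .of A)) (pullbackSpecIso_hom_fst K A A).symm
  have h4 : ringHom (snd (toricSpec K M) (toricSpec K M)) =
      (specHom p).comp (Algebra.TensorProduct.includeRight : A →ₐ[K] (A ⊗[K] A)).toRingHom := by
    refine Eq.trans ?_ (specHom_map p (CommRingCat.ofHom
      (Algebra.TensorProduct.includeRight : A →ₐ[K] (A ⊗[K] A)).toRingHom))
    exact congrArg (specHom (R := .of A)) (pullbackSpecIso_hom_snd K A A).symm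
  simp only [char]
  rw [h2, h3, h4]
  simp only [RingHom.comp_apply]
  rw [← map_mul]
  congr 1
  change Coalgebra.comul (R := K) (AddMonoidAlgebra.single n (1 : K)) =
    (AddMonoidAlgebra.single n (1:K) ⊗ₜ[K] (1 : AddMonoidAlgebra K M)) *
      ((1 : AddMonoidAlgebra K M) ⊗ₜ[K] AddMonoidAlgebra.single n (1:K))
  simp only [AddMonoidAlgebra.comul_single, CommSemiring.comul_apply, TensorProduct.map_tmul,
    Algebra.TensorProduct.tmul_mul_tmul, one_mul, mul_one]
  rfl

lemma char_mul (a b : Z ⟶ toricSpec K M) (n : M) :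
    char (CartesianMonoidalCategory.lift a b ≫ MonObj.mul) n = char a n * char b n := by
  rw [char_comp, char_mul', map_mul, ← char_comp, ← char_comp, lift_fst, lift_snd]

end group

end toricSpec
end

noncomputable section

namespace toricSpec

variable {K : Type u} [Field K] {N N' : Type u} [AddCommMonoid N] [AddCommMonoid N']
  {Z W : Over (Spec (CommRingCat.of K))}

/-- The monomial `n` does not vanish at the point `y` of `Spec K[N]`. -/
def NonzeroAt (y : (toricSpec K N).left) (n : N) : Prop :=
  (AddMonoidAlgebra.single n 1 : AddMonoidAlgebra K N) ∉ (id y : PrimeSpectrum _).asIdeal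

lemma nonzeroAt_zero (y : (toricSpec K N).left) : NonzeroAt y 0 := by
  rw [NonzeroAt, ← AddMonoidAlgebra.one_def]
  exact fun h => (id y : PrimeSpectrum _).isPrime.ne_top ((Ideal.eq_top_iff_one _).2 h)

lemma nonzeroAt_add {y : (toricSpec K N).left} {m n : N} :
    NonzeroAt y (m + n) ↔ NonzeroAt y m ∧ NonzeroAt y n := by
  have : (AddMonoidAlgebra.single (m + n) 1 : AddMonoidAlgebra K N) =
    AddMonoidAlgebra.single m 1 * AddMonoidAlgebra.single n 1 := by
      rw [AddMonoidAlgebra.single_mul_single, one_mul]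
  rw [NonzeroAt, NonzeroAt, NonzeroAt, this,
    (id y : PrimeSpectrum _).isPrime.mul_mem_iff_mem_or_mem, not_or]

lemma nonzeroAt_sum {y : (toricSpec K N).left} {ι : Type*} (s : Finset ι) (f : ι → N) :
    NonzeroAt y (∑ i ∈ s, f i) ↔ ∀ i ∈ s, NonzeroAt y (f i) := by
  classical
  induction s using Finset.induction_on with
  | empty => simp [nonzeroAt_zero]
  | insert a s ha ih => rw [Finset.sum_insert ha, nonzeroAt_add, ih, Finset.forall_mem_insert]

@[simp] lemma nonzeroAt_map (h : N' →+ N) (y : (toricSpec K N).left) (n : N') :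
    NonzeroAt ((map K h).left y) n ↔ NonzeroAt y (h n) := by
  have : AddMonoidAlgebra.mapDomainAlgHom K K h (AddMonoidAlgebra.single n 1) =
      AddMonoidAlgebra.single (h n) 1 := by
    change AddMonoidAlgebra.mapDomain h (AddMonoidAlgebra.single n (1 : K)) = _
    simp
  rw [NonzeroAt, NonzeroAt, ← this]
  rfl

lemma isDomain [TwoUniqueSums N] : IsDomain (AddMonoidAlgebra K N) :=
  NoZeroDivisors.to_isDomain _

instance isIntegral [TwoUniqueSums N] : IsIntegral (toricSpec K N).left :=
  have : IsDomain (CommRingCat.of (AddMonoidAlgebra K N)) := isDomain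
  inferInstanceAs (IsIntegral (Spec (.of (AddMonoidAlgebra K N))))

lemma map_isDominant {h : N' →+ N} (hh : Function.Injective h) : IsDominant (map K h).left := by
  have hinj : Function.Injective (AddMonoidAlgebra.mapDomainAlgHom K K h).toRingHom :=
    AddMonoidAlgebra.mapDomain_injective hh
  have : DenseRange (PrimeSpectrum.comap (AddMonoidAlgebra.mapDomainAlgHom K K h).toRingHom) := by
    rw [PrimeSpectrum.denseRange_comap_iff_ker_le_nilRadical,
      (RingHom.injective_iff_ker_eq_bot _).1 hinj]
    exact bot_le
  exact ⟨this⟩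

lemma map_isClosedImmersion_of_surjective {R : Type u} [CommRing R]
    (φ : AddMonoidAlgebra K N →+* R) (h : Function.Surjective φ) :
    IsClosedImmersion (Spec.map (CommRingCat.ofHom φ)) :=
  IsClosedImmersion.spec_of_surjective _ h

section localization

variable {h : N' →+ N} (hh : Function.Injective h) {w : N'} {v : N} (hv : h w + v = 0)
  (hs : ∀ n : N, ∃ (k : ℕ) (n' : N'), n + k • h w = h n')

include hh hv hs in
lemma isLocalization_away :
    letI := (AddMonoidAlgebra.mapDomainAlgHom K K h).toRingHom.toAlgebra
    IsLocalization.Away (AddMonoidAlgebra.single w 1 : AddMonoidAlgebra K N')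
      (AddMonoidAlgebra K N) := by
  let _ := (AddMonoidAlgebra.mapDomainAlgHom K K h).toRingHom.toAlgebra
  have hmap (x : AddMonoidAlgebra K N') : algebraMap (AddMonoidAlgebra K N')
    (AddMonoidAlgebra K N) x = AddMonoidAlgebra.mapDomain h x := rfl
  have hsingle (n : N') : algebraMap (AddMonoidAlgebra K N')
      (AddMonoidAlgebra K N) (AddMonoidAlgebra.single n 1) = AddMonoidAlgebra.single (h n) 1 := by
    rw [hmap]; simp
  refine ⟨⟨?_, ?_, ?_⟩⟩
  · rintro ⟨_, k, rfl⟩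
    simp only [map_pow]
    refine IsUnit.pow _ (IsUnit.of_mul_eq_one (AddMonoidAlgebra.single v 1) ?_)
    rw [hsingle, AddMonoidAlgebra.single_mul_single, hv, one_mul, AddMonoidAlgebra.one_def]
  · intro z
    suffices H : ∃ k : ℕ, ∃ x, z * algebraMap (AddMonoidAlgebra K N') (AddMonoidAlgebra K N)
        (AddMonoidAlgebra.single w 1) ^ k = algebraMap (AddMonoidAlgebra K N') _ x by
      obtain ⟨k, x, hx⟩ := H
      exact ⟨(x, ⟨_, k, rfl⟩), by rw [← hx, map_pow]⟩
    induction z using AddMonoidAlgebra.induction_on with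
    | of n =>
      obtain ⟨k, n', hn⟩ := hs n
      refine ⟨k, AddMonoidAlgebra.single n' 1, ?_⟩
      rw [hsingle, hsingle, ← hn, AddMonoidAlgebra.single_pow]
      simp [AddMonoidAlgebra.of_apply, AddMonoidAlgebra.single_mul_single]
    | add f g hf hg =>
      obtain ⟨k, x, hx⟩ := hf
      obtain ⟨l, y, hy⟩ := hg
      refine ⟨k + l, x * AddMonoidAlgebra.single w 1 ^ l + y * AddMonoidAlgebra.single w 1 ^ k, ?_⟩
      rw [map_add, map_mul, map_mul, ← hx, ← hy, map_pow, map_pow]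
      ring
    | smul r f hf =>
      obtain ⟨k, x, hx⟩ := hf
      refine ⟨k, r • x, ?_⟩
      rw [smul_mul_assoc, hx]
      exact (map_smul (AddMonoidAlgebra.mapDomainAlgHom K K h) r x).symm
  · intro x y hxy
    refine ⟨1, ?_⟩
    rw [AddMonoidAlgebra.mapDomain_injective hh hxy]

include hh hv hs in
/-- Inverting a monomial `w` yields an open immersion. -/
lemma map_isOpenImmersion : IsOpenImmersion (map K h).left := by
  let _ := (AddMonoidAlgebra.mapDomainAlgHom K K h).toRingHom.toAlgebra
  have := isLocalization_away (K := K) hh hv hs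
  exact IsOpenImmersion.of_isLocalization (R := AddMonoidAlgebra K N')
    (S := AddMonoidAlgebra K N) (AddMonoidAlgebra.single w 1)

include hh hv hs in
lemma mem_range_map_iff (y : (toricSpec K N').left) :
    y ∈ Set.range (map K h).left ↔ NonzeroAt y w := by
  let _ := (AddMonoidAlgebra.mapDomainAlgHom K K h).toRingHom.toAlgebra
  have := isLocalization_away (K := K) hh hv hs
  have h2 := PrimeSpectrum.localization_away_comap_range (AddMonoidAlgebra K N)
    (AddMonoidAlgebra.single w 1 : AddMonoidAlgebra K N')
  exact Set.ext_iff.1 h2 y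

end localization

lemma char_map' (h : N' →+ N) (n : N') : char (map K h) n = char (𝟙 _) (h n) := by
  rw [← Category.id_comp (map K h), char_map]

/-- The morphism `Spec K[N] × Spec K[N'] ⟶ Spec K[N × N']`. -/
def prodInv (K N N' : Type u) [Field K] [AddCommMonoid N] [AddCommMonoid N'] :
    toricSpec K N ⊗ toricSpec K N' ⟶ toricSpec K (N × N') :=
  lift
    { toFun n := char (fst (toricSpec K N) (toricSpec K N')) n.toAdd.1 *
        char (snd (toricSpec K N) (toricSpec K N')) n.toAdd.2
      map_one' := by simp
      map_mul' m n := by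
        simp only [toAdd_mul, Prod.fst_add, Prod.snd_add, char_add]
        ring }

lemma char_prodInv (n : N × N') : char (prodInv K N N') n =
    char (fst (toricSpec K N) (toricSpec K N')) n.1 *
      char (snd (toricSpec K N) (toricSpec K N')) n.2 := by
  rw [prodInv, char_lift]; rfl

/-- `Spec K[N] × Spec K[N'] ≅ Spec K[N × N']`. -/
def prodIso (K N N' : Type u) [Field K] [AddCommMonoid N] [AddCommMonoid N'] :
    toricSpec K (N × N') ≅ toricSpec K N ⊗ toricSpec K N' where
  hom := CartesianMonoidalCategory.lift (map K (AddMonoidHom.inl N N'))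
    (map K (AddMonoidHom.inr N N'))
  inv := prodInv K N N'
  hom_inv_id := by
    refine hom_ext fun n => ?_
    rw [char_comp, char_prodInv, map_mul, ← char_comp, ← char_comp, lift_fst, lift_snd,
      char_map', char_map', ← char_add]
    congr 1
    simp
  inv_hom_id := by
    refine CartesianMonoidalCategory.hom_ext _ _ ?_ ?_
    · rw [Category.assoc, lift_fst, Category.id_comp]
      refine hom_ext fun n => ?_
      rw [char_map, char_prodInv, AddMonoidHom.inl_apply, char_zero, mul_one]
    · rw [Category.assoc, lift_snd, Category.id_comp]
      refine hom_ext fun n => ?_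
      rw [char_map, char_prodInv, AddMonoidHom.inr_apply, char_zero, one_mul]

lemma char_prodIso_inv (n : N × N') : char (prodIso K N N').inv n =
    char (fst (toricSpec K N) (toricSpec K N')) n.1 *
      char (snd (toricSpec K N) (toricSpec K N')) n.2 :=
  char_prodInv n

instance isIntegral_prod [TwoUniqueSums N] [TwoUniqueSums N'] :
    IsIntegral (toricSpec K N ⊗ toricSpec K N').left :=
  have e : (toricSpec K (N × N')).left ≅ (toricSpec K N ⊗ toricSpec K N').left :=
    (Over.forget _).mapIso (prodIso K N N')
  have : Nonempty (toricSpec K N ⊗ toricSpec K N').left :=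
    ((inferInstance : Nonempty (toricSpec K (N × N')).left)).map e.hom
  isIntegral_of_isOpenImmersion e.inv

lemma whiskerLeft_map_isDominant {M : Type u} [AddCommMonoid M] {h : N' →+ N}
    (hh : Function.Injective h) : IsDominant (toricSpec K M ◁ map K h).left := by
  have h1 : toricSpec K M ◁ map K h ≫ (prodIso K M N').inv = (prodIso K M N).inv ≫
      map K ((AddMonoidHom.id M).prodMap h) := by
    refine hom_ext fun n => ?_
    rw [char_comp, char_prodIso_inv, map_mul, ← char_comp, ← char_comp,
      whiskerLeft_fst, whiskerLeft_snd, char_map, char_map, char_prodIso_inv]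
    rfl
  rw [Iso.comp_inv_eq] at h1
  have := map_isDominant (K := K) (h := (AddMonoidHom.id M).prodMap h)
    (Function.injective_id.prodMap hh)
  have : IsIso (prodIso K M N).inv.left :=
    inferInstanceAs (IsIso ((Over.forget _).mapIso (prodIso K M N)).inv)
  have : IsIso (prodIso K M N').hom.left :=
    inferInstanceAs (IsIso ((Over.forget _).mapIso (prodIso K M N')).hom)
  rw [h1]
  change IsDominant (((prodIso K M N).inv.left ≫ _) ≫ (prodIso K M N').hom.left)
  infer_instance

end toricSpec

/-! ### Gluing by density -/

/-- Morphisms on the members of an open cover by reduced schemes, with a separated target, glue as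
soon as they agree on a scheme which is dense in all members of the cover. -/
lemma exists_glue_of_isDominant {S : Scheme.{u}} {Z Y D : Over S} [IsSeparated Y.hom] {ι : Type u}
    (U : ι → Over S) (j : ∀ i, U i ⟶ Z) (hj : ∀ i, IsOpenImmersion (j i).left)
    (hcov : ∀ z : Z.left, ∃ i, z ∈ Set.range (j i).left) [∀ i, IsReduced (U i).left]
    (d : ∀ i, D ⟶ U i) [∀ i, IsDominant (d i).left] (hd : ∀ i i', d i ≫ j i = d i' ≫ j i')
    (g : ∀ i, U i ⟶ Y) (hg : ∀ i i', d i ≫ g i = d i' ≫ g i') :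
    ∃ f : Z ⟶ Y, ∀ i, j i ≫ f = g i := by
  let 𝒰 : Z.left.OpenCover := Scheme.Cover.mkOfCovers (P := @IsOpenImmersion) ι
    (fun i => (U i).left) (fun i => (j i).left) (fun z => hcov z) hj
  have hglue : ∀ x y : ι, pullback.fst (j x).left (j y).left ≫ (g x).left =
      pullback.snd (j x).left (j y).left ≫ (g y).left := by
    intro x y
    have := hj x
    have := hj y
    let l : D.left ⟶ pullback (j x).left (j y).left := pullback.lift (d x).left (d y).left (by
      simpa using congrArg (fun f => f.left) (hd x y))
    have hl : l ≫ pullback.fst _ _ = (d x).left := pullback.lift_fst _ _ _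
    have hl' : l ≫ pullback.snd _ _ = (d y).left := pullback.lift_snd _ _ _
    have : IsDominant (l ≫ pullback.fst (j x).left (j y).left) := by rw [hl]; infer_instance
    have : IsDominant l := IsDominant.of_comp_of_isOpenImmersion l (pullback.fst _ _)
    have : IsReduced (pullback (j x).left (j y).left) :=
      isReduced_of_isOpenImmersion (pullback.fst (j x).left (j y).left)
    refine ext_of_isDominant_of_isSeparated Y.hom ?_ l ?_
    · rw [Category.assoc, Category.assoc, Over.w, Over.w, ← Over.w (j x), ← Over.w (j y),
        pullback.condition_assoc]
    · rw [reassoc_of% hl, reassoc_of% hl']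
      simpa using congrArg (fun f => f.left) (hg x y)
  have h1 (i : ι) : (j i).left ≫ Scheme.Cover.glueMorphisms 𝒰 (fun i => (g i).left) hglue =
    (g i).left := Scheme.Cover.ι_glueMorphisms 𝒰 (fun i => (g i).left) hglue i
  refine ⟨Over.homMk (Scheme.Cover.glueMorphisms 𝒰 (fun i => (g i).left) hglue) ?_, fun i => ?_⟩
  · refine Scheme.Cover.hom_ext 𝒰 _ _ fun i => ?_
    refine (Category.assoc _ _ _).symm.trans ?_
    refine (congrArg (· ≫ Y.hom) (h1 i)).trans ?_
    exact (Over.w (g i)).trans (Over.w (j i)).symm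
  · ext1
    exact h1 i

/-- Morphisms may be compared on the members of an open cover. -/
lemma hom_ext_of_cover {S : Scheme.{u}} {Z Y : Over S} {ι : Type u}
    (U : ι → Over S) (j : ∀ i, U i ⟶ Z) (hj : ∀ i, IsOpenImmersion (j i).left)
    (hcov : ∀ z : Z.left, ∃ i, z ∈ Set.range (j i).left) {f g : Z ⟶ Y}
    (h : ∀ i, j i ≫ f = j i ≫ g) : f = g := by
  let 𝒰 : Z.left.OpenCover := Scheme.Cover.mkOfCovers (P := @IsOpenImmersion) ι
    (fun i => (U i).left) (fun i => (j i).left) (fun z => hcov z) hj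
  ext1
  refine Scheme.Cover.hom_ext 𝒰 _ _ fun i => ?_
  exact congrArg (fun f => f.left) (h i)

end

noncomputable section

/-! ### Toric atlases of sums of simplices -/

namespace charLattice

variable {E : Type u}

instance : TwoUniqueSums (charLattice E) :=
  TwoUniqueSums.of_injective_addHom (charLattice E).subtype.toAddHom Subtype.val_injective
    inferInstance

instance {M : Type u} [AddCommMonoid M] [TwoUniqueSums M] (N : AddSubmonoid M) : TwoUniqueSums N :=
  TwoUniqueSums.of_injective_addHom N.subtype.toAddHom Subtype.val_injective inferInstance

@[simp] lemma ratio_self (a : E) : ratio a a = 0 := Subtype.ext (sub_self _)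

lemma ratio_add_ratio (a b c : E) : ratio a b + ratio b c = ratio a c :=
  Subtype.ext (sub_add_sub_cancel _ _ _)

lemma neg_ratio (a b : E) : -ratio a b = ratio b a := Subtype.ext (neg_sub _ _)

end charLattice

open charLattice

/-- A choice of an element in every member of a family of sets. -/
abbrev Sel {E : Type u} (G : Set (Set E)) : Type u := ∀ S : G, (S : Set E)

variable {K E : Type u} [Field K] {G : Set (Set E)}

/-- The monoid generated by the ratios `X_a / X_b` with `a ∈ S ∈ G`, where `b` is the element
chosen in `S`. -/
def chartMonoid (c : Sel G) : AddSubmonoid (charLattice E) :=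
  AddSubmonoid.closure {m | ∃ S : G, ∃ a ∈ (S : Set E), m = ratio a (c S)}

lemma ratio_mem_chartMonoid (c : Sel G) (S : G) {a : E} (ha : a ∈ (S : Set E)) :
    ratio a (c S) ∈ chartMonoid c :=
  AddSubmonoid.subset_closure ⟨S, a, ha, rfl⟩

/-- The generator `X_a / X_b` of `chartMonoid c`, for `a ∈ S`, where `b` is chosen in `S`. -/
def chartGen (c : Sel G) (S : G) (a : (S : Set E)) : chartMonoid c :=
  ⟨ratio a (c S), ratio_mem_chartMonoid c S a.2⟩

/-- An atlas of a separated `K`-scheme `X` by the affine toric schemes `Spec K[chartMonoid c]`, which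
contain a common torus and meet as they do in the toric variety of the sum of the simplices with
vertices in the members of `G`. -/
structure Atlas (G : Set (Set E)) (X : Over (Spec (CommRingCat.of K))) where
  chart (c : Sel G) : toricSpec K (chartMonoid c) ⟶ X
  isOpenImmersion (c : Sel G) : IsOpenImmersion (chart c).left
  covers (x : X.left) : ∃ c, x ∈ Set.range (chart c).left
  incl : torus K E ⟶ X
  map_chart (c : Sel G) : toricSpec.map K (chartMonoid c).subtype ≫ chart c = incl
  mem_range (c c' : Sel G) (y : (toricSpec K (chartMonoid c)).left) :
    (chart c).left y ∈ Set.range (chart c').left ↔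
      ∀ S, toricSpec.NonzeroAt y (chartGen c S (c' S))
  isSeparated : IsSeparated X.hom

namespace Atlas

open toricSpec

attribute [instance] isOpenImmersion

variable {X : Over (Spec (CommRingCat.of K))} (A : Atlas G X)

/-- Transport of an atlas along an isomorphism. -/
def ofIso {Y : Over (Spec (CommRingCat.of K))} (e : X ≅ Y) : Atlas G Y where
  chart c := A.chart c ≫ e.hom
  isOpenImmersion c := by
    have : IsIso e.hom.left := inferInstanceAs (IsIso ((Over.forget _).mapIso e).hom)
    rw [Over.comp_left]
    infer_instance
  covers y := by
    obtain ⟨c, z, hz⟩ := A.covers (e.inv.left y)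
    refine ⟨c, z, ?_⟩
    rw [Over.comp_left, Scheme.Hom.comp_apply, hz, ← Scheme.Hom.comp_apply, ← Over.comp_left,
      e.inv_hom_id]
    rfl
  incl := A.incl ≫ e.hom
  map_chart c := by rw [← A.map_chart c, Category.assoc]
  mem_range c c' y := by
    rw [← A.mem_range]
    have hinj : Function.Injective e.hom.left := by
      have : IsIso e.hom.left := inferInstanceAs (IsIso ((Over.forget _).mapIso e).hom)
      exact (Scheme.Hom.isOpenEmbedding e.hom.left).injective
    simp only [Set.mem_range, Over.comp_left, Scheme.Hom.comp_apply, hinj.eq_iff]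
  isSeparated := by
    have := A.isSeparated
    have : IsIso e.inv.left := inferInstanceAs (IsIso ((Over.forget _).mapIso e).inv)
    rw [← Over.w e.inv]
    infer_instance

instance (c : Sel G) : IsDominant (toricSpec.map K (chartMonoid c).subtype).left :=
  map_isDominant Subtype.val_injective

/-- Morphisms on the charts glue if they agree on the torus. -/
lemma exists_glue {Y : Over (Spec (CommRingCat.of K))} [IsSeparated Y.hom]
    (g : ∀ c : Sel G, toricSpec K (chartMonoid c) ⟶ Y) (h : torus K E ⟶ Y)
    (hg : ∀ c, toricSpec.map K (chartMonoid c).subtype ≫ g c = h) :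
    ∃ f : X ⟶ Y, ∀ c, A.chart c ≫ f = g c :=
  exists_glue_of_isDominant _ A.chart A.isOpenImmersion A.covers
    (fun c => toricSpec.map K (chartMonoid c).subtype) (fun c c' => by rw [A.map_chart, A.map_chart])
    g (fun c c' => by rw [hg, hg])

section prod

variable (M : Over (Spec (CommRingCat.of K)))

instance isOpenImmersion_whiskerLeft (c : Sel G) : IsOpenImmersion (M ◁ A.chart c).left := by
  rw [Over.whiskerLeft_left]
  infer_instance

lemma covers_whiskerLeft (z : (M ⊗ X).left) : ∃ c, z ∈ Set.range (M ◁ A.chart c).left := by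
  obtain ⟨c, hc⟩ := A.covers ((snd M X).left z)
  refine ⟨c, ?_⟩
  rw [Over.whiskerLeft_left, Scheme.Pullback.range_map]
  · refine ⟨?_, hc⟩
    simp

end prod

/-- Morphisms on the product with a torus may be compared on the charts. -/
lemma prod_hom_ext (M : Over (Spec (CommRingCat.of K))) {Y : Over (Spec (CommRingCat.of K))}
    {f g : M ⊗ X ⟶ Y} (h : ∀ c, M ◁ A.chart c ≫ f = M ◁ A.chart c ≫ g) : f = g :=
  hom_ext_of_cover _ (fun c => M ◁ A.chart c) (A.isOpenImmersion_whiskerLeft M)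
    (A.covers_whiskerLeft M) h

lemma exists_glue_prod {Y : Over (Spec (CommRingCat.of K))} [IsSeparated Y.hom]
    (g : ∀ c : Sel G, torus K E ⊗ toricSpec K (chartMonoid c) ⟶ Y) (h : torus K E ⊗ torus K E ⟶ Y)
    (hg : ∀ c, torus K E ◁ toricSpec.map K (chartMonoid c).subtype ≫ g c = h) :
    ∃ f : torus K E ⊗ X ⟶ Y, ∀ c, torus K E ◁ A.chart c ≫ f = g c :=
  have (c : Sel G) : IsDominant (torus K E ◁ toricSpec.map K (chartMonoid c).subtype).left :=
    whiskerLeft_map_isDominant Subtype.val_injective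
  exists_glue_of_isDominant _ (fun c => torus K E ◁ A.chart c) (A.isOpenImmersion_whiskerLeft _)
    (A.covers_whiskerLeft _) (fun c => torus K E ◁ toricSpec.map K (chartMonoid c).subtype)
    (fun c c' => by
      rw [← MonoidalCategory.whiskerLeft_comp, ← MonoidalCategory.whiskerLeft_comp, A.map_chart,
        A.map_chart])
    g (fun c c' => by rw [hg, hg])

/-- The set of `a ∈ S` such that the coordinate `X_a` of the simplex of `S` does not vanish at
`x`. -/
def nz (S : G) (x : X.left) : Set E :=
  {a | ∃ c : Sel G, (c S : E) = a ∧ x ∈ Set.range (A.chart c).left}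

lemma nz_subset (S : G) (x : X.left) : A.nz S x ⊆ S := by
  rintro _ ⟨c, rfl, -⟩
  exact (c S).2

lemma mem_nz_of_mem_range {c : Sel G} {x : X.left} (h : x ∈ Set.range (A.chart c).left) (S : G) :
    (c S : E) ∈ A.nz S x := ⟨c, rfl, h⟩

lemma nz_nonempty (S : G) (x : X.left) : (A.nz S x).Nonempty := by
  obtain ⟨c, hc⟩ := A.covers x
  exact ⟨_, A.mem_nz_of_mem_range hc S⟩

lemma chartGen_self (c : Sel G) (S : G) : chartGen c S (c S) = 0 := Subtype.ext (ratio_self _)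

lemma mem_nz_chart_iff (c : Sel G) (y : (toricSpec K (chartMonoid c)).left) (S : G)
    (a : (S : Set E)) :
    (a : E) ∈ A.nz S ((A.chart c).left y) ↔ NonzeroAt y (chartGen c S a) := by
  classical
  constructor
  · rintro ⟨c', hc', h⟩
    have := (A.mem_range c c' y).1 h S
    rwa [Subtype.ext hc'] at this
  · intro h
    refine ⟨Function.update c S a, by simp, (A.mem_range _ _ _).2 fun S' => ?_⟩
    by_cases hS : S' = S
    · subst hS
      simpa using h
    · rw [Function.update_of_ne hS, chartGen_self]
      exact nonzeroAt_zero y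

lemma mem_range_iff (c : Sel G) (x : X.left) :
    x ∈ Set.range (A.chart c).left ↔ ∀ S, (c S : E) ∈ A.nz S x := by
  refine ⟨fun h S => A.mem_nz_of_mem_range h S, fun h => ?_⟩
  obtain ⟨c', y, rfl⟩ := A.covers x
  exact (A.mem_range _ _ _).2 fun S => (A.mem_nz_chart_iff c' y S (c S)).1 (h S)

/-- Coordinates of comparable simplices vanish together, unless all those of the smaller
simplex vanish in the larger one. -/
lemma nz_eq_inter {S S' : G} (hSS' : (S : Set E) ⊆ S') (x : X.left)
    (h : (A.nz S' x ∩ S).Nonempty) : A.nz S x = A.nz S' x ∩ S := by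
  classical
  obtain ⟨b, hb, hbS⟩ := h
  choose c₀ hc₀ using fun T : G => A.nz_nonempty T x
  let c : Sel G := Function.update (fun T => ⟨c₀ T, A.nz_subset _ _ (hc₀ T)⟩) S'
    ⟨b, A.nz_subset _ _ hb⟩
  have hcS' : (c S' : E) = b := by simp [c]
  have hc : x ∈ Set.range (A.chart c).left := by
    rw [A.mem_range_iff]
    intro T
    by_cases hT : T = S'
    · subst hT; rw [hcS']; exact hb
    · simp only [c, Function.update_of_ne hT]; exact hc₀ T
  clear_value c
  obtain ⟨y, rfl⟩ := hc
  have hadd (a : (S : Set E)) : chartGen c S' ⟨a, hSS' a.2⟩ =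
      chartGen c S a + chartGen c S' ⟨c S, hSS' (c S).2⟩ :=
    Subtype.ext (ratio_add_ratio _ _ _).symm
  have hnz : NonzeroAt y (chartGen c S' ⟨c S, hSS' (c S).2⟩) := by
    have h0 := hadd ⟨b, hbS⟩
    have h1 : chartGen c S' ⟨b, hSS' hbS⟩ = 0 := by
      rw [← chartGen_self c S']; congr 1; exact Subtype.ext hcS'.symm
    rw [h1] at h0
    exact (nonzeroAt_add.1 (h0 ▸ nonzeroAt_zero y)).2
  ext a
  constructor
  · intro ha
    have haS := A.nz_subset _ _ ha
    refine ⟨?_, haS⟩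
    rw [A.mem_nz_chart_iff c y S' ⟨a, hSS' haS⟩, hadd ⟨a, haS⟩, nonzeroAt_add]
    exact ⟨(A.mem_nz_chart_iff c y S ⟨a, haS⟩).1 ha, hnz⟩
  · rintro ⟨ha, haS⟩
    rw [A.mem_nz_chart_iff c y S ⟨a, haS⟩]
    rw [A.mem_nz_chart_iff c y S' ⟨a, hSS' haS⟩, hadd ⟨a, haS⟩, nonzeroAt_add] at ha
    exact ha.1

section integral

variable [hne : Nonempty (Sel G)]

include A hne in
lemma incl_isDominant : IsDominant A.incl.left := by
  obtain ⟨c⟩ := hne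
  constructor
  rw [DenseRange, dense_iff_closure_eq, Set.eq_univ_iff_forall]
  intro x
  obtain ⟨c, y, rfl⟩ := A.covers x
  have h1 : DenseRange (toricSpec.map K (chartMonoid c).subtype).left :=
    (inferInstance : IsDominant (toricSpec.map K (chartMonoid c).subtype).left).denseRange
  have h2 := (A.chart c).left.continuous.range_subset_closure_image_dense h1 ⟨y, rfl⟩
  refine closure_mono ?_ h2
  rintro _ ⟨_, ⟨t, rfl⟩, rfl⟩
  refine ⟨t, ?_⟩
  rw [← A.map_chart c]
  rfl

include A hne in
lemma isIntegral : IsIntegral X.left := by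
  have hred : IsReduced X.left := by
    have (x : X.left) : _root_.IsReduced (X.left.presheaf.stalk x) := by
      obtain ⟨c, y, rfl⟩ := A.covers x
      exact isReduced_of_injective ((A.chart c).left.stalkMap y).hom
        (ConcreteCategory.bijective_of_isIso ((A.chart c).left.stalkMap y)).1
    exact isReduced_of_isReduced_stalk _
  have hirr : IrreducibleSpace X.left := by
    have hd := (A.incl_isDominant).denseRange
    have h1 : IrreducibleSpace (torus K E).left := inferInstance
    have h2 : IsIrreducible (Set.range A.incl.left) := by
      rw [← Set.image_univ]
      exact (IrreducibleSpace.isIrreducible_univ _).image _ A.incl.left.continuous.continuousOn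
    have h3 := h2.closure
    rw [hd.closure_range] at h3
    exact { isPreirreducible_univ := h3.2, toNonempty := ⟨h3.1.some⟩ }
  exact isIntegral_of_irreducibleSpace_of_isReduced _

end integral

end Atlas

end

noncomputable section

/-! ### Points of projective spectra -/

namespace ProjPoint

open HomogeneousLocalization

variable {σ A : Type u} [CommRing A] [SetLike σ A] [AddSubgroupClass σ A] (𝒜 : ℕ → σ)
  [GradedRing 𝒜] {R R' : Type u} [CommRing R] [CommRing R']

/-- The homomorphism from the degree zero part of `A_r` induced by a homomorphism from `A` which
makes `r` invertible. -/
def awayLift (f : A →+* R) {r : A} (hr : IsUnit (f r)) : Away 𝒜 r →+* R :=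
  (IsLocalization.Away.lift (S := Localization.Away r) r hr).comp
    (algebraMap (Away 𝒜 r) (Localization.Away r))

variable {𝒜}

lemma awayLift_mk (f : A →+* R) {r : A} (hr : IsUnit (f r)) {d : ℕ} (hd : r ∈ 𝒜 d) (n : ℕ) (a : A)
    (ha : a ∈ 𝒜 (n • d)) : awayLift 𝒜 f hr (Away.mk 𝒜 hd n a ha) * f r ^ n = f a := by
  have h1 : (algebraMap (Away 𝒜 r) (Localization.Away r)) (Away.mk 𝒜 hd n a ha) *
      algebraMap A (Localization.Away r) (r ^ n) = algebraMap A (Localization.Away r) a := by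
    rw [HomogeneousLocalization.algebraMap_apply, Away.val_mk, Localization.mk_eq_mk']
    exact IsLocalization.mk'_spec _ _ _
  have h2 := congrArg (IsLocalization.Away.lift (S := Localization.Away r) r hr) h1
  rw [map_mul, IsLocalization.Away.lift_eq, IsLocalization.Away.lift_eq, map_pow] at h2
  exact h2

lemma awayLift_unique (f : A →+* R) {r : A} (hr : IsUnit (f r)) {d : ℕ} (hd : r ∈ 𝒜 d)
    {g : Away 𝒜 r →+* R} (hg : ∀ n a ha, g (Away.mk 𝒜 hd n a ha) * f r ^ n = f a) :
    g = awayLift 𝒜 f hr := by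
  ext z
  obtain ⟨n, a, ha, rfl⟩ := Away.mk_surjective 𝒜 hd z
  refine (hr.pow n).mul_left_injective ?_
  exact (hg n a ha).trans (awayLift_mk f hr hd n a ha).symm

lemma awayLift_comp_awayMap (f : A →+* R) {r s x : A} (hx : x = r * s) (hxu : IsUnit (f x))
    (hr : IsUnit (f r)) {d e : ℕ} (hd : r ∈ 𝒜 d) (hs : s ∈ 𝒜 e) :
    (awayLift 𝒜 f hxu).comp (awayMap 𝒜 hs hx) = awayLift 𝒜 f hr := by
  refine awayLift_unique f hr hd fun n a ha => ?_
  have h1 : algebraMap (Away 𝒜 x) (Localization.Away x)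
      (awayMap 𝒜 hs hx (Away.mk 𝒜 hd n a ha)) * algebraMap A (Localization.Away x) (x ^ n) =
      algebraMap A (Localization.Away x) (a * s ^ n) := by
    rw [HomogeneousLocalization.algebraMap_apply, Away.mk, val_awayMap_mk, Localization.mk_eq_mk']
    exact IsLocalization.mk'_spec _ _ _
  have h2 := congrArg (IsLocalization.Away.lift (S := Localization.Away x) x hxu) h1
  have hfx : f x ^ n = f r ^ n * f s ^ n := by rw [hx, map_mul, mul_pow]
  rw [map_mul, IsLocalization.Away.lift_eq, IsLocalization.Away.lift_eq, map_mul, map_pow,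
    map_pow, hfx, ← mul_assoc] at h2
  have hsu : IsUnit (f s) := by
    rw [hx, map_mul] at hxu
    exact isUnit_of_mul_isUnit_right hxu
  exact (hsu.pow n).mul_left_injective h2

lemma comp_awayLift (φ : R →+* R') (f : A →+* R) {r : A} (hr : IsUnit (f r)) :
    φ.comp (awayLift 𝒜 f hr) = awayLift 𝒜 (φ.comp f) (hr.map φ) := by
  rw [awayLift, ← RingHom.comp_assoc]
  congr 1
  refine IsLocalization.ringHom_ext (Submonoid.powers r) ?_
  ext a
  simp

lemma awayLift_fromZero (f : A →+* R) {r : A} (hr : IsUnit (f r)) (a : 𝒜 0) :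
    awayLift 𝒜 f hr (fromZeroRingHom 𝒜 _ a) = f a := by
  have h1 : algebraMap (Away 𝒜 r) (Localization.Away r) (fromZeroRingHom 𝒜 _ a) =
      algebraMap A (Localization.Away r) a := by
    rw [HomogeneousLocalization.algebraMap_apply]
    exact Localization.mk_one_eq_algebraMap _
  rw [awayLift, RingHom.comp_apply, h1, IsLocalization.Away.lift_eq]

lemma Spec_map_awayLift_awayι_mul (f : A →+* R) {r s x : A} (hx : x = r * s) (hxu : IsUnit (f x))
    (hr : IsUnit (f r)) {d e : ℕ} (hd : r ∈ 𝒜 d) (hd0 : 0 < d) (hs : s ∈ 𝒜 e) :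
    Spec.map (CommRingCat.ofHom (awayLift 𝒜 f hr)) ≫ Proj.awayι 𝒜 r hd hd0 =
    Spec.map (CommRingCat.ofHom (awayLift 𝒜 f hxu)) ≫ Proj.awayι 𝒜 x
      (hx ▸ SetLike.mul_mem_graded hd hs) (hd0.trans_le (d.le_add_right e)) := by
  rw [← Proj.SpecMap_awayMap_awayι 𝒜 hd hd0 hs hx, ← Spec.map_comp_assoc,
    ← CommRingCat.ofHom_comp, awayLift_comp_awayMap f hx hxu hr hd hs]

lemma Spec_map_awayLift_awayι_eq (f : A →+* R) {r s : A} (hr : IsUnit (f r)) (hs : IsUnit (f s))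
    {d e : ℕ} (hd : r ∈ 𝒜 d) (hd0 : 0 < d) (he : s ∈ 𝒜 e) (he0 : 0 < e) :
    Spec.map (CommRingCat.ofHom (awayLift 𝒜 f hr)) ≫ Proj.awayι 𝒜 r hd hd0 =
    Spec.map (CommRingCat.ofHom (awayLift 𝒜 f hs)) ≫ Proj.awayι 𝒜 s he he0 := by
  have hxu : IsUnit (f (r * s)) := by rw [map_mul]; exact hr.mul hs
  rw [Spec_map_awayLift_awayι_mul f rfl hxu hr hd hd0 he,
    Spec_map_awayLift_awayι_mul f (mul_comm r s) hxu hs he he0 hd]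
  congr 2
  exact Nat.add_comm d e

/-- The morphism to `Proj` given by a ring homomorphism, in the chart of a homogeneous element that
becomes invertible. -/
lemma fromOfGlobalSections_eq {X : Scheme.{u}} (f : A →+* Γ(X, ⊤))
    (hf : (HomogeneousIdeal.irrelevant 𝒜).toIdeal.map f = ⊤) {r : A} (hr : IsUnit (f r)) {d : ℕ}
    (hd : r ∈ 𝒜 d) (hd0 : 0 < d) :
    Proj.fromOfGlobalSections 𝒜 f hf =
      toSpecOf (R := .of (Away 𝒜 r)) (awayLift 𝒜 f hr) ≫ Proj.awayι 𝒜 r hd hd0 := by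
  have hι : IsIso (X.basicOpen (f r)).ι := by
    rw [X.basicOpen_of_isUnit hr]
    exact inferInstanceAs (IsIso (Scheme.topIso X).hom)
  rw [← cancel_epi (X.basicOpen (f r)).ι]
  have h1 : (X.basicOpen (f r)).ι ≫ Proj.fromOfGlobalSections 𝒜 f hf =
      Proj.toBasicOpenOfGlobalSections 𝒜 f rfl hd0 hd ≫ (Proj.basicOpen 𝒜 r).ι :=
    (Proj.openCoverOfMapIrrelevantEqTop 𝒜 f hf).ι_glueMorphisms _ _ ⟨d, r, hd0, hd⟩
  rw [h1, Proj.toBasicOpenOfGlobalSections]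
  simp only [Category.assoc, Proj.basicOpenIsoSpec_inv_ι, toSpecOf]
  have h2 : CommRingCat.ofHom ((IsLocalization.map (M := Submonoid.powers r) (T := Submonoid.powers (f r))
      (Localization.Away (f r)) f (by
      rw [← Submonoid.map_le_iff_le_comap, Submonoid.map_powers]) :
      Localization.Away r →+* Localization.Away (f r)).comp
      (algebraMap (Away 𝒜 r) (Localization.Away r))) =
      CommRingCat.ofHom (awayLift 𝒜 f hr) ≫ CommRingCat.ofHom
        (algebraMap Γ(X, ⊤) (Localization.Away (f r))) := by
    rw [← CommRingCat.ofHom_comp, awayLift, ← RingHom.comp_assoc]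
    congr 2
    refine IsLocalization.ringHom_ext (Submonoid.powers r) ?_
    ext a
    simp
  rw [h2, Spec.map_comp, ← Category.assoc, ← Category.assoc, ← Category.assoc, ← Category.assoc,
    ← Category.assoc, ← Category.assoc]
  congr 2
  simp only [Category.assoc]
  rw [basicOpenIsoSpecAway_hom_SpecMap]
  refine (congrArg (_ ≫ ·) (morphismRestrict_ι X.toSpecΓ (PrimeSpectrum.basicOpen (f r)))).trans ?_
  exact Scheme.isoOfEq_inv_ι_assoc _ _ _

end ProjPoint

end

noncomputable section

/-! ### Atlases of projective spectra -/

open charLattice ProjPoint HomogeneousLocalization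

variable {K E : Type u} [Field K] {A : Type u} [CommRing A] [Algebra K A]

/-- The structure morphism of the projective spectrum of a graded `K`-algebra. -/
def projToSpec (𝒜 : ℕ → Submodule K A) [GradedAlgebra 𝒜] : Proj 𝒜 ⟶ Spec (CommRingCat.of K) :=
  Proj.toSpecZero 𝒜 ≫ Spec.map (CommRingCat.ofHom (algebraMap K (𝒜 0)))

/-- A graded `K`-algebra generated by elements of degree one indexed by the choices `c`, which is
embedded degreewise in the coordinate ring of the torus, such that the generators become the
vertices of the sum of the simplices in the family `G`. -/
structure GradedChartData (𝒜 : ℕ → Submodule K A) (G : Set (Set E)) [Fintype G] where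
  hom : A →ₐ[K] TorusRing K E
  gen : Sel G → A
  exponent : Sel G → charLattice E
  gen_mem (c : Sel G) : gen c ∈ 𝒜 1
  hom_gen (c : Sel G) : hom (gen c) = AddMonoidAlgebra.single (exponent c) 1
  exponent_eq (c c' : Sel G) : exponent c' = exponent c + ∑ S, ratio (c' S : E) (c S)
  hom_injOn (n : ℕ) (a : A) : a ∈ 𝒜 n → hom a = 0 → a = 0
  adjoin_gen : Algebra.adjoin K (Set.range gen) = ⊤

namespace GradedChartData

variable {𝒜 : ℕ → Submodule K A} [GradedAlgebra 𝒜] {G : Set (Set E)} [Fintype G]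
  (D : GradedChartData 𝒜 G)

lemma isUnit_hom_gen (c : Sel G) : IsUnit (D.hom.toRingHom (D.gen c)) := by
  refine IsUnit.of_mul_eq_one (AddMonoidAlgebra.single (-D.exponent c) 1) ?_
  change D.hom (D.gen c) * _ = 1
  rw [D.hom_gen, AddMonoidAlgebra.single_mul_single, add_neg_cancel, one_mul,
    AddMonoidAlgebra.one_def]

/-- The coordinate ring of the chart `gen c ≠ 0`, as a subring of that of the torus. -/
def away (c : Sel G) : Away 𝒜 (D.gen c) →+* TorusRing K E :=
  awayLift 𝒜 D.hom.toRingHom (D.isUnit_hom_gen c)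

lemma away_mk (c : Sel G) (n : ℕ) (a : A) (ha : a ∈ 𝒜 (n • 1)) :
    D.away c (Away.mk 𝒜 (D.gen_mem c) n a ha) * AddMonoidAlgebra.single (n • D.exponent c) 1 =
      D.hom a := by
  refine Eq.trans ?_ (awayLift_mk D.hom.toRingHom (D.isUnit_hom_gen c) (D.gen_mem c) n a ha)
  congr 1
  change _ = (D.hom (D.gen c)) ^ n
  rw [D.hom_gen, AddMonoidAlgebra.single_pow, one_pow]

lemma single_mul_injective (m : charLattice E) : Function.Injective
    fun z : TorusRing K E => z * AddMonoidAlgebra.single m 1 := by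
  refine IsUnit.mul_left_injective (IsUnit.of_mul_eq_one (AddMonoidAlgebra.single (-m) 1) ?_)
  rw [AddMonoidAlgebra.single_mul_single, add_neg_cancel, one_mul, AddMonoidAlgebra.one_def]

lemma away_injective (c : Sel G) : Function.Injective (D.away c) := by
  rw [injective_iff_map_eq_zero]
  intro z hz
  obtain ⟨n, a, ha, rfl⟩ := Away.mk_surjective 𝒜 (D.gen_mem c) z
  have h := D.away_mk c n a ha
  rw [hz, zero_mul] at h
  have ha0 := D.hom_injOn _ a ha h.symm
  subst ha0
  ext
  simp [Localization.mk_zero]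

/-- The inclusion of the coordinate ring of a chart in that of the torus. -/
def incl (K : Type u) [Field K] (c : Sel G) :
    AddMonoidAlgebra K (chartMonoid c) →ₐ[K] TorusRing K E :=
  AddMonoidAlgebra.mapDomainAlgHom K K (chartMonoid c).subtype

lemma incl_single (c : Sel G) (n : chartMonoid c) (r : K) :
    incl K c (AddMonoidAlgebra.single n r) = AddMonoidAlgebra.single n.1 r := by
  change AddMonoidAlgebra.mapDomain _ _ = _
  simp

lemma incl_injective (c : Sel G) : Function.Injective (incl K c) :=
  AddMonoidAlgebra.mapDomain_injective Subtype.val_injective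

lemma exponent_sub_mem (c c' : Sel G) : D.exponent c' - D.exponent c ∈ chartMonoid c := by
  rw [D.exponent_eq c c', add_sub_cancel_left]
  exact sum_mem fun S _ => ratio_mem_chartMonoid c S (c' S).2

lemma away_gen (c c' : Sel G) : D.away c (Away.mk 𝒜 (D.gen_mem c) 1 (D.gen c')
    (by simpa using D.gen_mem c')) =
    AddMonoidAlgebra.single (D.exponent c' - D.exponent c) 1 := by
  apply single_mul_injective (1 • D.exponent c)
  dsimp only
  rw [D.away_mk, D.hom_gen, AddMonoidAlgebra.single_mul_single, one_smul, sub_add_cancel, one_mul]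

/-- In degree `n`, division by the `n`-th power of `gen c` leads into the ring of the chart. -/
lemma exists_hom_eq (c : Sel G) (n : ℕ) (a : A) (ha : a ∈ 𝒜 n) :
    ∃ b, D.hom a = incl K c b * AddMonoidAlgebra.single (n • D.exponent c) 1 := by
  have key (w : A) (hw : w ∈ Submonoid.closure (Set.range D.gen)) : ∃ d, w ∈ 𝒜 d ∧
      ∃ b, D.hom w = incl K c b * AddMonoidAlgebra.single (d • D.exponent c) 1 := by
    induction hw using Submonoid.closure_induction with
    | mem w hw =>
      obtain ⟨c', rfl⟩ := hw
      refine ⟨1, D.gen_mem c', AddMonoidAlgebra.single ⟨_, D.exponent_sub_mem c c'⟩ 1, ?_⟩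
      rw [D.hom_gen, incl_single, AddMonoidAlgebra.single_mul_single]
      simp
    | one =>
      refine ⟨0, SetLike.GradedOne.one_mem, 1, ?_⟩
      rw [map_one, map_one, zero_smul, ← AddMonoidAlgebra.one_def, one_mul]
    | mul v w _ _ hv hw =>
      obtain ⟨d, hd, b, hb⟩ := hv
      obtain ⟨d', hd', b', hb'⟩ := hw
      refine ⟨d + d', SetLike.mul_mem_graded hd hd', b * b', ?_⟩
      rw [map_mul, map_mul, hb, hb', add_smul, mul_mul_mul_comm,
        AddMonoidAlgebra.single_mul_single, one_mul]
  have hspan : a ∈ Submodule.span K (Submonoid.closure (Set.range D.gen) : Set A) := by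
    rw [← Algebra.adjoin_eq_span, D.adjoin_gen]; trivial
  have : ∃ b, D.hom (GradedRing.proj 𝒜 n a) =
      incl K c b * AddMonoidAlgebra.single (n • D.exponent c) 1 := by
    clear ha
    induction hspan using Submodule.span_induction with
    | mem w hw =>
      obtain ⟨d, hd, b, hb⟩ := key w hw
      by_cases hdn : d = n
      · subst hdn
        refine ⟨b, ?_⟩
        rw [← hb, GradedRing.proj_apply, DirectSum.decompose_of_mem_same 𝒜 hd]
      · refine ⟨0, ?_⟩
        rw [GradedRing.proj_apply, DirectSum.decompose_of_mem_ne 𝒜 hd hdn, map_zero, map_zero,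
          zero_mul]
    | zero => exact ⟨0, by simp⟩
    | add v w _ _ hv hw =>
      obtain ⟨b, hb⟩ := hv
      obtain ⟨b', hb'⟩ := hw
      exact ⟨b + b', by rw [map_add, map_add, map_add, add_mul, hb, hb']⟩
    | smul r w _ hw =>
      obtain ⟨b, hb⟩ := hw
      refine ⟨r • b, ?_⟩
      have h : GradedRing.proj 𝒜 n (r • w) = r • GradedRing.proj 𝒜 n w := by
        simp only [GradedRing.proj_apply, DirectSum.decompose_smul]
        rfl
      rw [h, map_smul, map_smul, smul_mul_assoc, ← hb]
  rwa [GradedRing.proj_apply, DirectSum.decompose_of_mem_same 𝒜 ha] at this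

/-- The ring of the chart `gen c ≠ 0` contains the ratios `X_a / X_b` with `a ∈ S` and `b = c S`: replacing
the vertex `b` by `a` in the simplex of `S` alone gives the numerator. -/
lemma range_away (c : Sel G) : (D.away c).range = (incl K c).toRingHom.range := by
  classical
  apply le_antisymm
  · rintro _ ⟨z, rfl⟩
    obtain ⟨n, a, ha, rfl⟩ := Away.mk_surjective 𝒜 (D.gen_mem c) z
    obtain ⟨b, hb⟩ := D.exists_hom_eq c (n • 1) a ha
    refine ⟨b, single_mul_injective (n • D.exponent c) ?_⟩
    dsimp only
    rw [D.away_mk, hb, smul_eq_mul, mul_one]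
    rfl
  · have hs (m : charLattice E) (hm : m ∈ chartMonoid c) :
        (AddMonoidAlgebra.single m 1 : TorusRing K E) ∈ (D.away c).range := by
      induction hm using AddSubmonoid.closure_induction with
      | mem m hm =>
        obtain ⟨S, a, ha, rfl⟩ := hm
        refine ⟨Away.mk 𝒜 (D.gen_mem c) 1 (D.gen (Function.update c S ⟨a, ha⟩))
          (by simpa using D.gen_mem _), ?_⟩
        rw [D.away_gen, D.exponent_eq c, add_sub_cancel_left, Finset.sum_eq_single S]
        · simp
        · intro T _ hT
          rw [Function.update_of_ne hT, ratio_self]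
        · simp
      | zero => rw [← AddMonoidAlgebra.one_def]; exact one_mem _
      | add m m' _ _ h h' =>
        have := mul_mem h h'
        rwa [AddMonoidAlgebra.single_mul_single, one_mul] at this
    have hK (r : K) : algebraMap K (TorusRing K E) r ∈ (D.away c).range := by
      refine ⟨fromZeroRingHom 𝒜 _ (algebraMap K (𝒜 0) r), ?_⟩
      rw [away, awayLift_fromZero]
      exact D.hom.commutes r
    rintro _ ⟨b, rfl⟩
    induction b using AddMonoidAlgebra.induction_on with
    | of m =>
      refine (?_ : (incl K c) (AddMonoidAlgebra.single m 1) ∈ (D.away c).range)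
      rw [incl_single]; exact hs _ m.2
    | add a b ha hb => rw [map_add]; exact add_mem ha hb
    | smul r a ha =>
      have : (incl K c).toRingHom (r • a) = algebraMap K _ r * (incl K c).toRingHom a := by
        rw [← Algebra.smul_def]; exact map_smul (incl K c) r a
      rw [this]
      exact mul_mem (hK r) ha

/-- The coordinate ring of the chart `gen c ≠ 0`. -/
def equiv (c : Sel G) : Away 𝒜 (D.gen c) ≃+* AddMonoidAlgebra K (chartMonoid c) :=
  ((RingEquiv.ofBijective (D.away c).rangeRestrict
    ⟨fun _ _ h => D.away_injective c (congrArg Subtype.val h),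
      (D.away c).rangeRestrict_surjective⟩).trans (RingEquiv.subringCongr (D.range_away c))).trans
    (RingEquiv.ofBijective (incl K c).toRingHom.rangeRestrict
      ⟨fun _ _ h => incl_injective c (congrArg Subtype.val h),
        (incl K c).toRingHom.rangeRestrict_surjective⟩).symm

lemma incl_equiv (c : Sel G) (z : Away 𝒜 (D.gen c)) : incl K c (D.equiv c z) = D.away c z := by
  exact congrArg Subtype.val ((RingEquiv.ofBijective (incl K c).toRingHom.rangeRestrict
      ⟨fun _ _ h => incl_injective c (congrArg Subtype.val h),
        (incl K c).toRingHom.rangeRestrict_surjective⟩).apply_symm_apply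
      (RingEquiv.subringCongr (D.range_away c) ((D.away c).rangeRestrict z)))

/-- The open immersion of the chart `gen c ≠ 0`. -/
def chart (c : Sel G) : toricSpec K (chartMonoid c) ⟶ Over.mk (projToSpec 𝒜) :=
  Over.homMk (Spec.map (CommRingCat.ofHom (D.equiv c).toRingHom) ≫
    Proj.awayι 𝒜 (D.gen c) (D.gen_mem c) one_pos) (by
      change (_ ≫ _) ≫ Proj.toSpecZero 𝒜 ≫ Spec.map (CommRingCat.ofHom (algebraMap K (𝒜 0))) =
        Spec.map (CommRingCat.ofHom (algebraMap K (AddMonoidAlgebra K (chartMonoid c))))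
      rw [Category.assoc, Proj.awayι_toSpecZero_assoc, ← Spec.map_comp, ← Spec.map_comp]
      congr 1
      rw [← CommRingCat.ofHom_comp, ← CommRingCat.ofHom_comp]
      congr 1
      ext1 r
      apply incl_injective c
      refine (D.incl_equiv c _).trans ?_
      rw [away, RingHom.comp_apply, awayLift_fromZero]
      exact (D.hom.commutes r).trans ((incl K c).commutes r).symm)

instance (c : Sel G) : IsIso (CommRingCat.ofHom (D.equiv c).toRingHom) :=
  inferInstanceAs (IsIso (D.equiv c).toCommRingCatIso.hom)

instance (c : Sel G) : IsOpenImmersion (D.chart c).left :=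
  inferInstanceAs (IsOpenImmersion (X := Spec (.of (AddMonoidAlgebra K (chartMonoid c))))
    (Y := Proj 𝒜) (Spec.map (CommRingCat.ofHom (D.equiv c).toRingHom) ≫
    Proj.awayι 𝒜 (D.gen c) (D.gen_mem c) one_pos))

lemma opensRange_chart (c : Sel G) :
    (D.chart c).left.opensRange = Proj.basicOpen 𝒜 (D.gen c) := by
  refine (Scheme.Hom.opensRange_comp_of_isIso
    (Spec.map (CommRingCat.ofHom (D.equiv c).toRingHom)) _).trans ?_
  exact Proj.opensRange_awayι 𝒜 _ _ _

lemma map_chart (c : Sel G) : (toricSpec.map K (chartMonoid c).subtype ≫ D.chart c).left =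
    Spec.map (CommRingCat.ofHom (D.away c)) ≫
      Proj.awayι 𝒜 (D.gen c) (D.gen_mem c) one_pos := by
  change Spec.map (CommRingCat.ofHom (incl K c).toRingHom) ≫
    Spec.map (CommRingCat.ofHom (D.equiv c).toRingHom) ≫ _ = _
  rw [← Spec.map_comp_assoc, ← CommRingCat.ofHom_comp]
  congr 3
  exact RingHom.ext (D.incl_equiv c)

lemma chart_mem_range (c c' : Sel G) (y : (toricSpec K (chartMonoid c)).left) :
    (D.chart c).left y ∈ Set.range (D.chart c').left ↔
      ∀ S, toricSpec.NonzeroAt y (chartGen c S (c' S)) := by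
  have h1 : (D.chart c).left y ∈ Set.range (D.chart c').left ↔
      (D.chart c).left y ∈ Proj.basicOpen 𝒜 (D.gen c') := by
    rw [← opensRange_chart]; rfl
  have h2 : D.equiv c (Away.isLocalizationElem (D.gen_mem c) (D.gen_mem c')) =
      AddMonoidAlgebra.single (∑ S, chartGen c S (c' S)) 1 := by
    apply incl_injective c
    rw [D.incl_equiv, incl_single, AddSubmonoid.coe_finsetSum]
    have h3 := D.away_gen c c'
    rw [D.exponent_eq c c', add_sub_cancel_left] at h3
    refine Eq.trans ?_ h3
    congr 2
    exact HomogeneousLocalization.val_injective _ (by simp [Away.isLocalizationElem])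
  have h4 := SetLike.ext_iff.1 (Proj.awayι_preimage_basicOpen 𝒜 (D.gen_mem c) one_pos
    (D.gen_mem c') one_pos) (Spec.map (CommRingCat.ofHom (D.equiv c).toRingHom) y)
  rw [h1]
  refine h4.trans ?_
  have h5 := toricSpec.nonzeroAt_sum (y := y) Finset.univ (fun S => chartGen c S (c' S))
  rw [toricSpec.NonzeroAt, ← h2] at h5
  exact Iff.trans Iff.rfl (h5.trans (by simp))

/-- The atlas of the projective spectrum. -/
def atlas [Nonempty (Sel G)] : Atlas G (Over.mk (projToSpec 𝒜)) where
  chart := D.chart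
  isOpenImmersion := inferInstance
  covers x := by
    have h := Proj.iSup_basicOpen_eq_top' 𝒜 D.gen (fun c => ⟨1, D.gen_mem c⟩) (by
      rw [eq_top_iff]
      intro a _
      have ha : a ∈ Algebra.adjoin K (Set.range D.gen) := by rw [D.adjoin_gen]; trivial
      induction ha using Algebra.adjoin_induction with
      | mem a ha => exact Algebra.subset_adjoin ha
      | algebraMap r => exact algebraMap_mem _ (algebraMap K (𝒜 0) r)
      | add a b _ _ h h' => exact add_mem (h trivial) (h' trivial)
      | mul a b _ _ h h' => exact mul_mem (h trivial) (h' trivial))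
    have hx : (id x : Proj 𝒜) ∈ ⨆ c, Proj.basicOpen 𝒜 (D.gen c) := by rw [h]; trivial
    obtain ⟨c, hc⟩ := TopologicalSpace.Opens.mem_iSup.1 hx
    refine ⟨c, ?_⟩
    rw [← opensRange_chart] at hc
    exact hc
  incl := toricSpec.map K (chartMonoid (Classical.arbitrary (Sel G))).subtype ≫ D.chart _
  map_chart c := by
    apply Over.OverMorphism.ext
    rw [map_chart, map_chart]
    exact Spec_map_awayLift_awayι_eq _ _ _ _ _ _ _
  mem_range := D.chart_mem_range
  isSeparated := by
    change IsSeparated (Proj.toSpecZero 𝒜 ≫ Spec.map _)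
    infer_instance

lemma atlas_incl_left [Nonempty (Sel G)] (c : Sel G) : D.atlas.incl.left =
    Spec.map (CommRingCat.ofHom (D.away c)) ≫
      Proj.awayι 𝒜 (D.gen c) (D.gen_mem c) one_pos := by
  rw [← D.atlas.map_chart c]
  exact D.map_chart c

end GradedChartData

end

noncomputable section

attribute [local instance] MvPolynomial.gradedAlgebra

open charLattice ProjPoint HomogeneousLocalization

/-! ### Points of projective spaces -/

namespace PSpace

variable {K A : Type u} [Field K] {R R' : Type u} [CommRing R] [Algebra K R] [CommRing R']
  [Algebra K R']

lemma X_mem (K : Type u) [Field K] (a : A) :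
    (MvPolynomial.X a : MvPolynomial A K) ∈ MvPolynomial.homogeneousSubmodule A K 1 :=
  MvPolynomial.isHomogeneous_X K a

lemma isUnit_aeval {w : A → R} {a : A} (h : IsUnit (w a)) :
    IsUnit ((MvPolynomial.aeval w : _ →ₐ[K] R).toRingHom (MvPolynomial.X a)) := by
  change IsUnit (MvPolynomial.aeval w (MvPolynomial.X a))
  rwa [MvPolynomial.aeval_X]

/-- The point with given homogeneous coordinates, in the chart of an invertible coordinate. -/
lemma ofCoords_eq {w : A → R} (h : ∃ a, IsUnit (w a)) {a : A} (ha : IsUnit (w a)) :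
    ofCoords w h = Spec.map (CommRingCat.ofHom
      (awayLift (MvPolynomial.homogeneousSubmodule A K)
        (MvPolynomial.aeval w : _ →ₐ[K] R).toRingHom (isUnit_aeval ha))) ≫
      Proj.awayι _ (MvPolynomial.X a) (X_mem K a) one_pos := by
  have ha' := (isUnit_aeval (K := K) ha).map (Scheme.ΓSpecIso (.of R)).inv.hom
  refine (fromOfGlobalSections_eq (X := Spec (.of R)) _ _ (r := MvPolynomial.X a) ha' (X_mem K a)
    one_pos).trans ?_
  rw [← comp_awayLift _ _ (isUnit_aeval ha)]
  congr 1
  apply specHom_injective (R := .of _)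
  rw [specHom_toSpecOf, ← Category.id_comp (Spec.map _)]
  refine Eq.trans ?_ (specHom_map _ _).symm
  rw [specHom_id]
  rfl

lemma Spec_map_ofCoords (f : R →ₐ[K] R') (w : A → R) (h : ∃ a, IsUnit (w a))
    (h' : ∃ a, IsUnit (f (w a))) :
    Spec.map (CommRingCat.ofHom f.toRingHom) ≫ ofCoords w h = ofCoords (K := K) (f ∘ w) h' := by
  obtain ⟨a, ha⟩ := h
  rw [ofCoords_eq _ ha, ofCoords_eq (w := f ∘ w) h' (ha.map f), ← Spec.map_comp_assoc,
    ← CommRingCat.ofHom_comp, comp_awayLift]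
  congr 4
  have : f.comp (MvPolynomial.aeval w) = MvPolynomial.aeval (f ∘ w) :=
    MvPolynomial.algHom_ext fun i => by simp
  rw [← this]
  rfl

lemma aeval_mul_of_isHomogeneous {p : MvPolynomial A K} {n : ℕ} (hp : p.IsHomogeneous n)
    (u : R) (w : A → R) :
    MvPolynomial.aeval (fun a => u * w a) p = u ^ n * MvPolynomial.aeval w p := by
  rw [MvPolynomial.aeval_def, MvPolynomial.aeval_def, MvPolynomial.eval₂_eq, MvPolynomial.eval₂_eq,
    Finset.mul_sum]
  refine Finset.sum_congr rfl fun d hd => ?_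
  have hdn := hp (MvPolynomial.mem_support_iff.1 hd)
  rw [← hdn, Finsupp.weight_apply, Finsupp.sum, ← Finset.prod_pow_eq_pow_sum]
  simp only [mul_pow, Finset.prod_mul_distrib, Pi.one_apply, smul_eq_mul, mul_one]
  ring

lemma ofCoords_mul (u : R) (hu : IsUnit u) (w : A → R) (h : ∃ a, IsUnit (w a))
    (h' : ∃ a, IsUnit (u * w a)) :
    ofCoords (K := K) (fun a => u * w a) h' = ofCoords w h := by
  obtain ⟨a, ha⟩ := h
  rw [ofCoords_eq _ ha, ofCoords_eq (w := fun a => u * w a) h' (hu.mul ha)]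
  congr 3
  symm
  refine awayLift_unique _ _ (X_mem K a) fun n p hp => ?_
  have h1 := awayLift_mk (MvPolynomial.aeval w : _ →ₐ[K] R).toRingHom (isUnit_aeval ha)
    (X_mem K a) n p hp
  have h2 : MvPolynomial.aeval (fun a => u * w a) p = u ^ n * MvPolynomial.aeval w p :=
    aeval_mul_of_isHomogeneous (by simpa using hp) u w
  refine Eq.trans ?_ h2.symm
  change _ * (MvPolynomial.aeval (fun a => u * w a) (MvPolynomial.X a : MvPolynomial A K)) ^ n = _
  change _ * (MvPolynomial.aeval w (MvPolynomial.X a : MvPolynomial A K)) ^ n =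
    MvPolynomial.aeval w p at h1
  rw [← h1, MvPolynomial.aeval_X, MvPolynomial.aeval_X]
  ring

lemma ofCoords_toSpec (w : A → R) (h : ∃ a, IsUnit (w a)) :
    ofCoords w h ≫ PSpace.toSpec K A = Spec.map (CommRingCat.ofHom (algebraMap K R)) := by
  obtain ⟨a, ha⟩ := h
  rw [ofCoords_eq _ ha, PSpace.toSpec, Category.assoc, Proj.awayι_toSpecZero_assoc,
    ← Spec.map_comp, ← Spec.map_comp]
  congr 1
  rw [← CommRingCat.ofHom_comp, ← CommRingCat.ofHom_comp]
  congr 1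
  ext1 r
  rw [RingHom.comp_apply, RingHom.comp_apply, awayLift_fromZero]
  exact (MvPolynomial.aeval w : _ →ₐ[K] R).commutes r

end PSpace

namespace torus

variable {K A B : Type u} [Field K]

lemma coords_apply (φ : B ↪ A) (b₀ b : B) :
    coords K φ b₀ (φ b) = AddMonoidAlgebra.single (ratio b b₀) 1 := by
  have h : ∃ b', φ b' = φ b := ⟨b, rfl⟩
  rw [coords, dif_pos h, φ.injective h.choose_spec]

lemma coords_of_notMem (φ : B ↪ A) (b₀ : B) {a : A} (h : a ∉ Set.range φ) :
    coords K φ b₀ a = 0 := dif_neg h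

lemma isUnit_coords (φ : B ↪ A) (b₀ b : B) : IsUnit (coords K φ b₀ (φ b)) := by
  rw [coords_apply]
  refine IsUnit.of_mul_eq_one (AddMonoidAlgebra.single (-ratio b b₀) 1) ?_
  rw [AddMonoidAlgebra.single_mul_single, add_neg_cancel, one_mul, AddMonoidAlgebra.one_def]

lemma toPSpace_eq (φ : B ↪ A) (b₀ b₁ : B) : toPSpace K φ b₀ = toPSpace K φ b₁ := by
  have h : coords K φ b₀ = fun a => AddMonoidAlgebra.single (ratio b₁ b₀) 1 * coords K φ b₁ a := by
    ext1 a
    by_cases ha : a ∈ Set.range φ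
    · obtain ⟨b, rfl⟩ := ha
      rw [coords_apply, coords_apply, AddMonoidAlgebra.single_mul_single, one_mul, add_comm,
        ratio_add_ratio]
    · rw [coords_of_notMem _ _ ha, coords_of_notMem _ _ ha, mul_zero]
  have hu : IsUnit (AddMonoidAlgebra.single (ratio b₁ b₀) 1 : TorusRing K B) := by
    rw [← coords_apply (K := K) (Function.Embedding.refl B) b₀ b₁]
    exact isUnit_coords _ _ _
  rw [toPSpace, toPSpace]
  simp only [h]
  exact PSpace.ofCoords_mul _ hu _ _ _

end torus

/-! ### The atlas of a projective space -/

lemma eq_zero_of_mapDomain_eq_zero {K B M : Type u} [Field K] {φ : B → M} {S : Set B}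
    (hφ : Set.InjOn φ S) {p : AddMonoidAlgebra K B} (hp : (p.coeff.support : Set B) ⊆ S)
    (h : AddMonoidAlgebra.mapDomain φ p = 0) : p = 0 := by
  have h1 : Finsupp.mapDomain φ p.coeff = Finsupp.mapDomain φ 0 := by
    rw [Finsupp.mapDomain_zero]
    exact congrArg AddMonoidAlgebra.coeff h
  have h2 := Finsupp.mapDomain_injOn S hφ hp (by simp) h1
  exact AddMonoidAlgebra.coeff_injective h2

variable {K E : Type u} [Field K]

/-- The exponent of the dehomogenisation by `X_{e₀}` of a monomial. -/
def dehomExponent (e₀ : E) : (E →₀ ℕ) →+ charLattice E where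
  toFun m := ⟨m.mapRange Nat.cast Nat.cast_zero - Finsupp.single e₀ (m.degree : ℤ), by
    rw [AddMonoidHom.mem_ker, map_sub, Finsupp.degree_single, sub_eq_zero]
    induction m using Finsupp.induction_linear with
    | zero => simp
    | add f g hf hg =>
      rw [Finsupp.mapRange_add (by simp), map_add, hf, hg, map_add, Nat.cast_add]
    | single a b => simp⟩
  map_zero' := by ext; simp
  map_add' f g := by
    apply Subtype.ext
    change _ - _ = (_ - _) + (_ - _)
    rw [Finsupp.mapRange_add (by simp), map_add, Nat.cast_add, Finsupp.single_add]
    abel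

lemma dehomExponent_single (e₀ a : E) : dehomExponent e₀ (Finsupp.single a 1) = ratio a e₀ := by
  apply Subtype.ext
  change _ - _ = _ - _
  simp

lemma dehomExponent_injOn (e₀ : E) (n : ℕ) :
    Set.InjOn (dehomExponent e₀) {m : E →₀ ℕ | m.degree = n} := by
  intro m hm m' hm' h
  have h1 : m.mapRange Nat.cast Nat.cast_zero - Finsupp.single e₀ (m.degree : ℤ) =
    m'.mapRange Nat.cast Nat.cast_zero - Finsupp.single e₀ (m'.degree : ℤ) := congrArg Subtype.val h
  rw [Set.mem_ofPred_eq] at hm hm'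
  rw [hm, hm', sub_left_inj] at h1
  exact Finsupp.mapRange_injective _ Nat.cast_zero Nat.cast_injective h1

lemma aeval_coords_eq_mapDomain (e₀ : E) (p : MvPolynomial E K) :
    MvPolynomial.aeval (torus.coords K (Function.Embedding.refl E) e₀) p =
      AddMonoidAlgebra.mapDomain (dehomExponent e₀) p := by
  have : (MvPolynomial.aeval (torus.coords K (Function.Embedding.refl E) e₀)) =
      (AddMonoidAlgebra.mapDomainAlgHom K K (dehomExponent e₀) :
        MvPolynomial E K →ₐ[K] TorusRing K E) := by
    refine MvPolynomial.algHom_ext fun a => ?_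
    rw [MvPolynomial.aeval_X]
    refine (torus.coords_apply (Function.Embedding.refl E) e₀ a).trans ?_
    change _ = AddMonoidAlgebra.mapDomain (dehomExponent e₀)
      (AddMonoidAlgebra.single (Finsupp.single a 1) (1 : K))
    rw [AddMonoidAlgebra.mapDomain_single, dehomExponent_single]
  rw [this]
  rfl

/-- Projective space as the projective spectrum of a polynomial ring, with the charts where one
coordinate does not vanish. -/
def pspaceData (K : Type u) [Field K] (e₀ : E) : GradedChartData (MvPolynomial.homogeneousSubmodule E K)
    ({Set.univ} : Set (Set E)) where
  hom := MvPolynomial.aeval (torus.coords K (Function.Embedding.refl E) e₀)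
  gen c := MvPolynomial.X (c ⟨Set.univ, rfl⟩ : E)
  exponent c := ratio (c ⟨Set.univ, rfl⟩ : E) e₀
  gen_mem c := PSpace.X_mem K _
  hom_gen c := by
    rw [MvPolynomial.aeval_X]
    exact torus.coords_apply (Function.Embedding.refl E) e₀ _
  exponent_eq c c' := by
    rw [Fintype.sum_unique, add_comm]
    exact (ratio_add_ratio _ _ _).symm
  hom_injOn n a ha h := by
    rw [aeval_coords_eq_mapDomain] at h
    refine eq_zero_of_mapDomain_eq_zero (dehomExponent_injOn e₀ n) ?_ h
    rw [MvPolynomial.homogeneousSubmodule_eq_finsupp_supported] at ha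
    exact ha
  adjoin_gen := by
    rw [← MvPolynomial.adjoin_range_X]
    congr 1
    ext p
    constructor
    · rintro ⟨c, rfl⟩; exact ⟨_, rfl⟩
    · rintro ⟨a, rfl⟩; exact ⟨fun S => ⟨a, by rw [S.2]; trivial⟩, rfl⟩

lemma nonempty_sel {G : Set (Set E)} (h : ∅ ∉ G) : Nonempty (Sel G) :=
  ⟨fun S => ⟨_, (Set.nonempty_iff_ne_empty.2 fun hS => h (hS ▸ S.2)).some_mem⟩⟩

/-- The standard atlas of projective space. -/
def pspaceAtlas (K : Type u) [Field K] (e₀ : E) :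
    Atlas ({Set.univ} : Set (Set E)) (Over.mk (PSpace.toSpec K E)) :=
  have : Nonempty (Sel ({Set.univ} : Set (Set E))) := ⟨fun S => ⟨e₀, by rw [S.2]; trivial⟩⟩
  (pspaceData K e₀).atlas

lemma pspaceAtlas_incl (e₀ e₁ : E) : (pspaceAtlas K e₀).incl.left =
    torus.toPSpace K (Function.Embedding.refl E) e₁ := by
  have : Nonempty (Sel ({Set.univ} : Set (Set E))) := ⟨fun S => ⟨e₀, by rw [S.2]; trivial⟩⟩
  rw [torus.toPSpace_eq _ e₁ e₀]
  refine ((pspaceData K e₀).atlas_incl_left fun S => ⟨e₀, by rw [S.2]; trivial⟩).trans ?_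
  exact (PSpace.ofCoords_eq _ (torus.isUnit_coords (Function.Embedding.refl E) e₀ e₀)).symm

/-! ### Existence of schemes with a given atlas -/

section model

variable {G : Set (Set E)} [Fintype G] (e₀ : E)

/-- The sum of the vertices chosen by `c`. -/
def vertexSum (c : Sel G) : charLattice E := ∑ S, ratio (c S : E) e₀

/-- The graded monoid generated in degree one by the sums of vertices of the simplices. -/
def coneMonoid (G : Set (Set E)) [Fintype G] (e₀ : E) : AddSubmonoid (charLattice E × ℕ) :=
  AddSubmonoid.closure (Set.range fun c : Sel G => (vertexSum e₀ c, 1))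

/-- The degree on the graded monoid. -/
def coneDegree (G : Set (Set E)) [Fintype G] (e₀ : E) : coneMonoid G e₀ →+ ℕ :=
  (AddMonoidHom.snd _ _).comp (coneMonoid G e₀).subtype

/-- The generators of the graded monoid. -/
def coneGen (c : Sel G) : coneMonoid G e₀ :=
  ⟨(vertexSum e₀ c, 1), AddSubmonoid.subset_closure ⟨c, rfl⟩⟩

/-- The projective toric variety of the sum of the simplices in `G`. -/
def modelData (K : Type u) [Field K] (G : Set (Set E)) [Fintype G] (e₀ : E) :
    GradedChartData (AddMonoidAlgebra.gradeBy K (coneDegree G e₀)) G where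
  hom := AddMonoidAlgebra.mapDomainAlgHom K K ((AddMonoidHom.fst _ _).comp (coneMonoid G e₀).subtype)
  gen c := AddMonoidAlgebra.single (coneGen e₀ c) 1
  exponent c := vertexSum e₀ c
  gen_mem c := AddMonoidAlgebra.single_mem_gradeBy _ (coneGen e₀ c) _
  hom_gen c := AddMonoidAlgebra.mapDomain_single
  exponent_eq c c' := by
    rw [vertexSum, vertexSum, ← Finset.sum_add_distrib]
    exact Finset.sum_congr rfl fun S _ => by rw [add_comm, ratio_add_ratio]
  hom_injOn n a ha h := by
    refine eq_zero_of_mapDomain_eq_zero (S := {b | coneDegree G e₀ b = n}) ?_ ha h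
    intro b hb b' hb' hbb'
    exact Subtype.ext (Prod.ext hbb' (hb.trans hb'.symm))
  adjoin_gen := by
    rw [eq_top_iff]
    intro p _
    have hs (m : charLattice E × ℕ) (hm : m ∈ coneMonoid G e₀) :
        (AddMonoidAlgebra.single ⟨m, hm⟩ 1 : AddMonoidAlgebra K (coneMonoid G e₀)) ∈
          Algebra.adjoin K (Set.range fun c : Sel G =>
            (AddMonoidAlgebra.single (coneGen e₀ c) 1 : AddMonoidAlgebra K _)) := by
      induction hm using AddSubmonoid.closure_induction with
      | mem m hm =>
        obtain ⟨c, rfl⟩ := hm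
        exact Algebra.subset_adjoin ⟨c, rfl⟩
      | zero => exact one_mem (Algebra.adjoin K _)
      | add m m' hm hm' h h' =>
        have := mul_mem h h'
        rwa [AddMonoidAlgebra.single_mul_single, one_mul] at this
    induction p using AddMonoidAlgebra.induction_on with
    | of m => exact hs m.1 m.2
    | add a b ha hb => exact add_mem (ha trivial) (hb trivial)
    | smul r a ha => exact Subalgebra.smul_mem _ (ha trivial) r

/-- The scheme of a family of non-empty sets exists: it is the projective toric variety of the sum of
the simplices with vertices in the members of the family. -/
lemma exists_atlas (K : Type u) [Field K] (G : Set (Set E)) [Finite E] [Nonempty E] (hG : ∅ ∉ G) :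
    ∃ X : Over (Spec (CommRingCat.of K)), Nonempty (Atlas G X) := by
  have := Fintype.ofFinite G
  have := nonempty_sel hG
  exact ⟨_, ⟨(modelData K G (Classical.arbitrary E)).atlas⟩⟩

end model

end

noncomputable section

open charLattice

/-! ### Nested choices -/

variable {K E : Type u} [Field K] {G : Set (Set E)}

/-- A choice of elements is nested if the element chosen in a set is also chosen in the smaller sets
which contain it. -/
def IsNested (c : Sel G) : Prop :=
  ∀ S T : G, (T : Set E) ⊆ S → (c S : E) ∈ (T : Set E) → (c T : E) = c S

/-- The family `G` of non-empty sets contains the set of all elements and the union of any two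
members. -/
structure IsUnionClosed (G : Set (Set E)) : Prop where
  univ_mem : Set.univ ∈ G
  empty_notMem : ∅ ∉ G
  union_mem : ∀ S ∈ G, ∀ T ∈ G, S ∪ T ∈ G

namespace IsUnionClosed

variable (hG : IsUnionClosed G)

include hG in
lemma nonempty_sel : Nonempty (Sel G) := _root_.nonempty_sel hG.empty_notMem

/-- The set of all elements, as a member of the family. -/
def top : G := ⟨Set.univ, hG.univ_mem⟩

/-- The union of two members of the family. -/
def sup (S T : G) : G := ⟨S ∪ T, hG.union_mem _ S.2 _ T.2⟩

lemma subset_sup_left (S T : G) : (S : Set E) ⊆ hG.sup S T := Set.subset_union_left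

lemma subset_sup_right (S T : G) : (T : Set E) ⊆ hG.sup S T := Set.subset_union_right

end IsUnionClosed

namespace IsNested

variable {c : Sel G} (hc : IsNested c) (hG : IsUnionClosed G)

include hc

lemma sup_eq (S T : G) : (c (hG.sup S T) : E) = c S ∨ (c (hG.sup S T) : E) = c T := by
  rcases (c (hG.sup S T)).2 with h | h
  · exact Or.inl (hc _ S (hG.subset_sup_left S T) h).symm
  · exact Or.inr (hc _ T (hG.subset_sup_right S T) h).symm

lemma sup_eq_right {S T : G} (h : (c (hG.sup S T) : E) ∈ (T : Set E)) :
    (c (hG.sup S T) : E) = c T := (hc _ T (hG.subset_sup_right S T) h).symm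

omit hc in
/-- `D` contains all the members of the family in which the same element is chosen. -/
def IsFull (c : Sel G) (D : G) : Prop := ∀ T : G, (c T : E) = c D → (T : Set E) ⊆ D

include hG

/-- Every set of the family is contained in a full set with the same chosen element. -/
lemma exists_isFull [Finite E] (S : G) : ∃ D, IsFull c D ∧ (c D : E) = c S ∧ (S : Set E) ⊆ D := by
  obtain ⟨D, hD, hmax⟩ := Set.exists_max_image {D : G | (c D : E) = c S}
    (fun D => (D : Set E).ncard) (Set.toFinite _) ⟨S, rfl⟩
  have hfull : IsFull c D := by
    intro T hT
    have h1 : (c (hG.sup T D) : E) = c S := by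
      rcases hc.sup_eq hG T D with h | h <;> rw [h]
      · rw [hT, hD]
      · exact hD
    have h2 := Set.eq_of_subset_of_ncard_le (hG.subset_sup_right T D) (hmax _ h1)
    rw [h2]
    exact hG.subset_sup_left T D
  exact ⟨D, hfull, hD, hfull S hD.symm⟩

/-- There is a member of the family whose chosen element is the deepest one. -/
lemma exists_deepest [Finite E] : ∃ D, IsFull c D ∧ ∀ S, (c (hG.sup D S) : E) = c S := by
  obtain ⟨D₁, hD₁, -⟩ := hc.exists_isFull hG hG.top
  obtain ⟨D, hD, hmin⟩ := Set.exists_min_image {D : G | IsFull c D}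
    (fun D => (D : Set E).ncard) (Set.toFinite _) ⟨D₁, hD₁⟩
  refine ⟨D, hD, fun S => ?_⟩
  rcases hc.sup_eq hG D S with h | h
  · have h1 : (S : Set E) ⊆ D := (hG.subset_sup_right D S).trans (hD _ h)
    obtain ⟨D', hD', hD'S, -⟩ := hc.exists_isFull hG S
    have h2 : (c D' : E) ∈ (D : Set E) := hD'S ▸ h1 (c S).2
    rw [h, ← hD'S]
    rcases hc.sup_eq hG D' D with h' | h'
    · exact hc D' D ((hG.subset_sup_right D' D).trans (hD' _ h')) h2
    · have h3 := Set.eq_of_subset_of_ncard_le ((hG.subset_sup_left D' D).trans (hD _ h'))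
        (hmin _ hD')
      rw [Subtype.ext h3]
  · exact h

omit hG in
/-- A new set whose unions with the members of the family belong to the family either avoids all
chosen elements, or contains the element chosen in some set around it. -/
lemma exists_or_forall_notMem {γ : Set E} (hγ : ∀ S ∈ G, γ ∪ S ∈ G) :
    (∃ S : G, γ ⊆ S ∧ (c S : E) ∈ γ) ∨ ∀ S : G, (c S : E) ∉ γ := by
  by_contra! h
  obtain ⟨h1, T, hT⟩ := h
  let S : G := ⟨γ ∪ T, hγ T T.2⟩
  have hS : γ ⊆ (S : Set E) := Set.subset_union_left
  rcases (c S).2 with h | h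
  · exact h1 S hS h
  · have := hc S T Set.subset_union_right h
    exact h1 S hS (this ▸ hT)

/-- A new set without chosen elements is contained in all full sets. -/
lemma subset_of_isFull {γ : Set E} (hγ : ∀ S ∈ G, γ ∪ S ∈ G) (h : ∀ S : G, (c S : E) ∉ γ) {D : G}
    (hD : IsFull c D) : γ ⊆ D := by
  let S : G := ⟨γ ∪ D, hγ D D.2⟩
  have h1 : (c S : E) ∈ (D : Set E) := (c S).2.resolve_left (h S)
  have h2 := hc S D Set.subset_union_right h1
  exact Set.subset_union_left.trans (hD S h2.symm)

section free

variable [Finite E]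

/-- The parent of `a`: the element chosen in the smallest full set around `a` in which an other
element is chosen. -/
lemma exists_parent {a : E} (ha : a ≠ c hG.top) : ∃ D, IsFull c D ∧ a ∈ (D : Set E) ∧
    (c D : E) ≠ a ∧ ∀ D', IsFull c D' → a ∈ (D' : Set E) → (c D' : E) ≠ a →
      (D : Set E).ncard ≤ (D' : Set E).ncard := by
  have htop : IsFull c hG.top := fun T _ => Set.subset_univ _
  obtain ⟨D, ⟨h1, h2, h3⟩, hmin⟩ := Set.exists_min_image
    {D : G | IsFull c D ∧ a ∈ (D : Set E) ∧ (c D : E) ≠ a} (fun D => (D : Set E).ncard)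
    (Set.toFinite _) ⟨hG.top, htop, Set.mem_univ _, ha.symm⟩
  exact ⟨D, h1, h2, h3, fun D' h1' h2' h3' => hmin D' ⟨h1', h2', h3'⟩⟩

end free

end IsNested

/-- The differences of the elements and their parents in a rooted forest are linearly
independent. -/
lemma sum_ratio_injective {σ : Set E} (p : σ → E) (h : E → ℕ) (hp : ∀ a : σ, h a < h (p a)) :
    Function.Injective fun v : σ →₀ ℕ => v.sum fun a n => n • ratio (a : E) (p a) := by
  classical
  intro v w hvw
  -- the coefficient at `a` only involves `v a` and the children of `a`, which are of smaller height
  have key (v : σ →₀ ℕ) (a : σ) :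
      ((v.sum fun a n => n • ratio (a : E) (p a) : charLattice E) : E →₀ ℤ) a =
        v a - v.sum fun b n => if p b = a then (n : ℤ) else 0 := by
    have h1 : ((v.sum fun a n => n • ratio (a : E) (p a) : charLattice E) : E →₀ ℤ) a =
        v.sum fun b n => (if b = a then (n : ℤ) else 0) - if p b = a then (n : ℤ) else 0 := by
      rw [Finsupp.sum, AddSubgroup.val_finsetSum, Finsupp.finsetSum_apply]
      refine Finset.sum_congr rfl fun b _ => ?_
      change (v b • (Finsupp.single (b : E) (1 : ℤ) - Finsupp.single (p b) 1) : E →₀ ℤ) a = _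
      simp only [Finsupp.smul_apply, Finsupp.sub_apply, Finsupp.single_apply, Subtype.ext_iff,
        smul_sub, smul_ite, nsmul_eq_mul, mul_one, mul_zero]
    rw [h1, Finsupp.sum_sub]
    congr 1
    rw [Finsupp.sum_ite_eq']
    split_ifs with h2
    · rfl
    · rw [Finsupp.notMem_support_iff.1 h2, Nat.cast_zero]
  have main : ∀ n, ∀ a : σ, h a = n → v a = w a := by
    intro n
    induction n using Nat.strong_induction_on with
    | _ n ih =>
      intro a ha
      have h1 := key v a
      rw [show (v.sum fun a n => n • ratio (a : E) (p a)) =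
        w.sum fun a n => n • ratio (a : E) (p a) from hvw, key w a] at h1
      have h2 : (v.sum fun b n => if p b = a then (n : ℤ) else 0) =
          w.sum fun b n => if p b = a then (n : ℤ) else 0 := by
        rw [Finsupp.sum_of_support_subset v (Finset.subset_union_left (s₂ := w.support)) _
            (fun _ _ => by simp),
          Finsupp.sum_of_support_subset w (Finset.subset_union_right (s₁ := v.support)) _
            (fun _ _ => by simp)]
        refine Finset.sum_congr rfl fun b _ => ?_
        split_ifs with hb
        · rw [ih (h b) (by rw [← ha, ← hb]; exact hp b) b rfl]
        · rfl
      rw [h2] at h1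
      exact_mod_cast (sub_left_inj.1 h1).symm
  exact Finsupp.ext fun a => main _ a rfl

/-- The monoid of the chart of a nested choice is free: a basis is formed by the ratios `X_a / X_b`,
where `a` runs through the elements other than the one chosen in the whole set, and `b` is the parent
of `a`. -/
lemma IsNested.exists_equiv [Finite E] {c : Sel G} (hc : IsNested c) (hG : IsUnionClosed G) :
    ∃ σ : Type u, Finite σ ∧ Nonempty ((σ →₀ ℕ) ≃+ chartMonoid c) := by
  classical
  choose D hfull hmem hne hmin using fun a : {a : E | a ≠ c hG.top} => hc.exists_parent hG a.2
  let h (a : E) : ℕ := sSup {n | ∃ S : G, (c S : E) = a ∧ n = (S : Set E).ncard}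
  have hbdd (a : E) : BddAbove {n | ∃ S : G, (c S : E) = a ∧ n = (S : Set E).ncard} := by
    refine ⟨(Set.univ : Set E).ncard, ?_⟩
    rintro _ ⟨S, -, rfl⟩
    exact Set.ncard_le_ncard (Set.subset_univ _)
  -- `h a`, the size of the largest set in which `a` is chosen, or zero, increases towards the root
  have hp (a : {a : E | a ≠ c hG.top}) : h a < h (c (D a)) := by
    have h1 : ((D a : G) : Set E).ncard ≤ h (c (D a)) := le_csSup (hbdd _) ⟨D a, rfl, rfl⟩
    refine lt_of_lt_of_le ?_ h1
    have hlt : ∀ n ∈ {n | ∃ S : G, (c S : E) = a ∧ n = (S : Set E).ncard},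
        n < ((D a : G) : Set E).ncard := by
      rintro _ ⟨T, hT, rfl⟩
      refine Set.ncard_lt_ncard ?_
      have h2 : (T : Set E) ⊆ D a := by
        rcases hc.sup_eq hG T (D a) with h3 | h3
        · have h4 : (c (hG.sup T (D a)) : E) ∈ ((D a : G) : Set E) := by
            rw [h3, hT]; exact hmem a
          rw [hc.sup_eq_right hG h4, hT] at h3
          exact absurd h3 (hne a)
        · exact (hG.subset_sup_left _ _).trans (hfull a _ h3)
      refine h2.ssubset_of_ne fun h3 => hne a ?_
      rw [← hT, Subtype.ext h3]
    rcases Set.eq_empty_or_nonempty {n | ∃ S : G, (c S : E) = a ∧ n = (S : Set E).ncard} with h2 | h2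
    · change sSup _ < _
      rw [h2, csSup_empty]
      exact (Set.ncard_pos).2 ⟨_, hmem a⟩
    · exact hlt _ (Nat.sSup_mem h2 (hbdd _))
  let y (a : {a : E | a ≠ c hG.top}) : chartMonoid c := ⟨ratio a (c (D a)), ratio_mem_chartMonoid c _ (hmem a)⟩
  let Θ : ({a : E | a ≠ c hG.top} →₀ ℕ) →+ chartMonoid c :=
    Finsupp.liftAddHom fun a => (AddMonoidHom.flip (smulAddHom ℕ (chartMonoid c))) (y a)
  have hΘ (v) : ((Θ v : chartMonoid c) : charLattice E) =
      v.sum fun a n => n • ratio (a : E) (c (D a)) := by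
    rw [Finsupp.liftAddHom_apply, Finsupp.sum, Finsupp.sum, AddSubmonoid.coe_finsetSum]
    rfl
  refine ⟨_, inferInstance, ⟨AddEquiv.ofBijective Θ ⟨fun v w hvw => ?_, ?_⟩⟩⟩
  · refine sum_ratio_injective (fun a => (c (D a) : E)) h hp ?_
    have := congrArg Subtype.val hvw
    rwa [hΘ, hΘ] at this
  -- walking from `a` to its parent, and so on, one arrives at the element chosen in `S`
  · have hrange : ∀ n, ∀ a : E, (Set.univ : Set E).ncard - h a = n → ∀ S : G, ∀ ha : a ∈ (S : Set E),
        (⟨ratio a (c S), ratio_mem_chartMonoid c S ha⟩ : chartMonoid c) ∈ AddMonoidHom.mrange Θ := by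
      intro n
      induction n using Nat.strong_induction_on with
      | _ n ih =>
        intro a han S ha
        by_cases haS : a = c S
        · convert zero_mem (AddMonoidHom.mrange Θ)
          exact haS ▸ ratio_self _
        obtain ⟨D', hD', hD'S, hSD'⟩ := hc.exists_isFull hG S
        have ha' : a ≠ c hG.top := by
          intro h1
          have := hc hG.top D' (Set.subset_univ _) (h1 ▸ hSD' ha)
          rw [← h1, hD'S] at this
          exact haS this.symm
        have hpD : (c (D ⟨a, ha'⟩) : E) ∈ (D' : Set E) := by
          rcases hc.sup_eq hG (D ⟨a, ha'⟩) D' with h1 | h1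
          · have h2 : (D' : Set E) ⊆ D ⟨a, ha'⟩ := (hG.subset_sup_right _ _).trans (hfull _ _ h1)
            have h3 := Set.eq_of_subset_of_ncard_le h2
              (hmin ⟨a, ha'⟩ D' hD' (hSD' ha) (by rw [hD'S]; exact Ne.symm haS))
            rw [Subtype.ext h3]
            exact (c _).2
          · exact ((hG.subset_sup_left _ _).trans (hD' _ h1)) (c _).2
        have hlt := hp ⟨a, ha'⟩
        have hle : h (c (D ⟨a, ha'⟩)) ≤ (Set.univ : Set E).ncard :=
          csSup_le ⟨_, D ⟨a, ha'⟩, rfl, rfl⟩ (by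
            rintro _ ⟨S, -, rfl⟩
            exact Set.ncard_le_ncard (Set.subset_univ _))
        have h1 := ih _ (by rw [← han]; dsimp only at hlt; omega) (c (D ⟨a, ha'⟩)) rfl D' hpD
        have h2 : y ⟨a, ha'⟩ ∈ AddMonoidHom.mrange Θ := ⟨Finsupp.single ⟨a, ha'⟩ 1, by
          simp [Θ]⟩
        have h3 := add_mem h2 h1
        convert h3
        refine Eq.trans ?_ (ratio_add_ratio a (c (D ⟨a, ha'⟩)) (c D')).symm
        rw [hD'S]
    rintro ⟨m, hm⟩
    change _ ∈ AddMonoidHom.mrange Θ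
    induction hm using AddSubmonoid.closure_induction with
    | mem m hm =>
      obtain ⟨S, a, ha, rfl⟩ := hm
      exact hrange _ a rfl S ha
    | zero => exact zero_mem (AddMonoidHom.mrange Θ)
    | add m m' hm hm' h h' => exact add_mem (S := AddSubmonoid (chartMonoid c)) h h'

/-! ### Nested charts -/

namespace Atlas

variable {X : Over (Spec (CommRingCat.of K))} (A : Atlas G X)

/-- Every point lies in the chart of a nested choice: in every set of the family, choose the first
element whose coordinate does not vanish, for some well-order. -/
lemma exists_isNested (x : X.left) :
    ∃ c, IsNested c ∧ x ∈ Set.range (A.chart c).left := by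
  obtain ⟨_, hwf⟩ := exists_wellFoundedLT E
  let c : Sel G := fun T => ⟨hwf.wf.min (A.nz T x) (A.nz_nonempty T x),
    A.nz_subset _ _ (hwf.wf.min_mem _ (A.nz_nonempty T x))⟩
  have hc (T : G) : (c T : E) ∈ A.nz T x := hwf.wf.min_mem _ (A.nz_nonempty T x)
  refine ⟨c, fun S T hTS hST => ?_, (A.mem_range_iff c x).2 hc⟩
  have h := A.nz_eq_inter hTS x ⟨_, hc S, hST⟩
  apply le_antisymm
  · exact not_lt.1 (hwf.wf.not_lt_min (A.nz T x) (h ▸ ⟨hc S, hST⟩))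
  · exact not_lt.1 (hwf.wf.not_lt_min (A.nz S x) (h ▸ hc T : (c T : E) ∈ A.nz S x ∩ T).1)

end Atlas

end

noncomputable section

/-! ### Ideal sheaves on affine schemes -/

namespace AlgebraicGeometry.Scheme.IdealSheafData

variable {X Y : Scheme.{u}}

/-- On affine schemes, the inverse image of an ideal sheaf is given by the extension of ideals. -/
lemma comap_ofIdealTop [IsAffine X] [IsAffine Y] (f : X ⟶ Y) (𝔞 : Ideal Γ(Y, ⊤)) :
    (ofIdealTop 𝔞).comap f = ofIdealTop (𝔞.map f.appTop.hom) := by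
  refine eq_of_forall_ge_iff fun J => ?_
  have h1 : ofIdealTop (𝔞.map f.appTop.hom) ≤ J ↔
      𝔞.map f.appTop.hom ≤ J.ideal ⟨⊤, isAffineOpen_top X⟩ := by
    rw [← map_le_map_iff (equivOfIsAffine (X := X)), equivOfIsAffine_apply, equivOfIsAffine_apply]
    simp
  have h2 : ofIdealTop 𝔞 ≤ J.map f ↔ 𝔞 ≤ (J.map f).ideal ⟨⊤, isAffineOpen_top Y⟩ := by
    rw [← map_le_map_iff (equivOfIsAffine (X := Y)), equivOfIsAffine_apply, equivOfIsAffine_apply]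
    simp
  rw [← le_map_iff_comap_le, h1, h2, ideal_map_of_isAffineHom, Ideal.map_le_iff_le_comap]
  rfl

lemma appTop_mem_nonZeroDivisors [IsAffine X] [IsAffine Y] (f : X ⟶ Y) [IsOpenImmersion f]
    {t : Γ(Y, ⊤)} (ht : t ∈ nonZeroDivisors Γ(Y, ⊤)) :
    f.appTop.hom t ∈ nonZeroDivisors Γ(X, ⊤) := by
  have hflat := Scheme.Hom.flat_appTop f
  algebraize [f.appTop.hom]
  have := Module.Flat.isSMulRegular_of_nonZeroDivisors (M := Γ(X, ⊤)) ht
  rw [mem_nonZeroDivisors_iff_right]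
  intro z hz
  refine this (?_ : t • z = t • 0)
  rw [smul_zero, Algebra.smul_def, mul_comm]
  exact hz

lemma comap_ι_eq (I : X.IdealSheafData) (U : X.affineOpens) :
    I.comap U.1.ι = ofIdealTop ((I.ideal U).map U.1.topIso.inv.hom) := by
  have : IsAffine U.1 := U.2
  apply ext_of_isAffine
  have h : U.1 = U.1.ι ''ᵁ ⊤ := by simp
  have h1 := map_ideal' I (U := ⟨U.1.ι ''ᵁ ⊤, (isAffineOpen_top _).image_of_isOpenImmersion U.1.ι⟩)
    (V := U) (eqToHom (congrArg Opposite.op h))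
  refine (ideal_comap_of_isOpenImmersion I U.1.ι ⟨⊤, isAffineOpen_top _⟩).trans ?_
  refine (congrArg _ h1.symm).trans ?_
  rw [ofIdealTop_ideal, Ideal.map_map, ← CommRingCat.hom_comp]
  have hinv : (U.1.ι.appIso ⊤).inv = 𝟙 _ := by simp; rfl
  refine (congrArg (fun φ => Ideal.comap (CommRingCat.Hom.hom φ) _) hinv).trans ?_
  refine (Ideal.comap_id _).trans ?_
  congr 2
  have h3 : (U.1 : Scheme).presheaf.map (homOfLE (le_top : (⊤ : (U.1 : Scheme).Opens) ≤ ⊤)).op =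
    𝟙 _ := (U.1 : Scheme).presheaf.map_id _
  refine Eq.trans ?_ ((congrArg (U.1.topIso.inv ≫ ·) h3).trans (Category.comp_id _)).symm
  exact congrArg X.presheaf.map (Subsingleton.elim _ _)

/-- An invertible ideal sheaf is generated by a non-zero-divisor on arbitrarily small affine
neighbourhoods. -/
lemma IsInvertible.exists_affine {I : X.IdealSheafData} (hI : I.IsInvertible) (x : X)
    (O : X.Opens) (hx : x ∈ O) : ∃ U : X.Opens, IsAffineOpen U ∧ x ∈ U ∧ U ≤ O ∧
      ∃ t ∈ nonZeroDivisors Γ(U, ⊤), I.comap U.ι = ofIdealTop (Ideal.span {t}) := by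
  obtain ⟨U, hxU, t, ht, htU⟩ := hI x
  obtain ⟨s, hs, hxs⟩ := U.2.exists_basicOpen_le (V := O) ⟨x, hx⟩ hxU
  refine ⟨X.basicOpen s, U.2.basicOpen s, hxs, hs, ?_⟩
  have : IsAffine (X.basicOpen s) := U.2.basicOpen s
  have : IsAffine U.1 := U.2
  let k : (X.basicOpen s : Scheme) ⟶ U.1 := X.homOfLE (X.basicOpen_le s)
  have hk : k ≫ U.1.ι = (X.basicOpen s).ι := X.homOfLE_ι _
  refine ⟨k.appTop.hom (U.1.topIso.inv.hom t), appTop_mem_nonZeroDivisors k ?_, ?_⟩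
  · rw [mem_nonZeroDivisors_iff_right] at ht ⊢
    intro z hz
    have h1 := ht (U.1.topIso.hom.hom z) (by
      have h2 := congrArg U.1.topIso.hom.hom hz
      rw [map_mul, map_zero] at h2
      convert h2 using 2
      exact (congrArg (fun φ => φ.hom t) U.1.topIso.inv_hom_id).symm)
    have h3 := congrArg U.1.topIso.inv.hom h1
    rw [map_zero] at h3
    rw [← h3]
    exact (congrArg (fun φ => φ.hom z) U.1.topIso.hom_inv_id).symm
  · rw [← hk, comap_comp, comap_ι_eq, comap_ofIdealTop, htU, Ideal.map_span, Ideal.map_span,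
      Set.image_singleton, Set.image_singleton]

lemma isInvertible_of_affine {I : X.IdealSheafData}
    (h : ∀ x, ∃ (V : Scheme.{u}) (_ : IsAffine V) (j : V ⟶ X) (_ : IsOpenImmersion j),
      x ∈ Set.range j ∧ ∃ t ∈ nonZeroDivisors Γ(V, ⊤), I.comap j = ofIdealTop (Ideal.span {t})) :
    I.IsInvertible := by
  intro x
  obtain ⟨V, _, j, _, hx, t, ht, hI⟩ := h x
  refine ⟨⟨j ''ᵁ ⊤, (isAffineOpen_top V).image_of_isOpenImmersion j⟩, ?_, (j.appIso ⊤).inv.hom t,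
    ?_, ?_⟩
  · simpa using hx
  · rw [mem_nonZeroDivisors_iff_right] at ht ⊢
    intro z hz
    have h1 := ht ((j.appIso ⊤).hom.hom z) (by
      have h2 := congrArg (j.appIso ⊤).hom.hom hz
      rw [map_mul, map_zero] at h2
      convert h2 using 2
      exact (congrArg (fun φ => φ.hom t) (j.appIso ⊤).inv_hom_id).symm)
    have h3 := congrArg (j.appIso ⊤).inv.hom h1
    rw [map_zero] at h3
    rw [← h3]
    exact (congrArg (fun φ => φ.hom z) (j.appIso ⊤).hom_inv_id).symm
  · have h1 := ideal_comap_of_isOpenImmersion I j ⟨⊤, isAffineOpen_top V⟩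
    rw [hI, ofIdealTop_ideal] at h1
    have h2 : Ideal.map (j.appIso ⊤).inv.hom (Ideal.comap (j.appIso ⊤).inv.hom
        (I.ideal ⟨j ''ᵁ ⊤, (isAffineOpen_top V).image_of_isOpenImmersion j⟩)) = _ :=
      Ideal.map_comap_of_surjective _ (ConcreteCategory.bijective_of_isIso (j.appIso ⊤).inv).2 _
    rw [← h2]
    refine (congrArg _ h1.symm).trans ?_
    rw [Ideal.map_map, Ideal.map_span, Set.image_singleton]
    congr 2
    simp

lemma IsInvertible.comap_of_isOpenImmersion {I : X.IdealSheafData} (hI : I.IsInvertible)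
    {V : Scheme.{u}} (j : V ⟶ X) [IsOpenImmersion j] : (I.comap j).IsInvertible := by
  refine isInvertible_of_affine fun v => ?_
  obtain ⟨U, hU, hx, hle, t, ht, h⟩ := hI.exists_affine (j v) j.opensRange ⟨v, rfl⟩
  have hrange : Set.range U.ι ⊆ Set.range j := by
    rw [Scheme.Opens.range_ι]
    exact hle
  let k := IsOpenImmersion.lift j U.ι hrange
  have hk : k ≫ j = U.ι := IsOpenImmersion.lift_fac _ _ _
  have : IsOpenImmersion (k ≫ j) := by rw [hk]; infer_instance
  have : IsOpenImmersion k := IsOpenImmersion.of_comp k j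
  refine ⟨U, hU, k, inferInstance, ⟨⟨j v, hx⟩, ?_⟩, t, ht, ?_⟩
  · apply (Scheme.Hom.isOpenEmbedding j).injective
    exact congrArg (fun f : (U : Scheme) ⟶ X => f ⟨j v, hx⟩) hk
  · rw [← comap_comp, hk, h]

/-- The radical ideal sheaf of a closed set is computed in an affine chart. -/
lemma comap_vanishingIdeal {V : Scheme.{u}} [IsAffine V] (j : V ⟶ X) [IsOpenImmersion j]
    (Z : Closeds X) (𝔞 : Ideal Γ(V, ⊤)) (h𝔞 : 𝔞.IsRadical)
    (h : ∀ v, v ∈ V.zeroLocus (U := ⊤) (𝔞 : Set Γ(V, ⊤)) ↔ j v ∈ Z) :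
    (vanishingIdeal Z).comap j = ofIdealTop 𝔞 := by
  have h1 : ((vanishingIdeal Z).comap j).radical = (vanishingIdeal Z).comap j := by
    refine le_antisymm (fun U => ?_) (le_radical _)
    rw [radical_ideal, ideal_comap_of_isOpenImmersion, vanishingIdeal_ideal]
    exact (PrimeSpectrum.isRadical_vanishingIdeal _).comap _
  have h2 : (ofIdealTop 𝔞).radical = ofIdealTop 𝔞 := by
    refine ext_of_isAffine ?_
    rw [radical_ideal, ofIdealTop_ideal]
    have h3 : V.presheaf.map (homOfLE (le_top : (⊤ : V.Opens) ≤ ⊤)).op = 𝟙 _ :=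
      V.presheaf.map_id _
    erw [h3]
    change (Ideal.map (RingHom.id _) 𝔞).radical = Ideal.map (RingHom.id _) 𝔞
    rw [Ideal.map_id, h𝔞.radical]
  rw [← h1, ← h2, ← vanishingIdeal_support, ← vanishingIdeal_support]
  congr 1
  rw [support_comap]
  ext v
  have h4 : v ∈ (ofIdealTop 𝔞).support ↔ v ∈ V.zeroLocus (U := ⊤) (𝔞 : Set Γ(V, ⊤)) := by
    rw [← SetLike.mem_coe, coe_support_ofIdealTop]
  refine Iff.trans ?_ ((h v).symm.trans h4.symm)
  change j v ∈ ((vanishingIdeal Z).support : Set X) ↔ _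
  rw [coe_support_vanishingIdeal]
  rfl

end AlgebraicGeometry.Scheme.IdealSheafData

end

noncomputable section

open charLattice

/-! ### Faces of affine toric schemes -/

namespace toricSpec

variable {K : Type u} [Field K] {N Q : Type u} [AddCommMonoid N] [AddCommMonoid Q]
  {Z : Over (Spec (CommRingCat.of K))}

/-- The monomial `n` does not vanish at the image of `u` if and only if its pull-back does not vanish
at `u`. -/
lemma nonzeroAt_iff_mem_basicOpen (h : Z ⟶ toricSpec K N) (u : Z.left) (n : N) :
    NonzeroAt (h.left u) n ↔ u ∈ Z.left.basicOpen (char h n) := by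
  have h1 : h.left ⁻¹ᵁ ((toricSpec K N).left.basicOpen (char (𝟙 _) n)) =
      Z.left.basicOpen (char h n) := by
    have := Scheme.preimage_basicOpen_top h.left (char (𝟙 (toricSpec K N)) n)
    rw [this]
    rw [← char_comp, Category.comp_id]
  have h2 : (toricSpec K N).left.basicOpen (char (𝟙 _) n) =
      PrimeSpectrum.basicOpen (AddMonoidAlgebra.single n 1 : AddMonoidAlgebra K N) := by
    rw [char_id]
    exact basicOpen_eq_of_affine _
  rw [← h1, h2]
  rfl

lemma nonzeroAt_of_isUnit (h : Z ⟶ toricSpec K N) (u : Z.left) {n : N} (hn : IsUnit (char h n)) :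
    NonzeroAt (h.left u) n := by
  rw [nonzeroAt_iff_mem_basicOpen, Scheme.basicOpen_of_isUnit _ hn]
  trivial

/-- A face of the monoid `N`, with a homomorphism from the face to the monoid `Q`. -/
structure Face (N Q : Type u) [AddCommMonoid N] [AddCommMonoid Q] where
  mem : N → Prop
  toFun : N → Q
  mem_zero : mem 0
  mem_add (m n : N) : mem (m + n) ↔ mem m ∧ mem n
  toFun_zero : toFun 0 = 0
  toFun_add (m n : N) : mem m → mem n → toFun (m + n) = toFun m + toFun n

namespace Face

variable (F : Face N Q)

open Classical in
/-- The ring homomorphism `K[N] ⟶ K[Q]` which is zero on the monomials outside of the face. -/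
def ringHom (K : Type u) [Field K] : AddMonoidAlgebra K N →ₐ[K] AddMonoidAlgebra K Q :=
  AddMonoidAlgebra.lift K _ N
    { toFun n := if F.mem n.toAdd then AddMonoidAlgebra.single (F.toFun n.toAdd) 1 else 0
      map_one' := by
        rw [toAdd_one, if_pos F.mem_zero, F.toFun_zero, AddMonoidAlgebra.one_def]
      map_mul' m n := by
        rw [toAdd_mul]
        by_cases hm : F.mem m.toAdd
        · by_cases hn : F.mem n.toAdd
          · rw [if_pos hm, if_pos hn, if_pos ((F.mem_add _ _).2 ⟨hm, hn⟩), F.toFun_add _ _ hm hn,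
              AddMonoidAlgebra.single_mul_single, one_mul]
          · rw [if_neg hn, if_neg (fun h => hn ((F.mem_add _ _).1 h).2), mul_zero]
        · rw [if_neg hm, if_neg (fun h => hm ((F.mem_add _ _).1 h).1), zero_mul] }

open Classical in
lemma ringHom_of_mem {n : N} (hn : F.mem n) (r : K) : F.ringHom K (AddMonoidAlgebra.single n r) =
    AddMonoidAlgebra.single (F.toFun n) r := by
  rw [ringHom, AddMonoidAlgebra.lift_single]
  change r • (if F.mem n then _ else _) = _
  rw [if_pos hn, AddMonoidAlgebra.smul_single, smul_eq_mul, mul_one]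
  rfl

open Classical in
lemma ringHom_of_notMem {n : N} (hn : ¬ F.mem n) (r : K) :
    F.ringHom K (AddMonoidAlgebra.single n r) = 0 := by
  rw [ringHom, AddMonoidAlgebra.lift_single]
  change r • (if F.mem n then _ else _) = _
  rw [if_neg hn, smul_zero]

/-- The morphism `Spec K[Q] ⟶ Spec K[N]` onto the closed stratum of a face. -/
def map (K : Type u) [Field K] : toricSpec K Q ⟶ toricSpec K N :=
  Over.homMk (Spec.map (CommRingCat.ofHom (F.ringHom K).toRingHom)) (by
      refine (Spec.map_comp _ _).symm.trans (congrArg Spec.map ?_)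
      rw [← CommRingCat.ofHom_comp]
      exact congrArg CommRingCat.ofHom (F.ringHom K).comp_algebraMap)

lemma ringHom_comp_map (f : Z ⟶ toricSpec K Q) : toricSpec.ringHom (f ≫ F.map K) =
    (toricSpec.ringHom f).comp (F.ringHom K).toRingHom :=
  specHom_map (R := .of (AddMonoidAlgebra K Q)) _ _

lemma char_map_of_mem (f : Z ⟶ toricSpec K Q) {n : N} (hn : F.mem n) :
    char (f ≫ F.map K) n = char f (F.toFun n) := by
  rw [char, ringHom_comp_map]
  exact congrArg (toricSpec.ringHom f) (F.ringHom_of_mem hn 1)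

lemma char_map_of_notMem (f : Z ⟶ toricSpec K Q) {n : N} (hn : ¬ F.mem n) :
    char (f ≫ F.map K) n = 0 := by
  rw [char, ringHom_comp_map]
  exact (congrArg (toricSpec.ringHom f) (F.ringHom_of_notMem hn 1)).trans (map_zero _)

lemma nonzeroAt_map (y : (toricSpec K Q).left) (n : N) :
    NonzeroAt ((F.map K).left y) n ↔ F.mem n ∧ NonzeroAt y (F.toFun n) := by
  change F.ringHom K (AddMonoidAlgebra.single n 1) ∉ (id y : PrimeSpectrum _).asIdeal ↔ _
  by_cases hn : F.mem n
  · rw [F.ringHom_of_mem hn]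
    exact ⟨fun h => ⟨hn, h⟩, fun h => h.2⟩
  · rw [F.ringHom_of_notMem hn]
    exact ⟨fun h => absurd (zero_mem _) h, fun h => absurd h.1 hn⟩

end Face

end toricSpec

/-! ### Coordinate subspaces of the charts -/

variable {K E : Type u} [Field K] {G : Set (Set E)}

/-- The set `γ` is contained in the deepest set `D` of the family and contains none of the chosen
elements. -/
structure IsAdapted (c : Sel G) (D : G) (γ : Set E) : Prop where
  notMem (S : G) : (c S : E) ∉ γ
  subset : γ ⊆ D
  deepest (S : G) : ratio (c D : E) (c S) ∈ chartMonoid c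

lemma IsNested.isAdapted [Finite E] {c : Sel G} (hc : IsNested c) (hG : IsUnionClosed G) :
    ∃ D : G, ∀ γ : Set E, (∀ S ∈ G, γ ∪ S ∈ G) → (∀ S : G, (c S : E) ∉ γ) → IsAdapted c D γ := by
  obtain ⟨D, hD, h⟩ := hc.exists_deepest hG
  refine ⟨D, fun γ hγ h' => ⟨h', hc.subset_of_isFull hG hγ h' hD, fun S => ?_⟩⟩
  rw [← h S]
  exact ratio_mem_chartMonoid c _ (hG.subset_sup_left D S (c D).2)

namespace IsAdapted

open toricSpec

variable {c : Sel G} {D : G} {γ : Set E} (h : IsAdapted c D γ)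

lemma ratio_apply_self {a b : E} (hab : a ≠ b) : (ratio a b : E →₀ ℤ) a = 1 := by
  change (Finsupp.single a (1 : ℤ) - Finsupp.single b 1 : E →₀ ℤ) a = 1
  rw [Finsupp.sub_apply, Finsupp.single_eq_same, Finsupp.single_eq_of_ne hab, sub_zero]

lemma ratio_apply_of_ne {a b e : E} (hae : e ≠ a) (hbe : e ≠ b) : (ratio a b : E →₀ ℤ) e = 0 := by
  change (Finsupp.single a (1 : ℤ) - Finsupp.single b 1 : E →₀ ℤ) e = 0
  rw [Finsupp.sub_apply, Finsupp.single_eq_of_ne hae, Finsupp.single_eq_of_ne hbe, sub_zero]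

lemma ratio_apply_nonneg {a b e : E} (hbe : e ≠ b) : 0 ≤ (ratio a b : E →₀ ℤ) e := by
  by_cases hae : e = a
  · subst hae
    rw [ratio_apply_self hbe]
    exact zero_le_one
  · rw [ratio_apply_of_ne hae hbe]

/-- An element which is not chosen has non-negative exponents in the chart. -/
lemma _root_.apply_nonneg_of_mem_chartMonoid {c : Sel G} {e : E} (he : ∀ S : G, (c S : E) ≠ e)
    {m : charLattice E} (hm : m ∈ chartMonoid c) : 0 ≤ (m : E →₀ ℤ) e := by
  induction hm using AddSubmonoid.closure_induction with
  | mem m hm =>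
    obtain ⟨S, a, -, rfl⟩ := hm
    exact ratio_apply_nonneg (he S).symm
  | zero => rfl
  | add m m' _ _ h h' => exact add_nonneg h h'

include h

lemma apply_nonneg {e : E} (he : e ∈ γ) {m : charLattice E} (hm : m ∈ chartMonoid c) :
    0 ≤ (m : E →₀ ℤ) e :=
  apply_nonneg_of_mem_chartMonoid (fun S hS => h.notMem S (hS ▸ he)) hm

/-- The face of the monomials that do not involve the coordinates in `γ`. -/
def face : Face (chartMonoid c) (chartMonoid c) where
  mem m := ∀ e ∈ γ, (m.1 : E →₀ ℤ) e = 0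
  toFun := id
  mem_zero _ _ := rfl
  mem_add m n := by
    constructor
    · intro h1
      have h2 (e) (he : e ∈ γ) : (m.1 : E →₀ ℤ) e + (n.1 : E →₀ ℤ) e = 0 := h1 e he
      exact ⟨fun e he => by
          have := h.apply_nonneg he m.2; have := h.apply_nonneg he n.2; have := h2 e he; omega,
        fun e he => by
          have := h.apply_nonneg he m.2; have := h.apply_nonneg he n.2; have := h2 e he; omega⟩
    · rintro ⟨h1, h2⟩ e he
      change (m.1 : E →₀ ℤ) e + (n.1 : E →₀ ℤ) e = 0
      rw [h1 e he, h2 e he, add_zero]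
  toFun_zero := rfl
  toFun_add _ _ _ _ := rfl

/-- The monomial `X_a / X_n`, where `n` is the deepest chosen element. -/
def gen (a : γ) : chartMonoid c := chartGen c D ⟨a, h.subset a.2⟩

lemma exists_eq_gen_add (m : chartMonoid c) (hm : ¬ h.face.mem m) :
    ∃ a m', m = h.gen a + m' := by
  have key (m : charLattice E) (hm : m ∈ chartMonoid c) : (∀ e ∈ γ, (m : E →₀ ℤ) e = 0) ∨
      ∃ a m', (⟨m, hm⟩ : chartMonoid c) = h.gen a + m' := by
    induction hm using AddSubmonoid.closure_induction with
    | mem m hm =>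
      obtain ⟨S, a, ha, rfl⟩ := hm
      by_cases haγ : a ∈ γ
      · right
        refine ⟨⟨a, haγ⟩, ⟨_, h.deepest S⟩, Subtype.ext ?_⟩
        exact (ratio_add_ratio _ _ _).symm
      · left
        intro e he
        exact ratio_apply_of_ne (fun hea => haγ (hea ▸ he)) (fun hea => h.notMem S (hea ▸ he))
    | zero => exact Or.inl fun _ _ => rfl
    | add m m' hm hm' h1 h2 =>
      rcases h1 with h1 | ⟨a, n, hn⟩
      · rcases h2 with h2 | ⟨a, n, hn⟩
        · left
          intro e he
          change (m : E →₀ ℤ) e + (m' : E →₀ ℤ) e = 0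
          rw [h1 e he, h2 e he, add_zero]
        · right
          refine ⟨a, n + ⟨m, hm⟩, ?_⟩
          rw [← add_assoc, ← hn]
          exact Subtype.ext (add_comm m m')
      · right
        refine ⟨a, n + ⟨m', hm'⟩, ?_⟩
        rw [← add_assoc, ← hn]
        rfl
  exact (key m.1 m.2).resolve_left hm

lemma gen_notMem (a : γ) : ¬ h.face.mem (h.gen a) := by
  intro h1
  have h2 : (ratio (a : E) (c D) : E →₀ ℤ) a = 0 := h1 a a.2
  rw [ratio_apply_self (fun h3 : (a : E) = c D => h.notMem D (h3 ▸ a.2))] at h2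
  exact one_ne_zero h2

/-- The kernel of the restriction to the face is generated by the coordinates in `γ`. -/
lemma ker_face : RingHom.ker (h.face.ringHom K).toRingHom =
    Ideal.span (Set.range fun a => (AddMonoidAlgebra.single (h.gen a) 1 :
      AddMonoidAlgebra K (chartMonoid c))) := by
  apply le_antisymm
  · have key (x : AddMonoidAlgebra K (chartMonoid c)) : x - h.face.ringHom K x ∈
        Ideal.span (Set.range fun a => (AddMonoidAlgebra.single (h.gen a) 1 :
          AddMonoidAlgebra K (chartMonoid c))) := by
      induction x using AddMonoidAlgebra.induction_on with
      | of m =>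
        change AddMonoidAlgebra.single m 1 - h.face.ringHom K (AddMonoidAlgebra.single m 1) ∈ _
        by_cases hm : h.face.mem m
        · rw [Face.ringHom_of_mem _ hm]
          change AddMonoidAlgebra.single m 1 - AddMonoidAlgebra.single m 1 ∈ _
          rw [sub_self]
          exact zero_mem _
        · rw [Face.ringHom_of_notMem _ hm, sub_zero]
          obtain ⟨a, m', rfl⟩ := h.exists_eq_gen_add m hm
          have : (AddMonoidAlgebra.single (h.gen a + m') 1 : AddMonoidAlgebra K (chartMonoid c)) =
              AddMonoidAlgebra.single m' 1 * AddMonoidAlgebra.single (h.gen a) 1 := by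
            rw [AddMonoidAlgebra.single_mul_single, one_mul, add_comm]
          rw [this]
          exact Ideal.mul_mem_left _ _ (Ideal.subset_span ⟨a, rfl⟩)
      | add x y hx hy =>
        rw [map_add, add_sub_add_comm]
        exact add_mem hx hy
      | smul r x hx =>
        rw [map_smul, ← smul_sub]
        exact Submodule.smul_of_tower_mem _ r hx
    intro x hx
    have h1 := key x
    rw [show h.face.ringHom K x = 0 from hx, sub_zero] at h1
    exact h1
  · rw [Ideal.span_le]
    rintro _ ⟨a, rfl⟩
    exact Face.ringHom_of_notMem _ (h.gen_notMem a) 1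

/-- The generic point of the coordinate subspace. -/
lemma exists_generic (K : Type u) [Field K] : ∃ η : (toricSpec K (chartMonoid c)).left,
    (∀ m, NonzeroAt η m ↔ ∀ e ∈ γ, (m.1 : E →₀ ℤ) e = 0) ∧
    ∀ z : (toricSpec K (chartMonoid c)).left, (∀ a, ¬ NonzeroAt z (h.gen a)) → η ⤳ z := by
  have hdom : IsDomain (AddMonoidAlgebra K (chartMonoid c)) := isDomain
  have hprime : (RingHom.ker (h.face.ringHom K).toRingHom).IsPrime := RingHom.ker_isPrime _
  refine ⟨(⟨_, hprime⟩ : PrimeSpectrum (AddMonoidAlgebra K (chartMonoid c))), fun m => ?_,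
    fun z hz => ?_⟩
  · change h.face.ringHom K (AddMonoidAlgebra.single m 1) ≠ 0 ↔ h.face.mem m
    by_cases hm : h.face.mem m
    · rw [Face.ringHom_of_mem _ hm]
      exact ⟨fun _ => hm, fun _ => by simp⟩
    · rw [Face.ringHom_of_notMem _ hm]
      exact ⟨fun h => absurd rfl h, fun h => absurd h hm⟩
  · refine (PrimeSpectrum.le_iff_specializes (R := AddMonoidAlgebra K (chartMonoid c))
      ⟨_, hprime⟩ z).1 ?_
    change RingHom.ker (h.face.ringHom K).toRingHom ≤ (id z : PrimeSpectrum _).asIdeal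
    rw [h.ker_face, Ideal.span_le]
    rintro _ ⟨a, rfl⟩
    exact not_not.1 (hz a)

end IsAdapted

/-! ### Centres of blow-ups -/

namespace Atlas

open toricSpec

variable {X : Over (Spec (CommRingCat.of K))} (A : Atlas G X)

lemma isOpen_mem_nz (S : G) (a : E) : IsOpen {x | a ∈ A.nz S x} := by
  have : {x | a ∈ A.nz S x} = ⋃ c : {c : Sel G // (c S : E) = a}, Set.range (A.chart c.1).left := by
    ext x
    simp only [Set.mem_iUnion, Subtype.exists]
    exact ⟨fun ⟨c, h, hx⟩ => ⟨c, h, hx⟩, fun ⟨c, h, hx⟩ => ⟨c, h, hx⟩⟩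
  rw [this]
  exact isOpen_iUnion fun c => (A.chart c.1).left.isOpenEmbedding.isOpen_range

/-- The strict transform of the coordinate linear space of `γ`: the coordinates in `γ` vanish, in all
simplices around `γ`. -/
def center (γ : Set E) : Closeds X.left where
  carrier := {x | ∀ S : G, γ ⊆ S → ∀ a ∈ γ, a ∉ A.nz S x}
  isClosed' := by
    have : {x | ∀ S : G, γ ⊆ S → ∀ a ∈ γ, a ∉ A.nz S x} =
        ⋂ S : G, ⋂ _ : γ ⊆ S, ⋂ a ∈ γ, {x | a ∈ A.nz S x}ᶜ := by
      ext x; simp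
    rw [this]
    exact isClosed_iInter fun S => isClosed_iInter fun _ => isClosed_iInter fun a =>
      isClosed_iInter fun _ => (A.isOpen_mem_nz S a).isClosed_compl

lemma mem_center {γ : Set E} {x : X.left} :
    x ∈ A.center γ ↔ ∀ S : G, γ ⊆ S → ∀ a ∈ γ, a ∉ A.nz S x := Iff.rfl

lemma chart_mem_center {c : Sel G} {D : G} {γ : Set E} (h : IsAdapted c D γ)
    (y : (toricSpec K (chartMonoid c)).left) :
    (A.chart c).left y ∈ A.center γ ↔ ∀ a, ¬ NonzeroAt y (h.gen a) := by
  rw [mem_center]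
  constructor
  · intro h1 a h2
    exact h1 D h.subset a a.2 ((A.mem_nz_chart_iff c y D ⟨a, h.subset a.2⟩).2 h2)
  · intro h1 S hS a ha h2
    have h3 := (A.mem_nz_chart_iff c y S ⟨a, hS ha⟩).1 h2
    have h4 : chartGen c S ⟨a, hS ha⟩ = h.gen ⟨a, ha⟩ + ⟨_, h.deepest S⟩ :=
      Subtype.ext (ratio_add_ratio _ _ _).symm
    rw [h4, nonzeroAt_add] at h3
    exact h1 _ h3.1

lemma chart_notMem_center {c : Sel G} {γ : Set E} {S : G} (hS : γ ⊆ S) (h : (c S : E) ∈ γ)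
    (y : (toricSpec K (chartMonoid c)).left) : (A.chart c).left y ∉ A.center γ :=
  fun h1 => h1 S hS _ h (A.mem_nz_of_mem_range ⟨y, rfl⟩ S)

end Atlas

end

noncomputable section

open charLattice toricSpec

variable {K E : Type u} [Field K] {G 𝒮 : Set (Set E)}

/-! ### Refining the family of simplices -/

/-- A morphism over `S` into an open subscheme. -/
lemma exists_over_lift {S : Scheme.{u}} {V X U : Over S} (j : V ⟶ X) [IsOpenImmersion j.left]
    (g : U ⟶ X) (h : Set.range g.left ⊆ Set.range j.left) : ∃ k : U ⟶ V, k ≫ j = g := by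
  refine ⟨Over.homMk (IsOpenImmersion.lift j.left g.left h) ?_, ?_⟩
  · rw [← Over.w j, ← Category.assoc, IsOpenImmersion.lift_fac, Over.w]
  · exact Over.OverMorphism.ext (IsOpenImmersion.lift_fac _ _ _)

lemma over_cancel {S : Scheme.{u}} {V X U : Over S} (j : V ⟶ X) [IsOpenImmersion j.left]
    {k k' : U ⟶ V} (h : k ≫ j = k' ≫ j) : k = k' := by
  apply Over.OverMorphism.ext
  rw [← cancel_mono j.left]
  exact congrArg (·.left) h

/-- The family `𝒮` of new sets may be added to the union-closed family `G` in one step. As the union of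
two different new sets is an old one, the centres of the new sets are disjoint. -/
structure IsStep (G 𝒮 : Set (Set E)) : Prop where
  isUnionClosed : IsUnionClosed G
  nonempty : ∀ γ ∈ 𝒮, γ.Nonempty
  union_mem : ∀ γ ∈ 𝒮, ∀ S ∈ G, γ ∪ S ∈ G
  union_mem' : ∀ γ ∈ 𝒮, ∀ δ ∈ 𝒮, γ ≠ δ → γ ∪ δ ∈ G

lemma IsStep.isUnionClosed_union (h : IsStep G 𝒮) : IsUnionClosed (G ∪ 𝒮) where
  univ_mem := Or.inl h.isUnionClosed.univ_mem
  empty_notMem := by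
    rintro (h1 | h1)
    · exact h.isUnionClosed.empty_notMem h1
    · exact Set.not_nonempty_empty (h.nonempty _ h1)
  union_mem S hS T hT := by
    rcases hS with hS | hS
    · rcases hT with hT | hT
      · exact Or.inl (h.isUnionClosed.union_mem S hS T hT)
      · rw [Set.union_comm S]; exact Or.inl (h.union_mem T hT S hS)
    · rcases hT with hT | hT
      · exact Or.inl (h.union_mem S hS T hT)
      · by_cases hST : S = T
        · subst hST
          rw [Set.union_self]
          exact Or.inr hS
        · exact Or.inl (h.union_mem' S hS T hT hST)

/-- The restriction of a choice to a smaller family. -/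
def Sel.res (c : Sel (G ∪ 𝒮)) : Sel G := fun S => c ⟨S, Or.inl S.2⟩

lemma Sel.exists_extension (c : Sel G)
    (P : Set E → E → Prop) (hP : ∀ σ ∈ 𝒮, σ ∉ G → ∃ a ∈ σ, P σ a) :
    ∃ c' : Sel (G ∪ 𝒮), c'.res = c ∧ ∀ σ (hσ : σ ∈ 𝒮), σ ∉ G → P σ (c' ⟨σ, Or.inr hσ⟩) := by
  classical
  choose a ha hPa using hP
  refine ⟨fun T => if hT : (T : Set E) ∈ G then c ⟨T, hT⟩ else
    ⟨a T (T.2.resolve_left hT) hT, ha T (T.2.resolve_left hT) hT⟩, ?_, fun σ hσ hσG => ?_⟩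
  · funext S
    simp [Sel.res]
  · simp only [dif_neg hσG]
    exact hPa σ hσ hσG

lemma IsNested.res {c : Sel (G ∪ 𝒮)} (hc : IsNested c) : IsNested c.res :=
  fun S T h1 h2 => hc ⟨S, Or.inl S.2⟩ ⟨T, Or.inl T.2⟩ h1 h2

lemma chartMonoid_res_le (c : Sel (G ∪ 𝒮)) : chartMonoid c.res ≤ chartMonoid c := by
  rw [chartMonoid, AddSubmonoid.closure_le]
  rintro _ ⟨S, a, ha, rfl⟩
  exact ratio_mem_chartMonoid c ⟨S, Or.inl S.2⟩ ha

/-- The inclusion of the monoids of the charts. -/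
def resIncl (c : Sel (G ∪ 𝒮)) : chartMonoid c.res →+ chartMonoid c :=
  AddSubmonoid.inclusion (chartMonoid_res_le c)

namespace Atlas

variable {X X' : Over (Spec (CommRingCat.of K))} (A : Atlas G X) (A' : Atlas (G ∪ 𝒮) X')

/-- The morphism `f`, from the scheme of the refined family to the scheme of the family, is given by the inclusions of the monoids of the charts. -/
def IsRefinement (f : X' ⟶ X) : Prop :=
  ∀ c : Sel (G ∪ 𝒮), A'.chart c ≫ f = toricSpec.map K (resIncl c) ≫ A.chart c.res

lemma exists_isRefinement : ∃ f : X' ⟶ X, IsRefinement A A' f := by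
  have := A.isSeparated
  refine A'.exists_glue (fun c => toricSpec.map K (resIncl c) ≫ A.chart c.res) A.incl fun c => ?_
  rw [map_comp_map_assoc, ← A.map_chart c.res]
  rfl

variable {A A'} {f : X' ⟶ X}

lemma IsRefinement.incl_comp [Nonempty (Sel (G ∪ 𝒮))] (hf : IsRefinement A A' f) :
    A'.incl ≫ f = A.incl := by
  let c : Sel (G ∪ 𝒮) := Classical.arbitrary _
  rw [← A'.map_chart c, Category.assoc, hf c, map_comp_map_assoc, ← A.map_chart c.res]
  rfl

lemma IsRefinement.nz_eq (hf : IsRefinement A A' f) (S : G) (z : X'.left) :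
    A'.nz ⟨S, Or.inl S.2⟩ z = A.nz S (f.left z) := by
  obtain ⟨c, y, rfl⟩ := A'.covers z
  have h1 : f.left ((A'.chart c).left y) =
      (A.chart c.res).left ((toricSpec.map K (resIncl c)).left y) :=
    congrArg (fun φ : toricSpec K (chartMonoid c) ⟶ X => φ.left y) (hf c)
  rw [h1]
  ext a
  by_cases ha : a ∈ (S : Set E)
  · rw [A'.mem_nz_chart_iff c y ⟨S, Or.inl S.2⟩ ⟨a, ha⟩, A.mem_nz_chart_iff c.res _ S ⟨a, ha⟩,
      nonzeroAt_map]
    rfl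
  · exact ⟨fun h => absurd (A'.nz_subset _ _ h) ha, fun h => absurd (A.nz_subset _ _ h) ha⟩

/-! ### Lifting morphisms to a blow-up -/

section lift

variable {U : Over (Spec (CommRingCat.of K))}

/-- On the `K`-scheme `U`, which is mapped to a chart by `h`, the element chosen in each new set is
such that its coordinate divides the others of the set, and is not a zero-divisor. -/
structure Generates (c : Sel (G ∪ 𝒮)) (h : U ⟶ toricSpec K (chartMonoid c.res)) : Prop where
  out (σ : Set E) (hσ : σ ∈ 𝒮) : ∃ (S : G) (hS : σ ⊆ S),
    char h (chartGen c.res S ⟨c ⟨σ, Or.inr hσ⟩, hS (c ⟨σ, Or.inr hσ⟩).2⟩) ∈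
      nonZeroDivisors Γ(U.left, ⊤) ∧
    ∀ a (ha : a ∈ σ), char h (chartGen c.res S ⟨c ⟨σ, Or.inr hσ⟩, hS (c ⟨σ, Or.inr hσ⟩).2⟩) ∣
      char h (chartGen c.res S ⟨a, hS ha⟩)

namespace Generates

variable {c : Sel (G ∪ 𝒮)} {h : U ⟶ toricSpec K (chartMonoid c.res)} (H : Generates c h)

include H

/-- A monomial of the refined chart is a quotient of monomials of the chart, and the division can be
carried out in the functions on `U`. -/
lemma exists_frac (m : chartMonoid c) : ∃ (v : Γ(U.left, ⊤)) (k n : chartMonoid c.res),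
    resIncl c n = m + resIncl c k ∧ char h k ∈ nonZeroDivisors Γ(U.left, ⊤) ∧
      v * char h k = char h n := by
  obtain ⟨m, hm⟩ := m
  induction hm using AddSubmonoid.closure_induction with
  | mem m hm =>
    obtain ⟨⟨σ, hσ⟩, a, ha, rfl⟩ := hm
    by_cases hσG : σ ∈ G
    · refine ⟨char h (chartGen c.res ⟨σ, hσG⟩ ⟨a, ha⟩), 0, chartGen c.res ⟨σ, hσG⟩ ⟨a, ha⟩, ?_, ?_, ?_⟩
      · rw [map_zero, add_zero]; rfl
      · rw [char_zero]; exact one_mem _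
      · rw [char_zero, mul_one]
    · obtain ⟨S, hS, h1, h2⟩ := H.out σ (hσ.resolve_left hσG)
      obtain ⟨v, hv⟩ := h2 a ha
      refine ⟨v, _, _, ?_, h1, ((mul_comm _ _).trans hv.symm)⟩
      exact Subtype.ext (ratio_add_ratio _ _ _).symm
  | zero =>
    refine ⟨1, 0, 0, by rw [map_zero, add_zero]; rfl, ?_, by rw [char_zero, one_mul]⟩
    rw [char_zero]; exact one_mem _
  | add m m' hm hm' h1 h2 =>
    obtain ⟨v, k, n, e1, e2, e3⟩ := h1
    obtain ⟨v', k', n', e1', e2', e3'⟩ := h2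
    refine ⟨v * v', k + k', n + n', ?_, ?_, ?_⟩
    · rw [map_add, map_add, e1, e1', add_add_add_comm]; rfl
    · rw [char_add]; exact mul_mem e2 e2'
    · rw [char_add, char_add, ← e3, ← e3', mul_mul_mul_comm]

omit H in
lemma frac_unique {m : chartMonoid c} {v v' : Γ(U.left, ⊤)} {k n k' n' : chartMonoid c.res}
    (h1 : resIncl c n = m + resIncl c k) (h2 : char h k ∈ nonZeroDivisors Γ(U.left, ⊤))
    (h3 : v * char h k = char h n) (h1' : resIncl c n' = m + resIncl c k')
    (h2' : char h k' ∈ nonZeroDivisors Γ(U.left, ⊤)) (h3' : v' * char h k' = char h n') :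
    v = v' := by
  have h4 : n + k' = n' + k := by
    apply AddSubmonoid.inclusion_injective (chartMonoid_res_le c)
    change resIncl c _ = resIncl c _
    rw [map_add, map_add, h1, h1']
    abel
  have h5 : v * (char h k * char h k') = v' * (char h k * char h k') := by
    rw [← mul_assoc, h3, mul_comm (char h k), ← mul_assoc, h3', ← char_add, ← char_add, h4]
  exact (mul_cancel_right_mem_nonZeroDivisors (mul_mem h2 h2')).1 h5

/-- Existence of the lift to the chart of the refined family. -/
lemma exists_lift : ∃ l : U ⟶ toricSpec K (chartMonoid c), l ≫ toricSpec.map K (resIncl c) = h := by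
  choose v k n h1 h2 h3 using H.exists_frac
  refine ⟨toricSpec.lift
    { toFun m := v m.toAdd
      map_one' := ?_
      map_mul' m m' := ?_ }, ?_⟩
  · refine frac_unique (h1 _) (h2 _) (h3 _) (k' := 0) (n' := 0) ?_ ?_ ?_
    · rw [map_zero, add_zero]; rfl
    · rw [char_zero]; exact one_mem _
    · rw [char_zero, one_mul]
  · refine frac_unique (h1 _) (h2 _) (h3 _) (k' := k m.toAdd + k m'.toAdd)
      (n' := n m.toAdd + n m'.toAdd) ?_ ?_ ?_
    · rw [map_add, map_add, h1, h1, add_add_add_comm]; rfl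
    · rw [char_add]; exact mul_mem (h2 _) (h2 _)
    · rw [char_add, char_add, ← h3, ← h3, mul_mul_mul_comm]
  · refine toricSpec.hom_ext fun m => ?_
    rw [char_map, char_lift]
    refine frac_unique (h1 _) (h2 _) (h3 _) (k' := 0) (n' := m) ?_ ?_ ?_
    · rw [map_zero, add_zero]; rfl
    · rw [char_zero]; exact one_mem _
    · rw [char_zero, mul_one]

lemma lift_unique {l l' : U ⟶ toricSpec K (chartMonoid c)}
    (hl : l ≫ toricSpec.map K (resIncl c) = h) (hl' : l' ≫ toricSpec.map K (resIncl c) = h) :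
    l = l' := by
  refine toricSpec.hom_ext fun m => ?_
  obtain ⟨v, k, n, h1, h2, h3⟩ := H.exists_frac m
  have h4 (l : U ⟶ toricSpec K (chartMonoid c)) (hl : l ≫ toricSpec.map K (resIncl c) = h) :
      char l m * char h k = char h n := by
    rw [← hl, char_map, char_map, h1, char_add]
  exact frac_unique h1 h2 (h4 l hl) h1 h2 (h4 l' hl')

end Generates

lemma char_eq_of_comp_chart_eq {c c' : Sel G} (hcc' : c = c') {h : U ⟶ toricSpec K (chartMonoid c)}
    {h' : U ⟶ toricSpec K (chartMonoid c')} (e : h ≫ A.chart c = h' ≫ A.chart c')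
    (S : G) (a : (S : Set E)) : char h (chartGen c S a) = char h' (chartGen c' S a) := by
  subst hcc'
  rw [over_cancel _ e]

/-- A lift to the refined family lands in the expected chart. -/
lemma Generates.mem_range (hf : IsRefinement A A' f) [IsAffine U.left] {c : Sel (G ∪ 𝒮)}
    {h : U ⟶ toricSpec K (chartMonoid c.res)} (H : Generates c h) (l : U ⟶ X')
    (hl : l ≫ f = h ≫ A.chart c.res) (u : U.left) :
    l.left u ∈ Set.range (A'.chart c).left := by
  classical
  rw [A'.mem_range_iff]
  have hG (S : G) : (c.res S : E) ∈ A'.nz ⟨S, Or.inl S.2⟩ (l.left u) := by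
    rw [hf.nz_eq]
    have : f.left (l.left u) = (A.chart c.res).left (h.left u) :=
      congrArg (fun φ : U ⟶ X => φ.left u) hl
    rw [this]
    exact A.mem_nz_of_mem_range ⟨_, rfl⟩ S
  rintro ⟨σ, hσ⟩
  by_cases hσG : σ ∈ G
  · exact hG ⟨σ, hσG⟩
  have hσ' := hσ.resolve_left hσG
  -- a choice `d` whose chart contains the image of `u`, and which agrees with `c` on `G`
  choose c₀ hc₀ using fun T => A'.nz_nonempty T (l.left u)
  let d : Sel (G ∪ 𝒮) := fun T => if (T : Set E) ∈ G then c T else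
    ⟨c₀ T, A'.nz_subset _ _ (hc₀ T)⟩
  have hd : d.res = c.res := by
    funext S
    exact if_pos S.2
  have hu : l.left u ∈ Set.range (A'.chart d).left := by
    rw [A'.mem_range_iff]
    intro T
    by_cases hT : (T : Set E) ∈ G
    · have : d T = c T := if_pos hT
      rw [this]
      exact hG ⟨T, hT⟩
    · have : d T = ⟨c₀ T, A'.nz_subset _ _ (hc₀ T)⟩ := if_neg hT
      rw [this]
      exact hc₀ T
  clear_value d
  -- restrict to an affine neighbourhood `V` of `u` which is mapped to this chart
  obtain ⟨_, ⟨(V : U.left.Opens), hV, rfl⟩, huV, hVle⟩ := U.left.isBasis_affineOpens.exists_subset_of_mem_open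
    (show u ∈ l.left ⁻¹ᵁ (A'.chart d).left.opensRange from hu)
    (l.left ⁻¹ᵁ (A'.chart d).left.opensRange).2
  have hVaff : IsAffine V := hV
  let VO : Over (Spec (CommRingCat.of K)) := Over.mk (V.ι ≫ U.hom)
  let i : VO ⟶ U := Over.homMk V.ι rfl
  obtain ⟨lV, hlV⟩ := exists_over_lift (A'.chart d) (i ≫ l) (by
    rintro _ ⟨v, rfl⟩
    exact hVle v.2)
  have e : (lV ≫ toricSpec.map K (resIncl d)) ≫ A.chart d.res = (i ≫ h) ≫ A.chart c.res := by
    rw [Category.assoc, ← hf, reassoc_of% hlV, hl, Category.assoc]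
  obtain ⟨S, hS, h1, h2⟩ := H.out σ hσ'
  set b : (S : Set E) := ⟨c ⟨σ, Or.inr hσ'⟩, hS (c ⟨σ, Or.inr hσ'⟩).2⟩ with hb
  let a : (S : Set E) := ⟨d ⟨σ, Or.inr hσ'⟩, hS (d ⟨σ, Or.inr hσ'⟩).2⟩
  have hxb : char (i ≫ h) (chartGen c.res S b) ∈ nonZeroDivisors Γ(VO.left, ⊤) := by
    rw [char_comp]
    exact Scheme.IdealSheafData.appTop_mem_nonZeroDivisors V.ι h1
  have hxa : char (i ≫ h) (chartGen c.res S b) ∣ char (i ≫ h) (chartGen c.res S a) := by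
    rw [char_comp, char_comp]
    exact map_dvd _ (h2 a (d ⟨σ, Or.inr hσ'⟩).2)
  obtain ⟨s, hs⟩ := hxa
  have ht : char (i ≫ h) (chartGen c.res S b) =
      char lV (chartGen d ⟨σ, Or.inr hσ'⟩ ⟨b, (c ⟨σ, Or.inr hσ'⟩).2⟩) *
        char (i ≫ h) (chartGen c.res S a) := by
    rw [← char_eq_of_comp_chart_eq hd e, ← char_eq_of_comp_chart_eq hd e, char_map, char_map,
      ← char_add]
    congr 1
    exact Subtype.ext (ratio_add_ratio _ _ _).symm
  have hunit : IsUnit (char lV (chartGen d ⟨σ, Or.inr hσ'⟩ ⟨b, (c ⟨σ, Or.inr hσ'⟩).2⟩)) := by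
    refine IsUnit.of_mul_eq_one s ((mul_cancel_right_mem_nonZeroDivisors hxb).1 ?_)
    rw [one_mul]
    conv_rhs => rw [ht, hs]
    ring
  have h3 := nonzeroAt_of_isUnit lV ⟨u, huV⟩ hunit
  rw [← A'.mem_nz_chart_iff] at h3
  have h4 : (A'.chart d).left (lV.left ⟨u, huV⟩) = l.left u :=
    congrArg (fun φ : VO ⟶ X' => φ.left ⟨u, huV⟩) hlV
  rw [h4] at h3
  exact h3

lemma Generates.eq_of_comp_eq (hf : IsRefinement A A' f) [IsAffine U.left] {c : Sel (G ∪ 𝒮)}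
    {h : U ⟶ toricSpec K (chartMonoid c.res)} (H : Generates c h) {l l' : U ⟶ X'}
    (hl : l ≫ f = h ≫ A.chart c.res) (hl' : l' ≫ f = h ≫ A.chart c.res) : l = l' := by
  obtain ⟨k, hk⟩ := exists_over_lift (A'.chart c) l
    (by rintro _ ⟨u, rfl⟩; exact H.mem_range hf l hl u)
  obtain ⟨k', hk'⟩ := exists_over_lift (A'.chart c) l'
    (by rintro _ ⟨u, rfl⟩; exact H.mem_range hf l' hl' u)
  have h1 : k ≫ toricSpec.map K (resIncl c) = h := over_cancel (A.chart c.res) (by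
    rw [Category.assoc, ← hf, reassoc_of% hk, hl])
  have h1' : k' ≫ toricSpec.map K (resIncl c) = h := over_cancel (A.chart c.res) (by
    rw [Category.assoc, ← hf, reassoc_of% hk', hl'])
  rw [← hk, ← hk', H.lift_unique h1 h1']

end lift

end Atlas

end

noncomputable section

open charLattice toricSpec Scheme.IdealSheafData

variable {K E : Type u} [Field K] {G 𝒮 : Set (Set E)}

/-! ### Blow-ups of toric schemes -/

namespace toricSpec

variable {N : Type u} [AddCommMonoid N]

instance isAffine : IsAffine (toricSpec K N).left :=
  inferInstanceAs (IsAffine (Spec (.of (AddMonoidAlgebra K N))))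

/-- The isomorphism between the ring of functions on `toricSpec K N` and the monoid algebra. -/
def ΓEquiv (K N : Type u) [Field K] [AddCommMonoid N] :
    Γ((toricSpec K N).left, ⊤) ≃+* AddMonoidAlgebra K N :=
  (Scheme.ΓSpecIso (.of (AddMonoidAlgebra K N))).commRingCatIsoToRingEquiv

lemma ΓEquiv_symm_single (n : N) : (ΓEquiv K N).symm (AddMonoidAlgebra.single n 1) =
    char (𝟙 (toricSpec K N)) n := (char_id n).symm

lemma char_mem_nonZeroDivisors [TwoUniqueSums N] (n : N) :
    char (𝟙 (toricSpec K N)) n ∈ nonZeroDivisors Γ((toricSpec K N).left, ⊤) := by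
  have : IsDomain (AddMonoidAlgebra K N) := isDomain
  have : IsDomain Γ((toricSpec K N).left, ⊤) := MulEquiv.isDomain _ (ΓEquiv K N).toMulEquiv
  refine mem_nonZeroDivisors_of_ne_zero fun h => ?_
  rw [← ΓEquiv_symm_single, EmbeddingLike.map_eq_zero_iff] at h
  simp at h

end toricSpec

namespace Atlas

variable {X X' : Over (Spec (CommRingCat.of K))} (A : Atlas G X) {A' : Atlas (G ∪ 𝒮) X'}

/-- The union of the closed sets to be blown up. -/
abbrev totalCenter (𝒮 : Set (Set E)) : Closeds X.left := sSup (A.center '' 𝒮)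

lemma mem_totalCenter [Finite E] {x : X.left} :
    x ∈ A.totalCenter 𝒮 ↔ ∃ γ ∈ 𝒮, x ∈ A.center γ := by
  have hcl : IsClosed (⋃ γ ∈ 𝒮, (A.center γ : Set X.left)) :=
    (Set.toFinite 𝒮).isClosed_biUnion fun γ _ => (A.center γ).isClosed
  have : A.totalCenter 𝒮 = (⟨⋃ γ ∈ 𝒮, (A.center γ : Set X.left), hcl⟩ : Closeds X.left) := by
    apply le_antisymm
    · refine sSup_le ?_
      rintro _ ⟨γ, hγ, rfl⟩
      exact Set.subset_biUnion_of_mem (u := fun γ => (A.center γ : Set X.left)) hγ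
    · refine Set.iUnion₂_subset fun γ hγ => ?_
      exact le_sSup (s := A.center '' 𝒮) ⟨γ, hγ, rfl⟩
  rw [this]
  change x ∈ ⋃ γ ∈ 𝒮, (A.center γ : Set X.left) ↔ _
  simp

lemma mem_zeroLocus_span_iff {N : Type u} [AddCommMonoid N] {ι : Type*} (m : ι → N)
    (y : (toricSpec K N).left) :
    y ∈ (toricSpec K N).left.zeroLocus (U := ⊤)
      (Ideal.span (Set.range fun i => char (𝟙 (toricSpec K N)) (m i)) : Set _) ↔
      ∀ i, ¬ NonzeroAt y (m i) := by
  rw [Scheme.zeroLocus_span, Scheme.mem_zeroLocus_iff]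
  simp only [Set.forall_mem_range]
  refine forall_congr' fun i => not_congr ?_
  exact (nonzeroAt_iff_mem_basicOpen (𝟙 (toricSpec K N)) y (m i)).symm

lemma isRadical_span {c : Sel G} {D : G} {γ : Set E} (h : IsAdapted c D γ) :
    (Ideal.span (Set.range fun a => char (𝟙 (toricSpec K (chartMonoid c))) (h.gen a))).IsRadical := by
  have h1 : (Ideal.span (Set.range fun a => (AddMonoidAlgebra.single (h.gen a) 1 :
      AddMonoidAlgebra K (chartMonoid c)))).IsRadical := by
    rw [← h.ker_face]
    have hdom : IsDomain (AddMonoidAlgebra K (chartMonoid c)) := isDomain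
    exact (RingHom.ker_isPrime _).isRadical
  have h2 := h1.comap (ΓEquiv K (chartMonoid c) : Γ((toricSpec K (chartMonoid c)).left, ⊤) →+* _)
  have h3 : Ideal.comap (ΓEquiv K (chartMonoid c) : Γ((toricSpec K (chartMonoid c)).left, ⊤) →+* _)
      (Ideal.span (Set.range fun a => (AddMonoidAlgebra.single (h.gen a) 1 :
      AddMonoidAlgebra K (chartMonoid c)))) =
      Ideal.span (Set.range fun a => char (𝟙 (toricSpec K (chartMonoid c))) (h.gen a)) := by
    rw [Ideal.comap_coe, ← Ideal.map_symm, Ideal.map_span, ← Set.range_comp]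
    rfl
  rwa [h3] at h2

variable [Finite E] (hS : IsStep G 𝒮)
include hS

/-- In a chart of a nested choice, at most one of the centres is visible, and it is a coordinate
subspace. -/
lemma comap_vanishingIdeal_totalCenter {c : Sel G} (hc : IsNested c) :
    ((∀ γ ∈ 𝒮, ∃ S : G, γ ⊆ S ∧ (c S : E) ∈ γ) ∧
      (vanishingIdeal (A.totalCenter 𝒮)).comap (A.chart c).left = ofIdealTop (Ideal.span {1})) ∨
    ∃ γ ∈ 𝒮, ∃ D, ∃ h : IsAdapted c D γ, (∀ δ ∈ 𝒮, δ ≠ γ → ∃ S : G, δ ⊆ S ∧ (c S : E) ∈ δ) ∧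
      (vanishingIdeal (A.totalCenter 𝒮)).comap (A.chart c).left = ofIdealTop (Ideal.span
        (Set.range fun a => char (𝟙 (toricSpec K (chartMonoid c))) (h.gen a))) := by
  by_cases h : ∀ γ ∈ 𝒮, ∃ S : G, γ ⊆ S ∧ (c S : E) ∈ γ
  · refine Or.inl ⟨h, comap_vanishingIdeal _ _ _ ?_ fun v => ?_⟩
    · rw [Ideal.span_singleton_one]
      exact fun _ _ => trivial
    · rw [mem_totalCenter, Scheme.zeroLocus_span, Scheme.zeroLocus_singleton]
      refine iff_of_false (fun h1 => h1 ?_) ?_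
      · simp
      · rintro ⟨γ, hγ, h1⟩
        obtain ⟨S, hγS, hcS⟩ := h γ hγ
        exact A.chart_notMem_center hγS hcS v h1
  · push Not at h
    obtain ⟨γ, hγ, h⟩ := h
    have key (δ) (hδ : δ ∈ 𝒮) := hc.exists_or_forall_notMem (hS.union_mem δ hδ)
    have hγ' : ∀ S : G, (c S : E) ∉ γ :=
      (key γ hγ).resolve_left fun ⟨S, h1, h2⟩ => h S h1 h2
    have hother : ∀ δ ∈ 𝒮, δ ≠ γ → ∃ S : G, δ ⊆ S ∧ (c S : E) ∈ δ := by
      intro δ hδ hne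
      refine ⟨⟨γ ∪ δ, hS.union_mem' γ hγ δ hδ hne.symm⟩, Set.subset_union_right, ?_⟩
      exact (c ⟨γ ∪ δ, hS.union_mem' γ hγ δ hδ hne.symm⟩).2.resolve_left (hγ' _)
    obtain ⟨D, hD⟩ := hc.isAdapted hS.isUnionClosed
    have had := hD γ (hS.union_mem γ hγ) hγ'
    refine Or.inr ⟨γ, hγ, D, had, hother, comap_vanishingIdeal _ _ _ (isRadical_span had) fun v => ?_⟩
    rw [mem_zeroLocus_span_iff, mem_totalCenter]
    refine Iff.trans (A.chart_mem_center had v).symm ⟨fun h1 => ⟨γ, hγ, h1⟩, ?_⟩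
    rintro ⟨δ, hδ, h1⟩
    by_cases hne : δ = γ
    · exact hne ▸ h1
    · obtain ⟨S, hδS, hcS⟩ := hother δ hδ hne
      exact absurd h1 (A.chart_notMem_center hδS hcS v)

variable {A} {f : X' ⟶ X}

lemma IsRefinement.isInvertible_comap (hf : IsRefinement A A' f) :
    ((vanishingIdeal (A.totalCenter 𝒮)).comap f.left).IsInvertible := by
  refine isInvertible_of_affine fun z => ?_
  obtain ⟨c, hc, hz⟩ := A'.exists_isNested z
  refine ⟨(toricSpec K (chartMonoid c)).left, inferInstance, (A'.chart c).left, inferInstance, hz, ?_⟩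
  have h1 : (A'.chart c).left ≫ f.left =
      (toricSpec.map K (resIncl c)).left ≫ (A.chart c.res).left := congrArg (·.left) (hf c)
  rw [← comap_comp, h1, comap_comp]
  rcases A.comap_vanishingIdeal_totalCenter hS hc.res with ⟨-, h2⟩ | ⟨γ, hγ, D, had, -, h2⟩
  · refine ⟨1, one_mem _, ?_⟩
    rw [h2, comap_ofIdealTop, Ideal.map_span, Set.image_singleton, map_one]
  · let σ : (G ∪ 𝒮 : Set (Set E)) := ⟨γ, Or.inr hγ⟩
    let b : γ := c σ
    let n : chartMonoid c := resIncl c (had.gen b)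
    refine ⟨char (𝟙 _) n, char_mem_nonZeroDivisors _, ?_⟩
    rw [h2, comap_ofIdealTop, Ideal.map_span, ← Set.range_comp]
    congr 1
    have h3 (a : γ) : (toricSpec.map K (resIncl c)).left.appTop.hom
        (char (𝟙 (toricSpec K (chartMonoid c.res))) (had.gen a)) =
        char (𝟙 (toricSpec K (chartMonoid c))) (chartGen c σ a) * char (𝟙 _) n := by
      rw [← char_comp, Category.comp_id, ← char_add, ← Category.id_comp (toricSpec.map _ _), char_map]
      congr 1
      exact Subtype.ext (ratio_add_ratio _ _ _).symm
    apply le_antisymm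
    · rw [Ideal.span_le]
      rintro _ ⟨a, rfl⟩
      refine Ideal.mem_span_singleton'.2 ⟨_, (h3 a).symm⟩
    · rw [Ideal.span_singleton_le_iff_mem]
      refine Ideal.subset_span ⟨b, (h3 b).trans ?_⟩
      rw [show b = c σ from rfl, chartGen_self, char_zero, one_mul]

end Atlas

end

noncomputable section

open charLattice toricSpec Scheme.IdealSheafData

variable {K E : Type u} [Field K] {G 𝒮 : Set (Set E)}

namespace Atlas

variable {X X' : Over (Spec (CommRingCat.of K))} {A : Atlas G X} {A' : Atlas (G ∪ 𝒮) X'}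

lemma generates_of_forall {U : Over (Spec (CommRingCat.of K))} {c : Sel (G ∪ 𝒮)}
    {h : U ⟶ toricSpec K (chartMonoid c.res)}
    (H : ∀ σ (hσ : σ ∈ 𝒮), σ ∉ G →
      (∃ S : G, σ ⊆ S ∧ (c.res S : E) = c ⟨σ, Or.inr hσ⟩) ∨
      ∃ (S : G) (hS : σ ⊆ S),
      char h (chartGen c.res S ⟨c ⟨σ, Or.inr hσ⟩, hS (c ⟨σ, Or.inr hσ⟩).2⟩) ∈
        nonZeroDivisors Γ(U.left, ⊤) ∧
      ∀ a (ha : a ∈ σ), char h (chartGen c.res S ⟨c ⟨σ, Or.inr hσ⟩, hS (c ⟨σ, Or.inr hσ⟩).2⟩) ∣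
        char h (chartGen c.res S ⟨a, hS ha⟩)) : Generates c h where
  out σ hσ := by
    have key (S : G) (hS : σ ⊆ S) (he : (c.res S : E) = c ⟨σ, Or.inr hσ⟩) :
        char h (chartGen c.res S ⟨c ⟨σ, Or.inr hσ⟩, hS (c ⟨σ, Or.inr hσ⟩).2⟩) = 1 := by
      have : (⟨c ⟨σ, Or.inr hσ⟩, hS (c ⟨σ, Or.inr hσ⟩).2⟩ : (S : Set E)) = c.res S :=
        Subtype.ext he.symm
      rw [this, chartGen_self, char_zero]
    have key' (S : G) (hS : σ ⊆ S) (he : (c.res S : E) = c ⟨σ, Or.inr hσ⟩) := by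
      refine (⟨S, hS, ?_, ?_⟩ : ∃ (S : G) (hS : σ ⊆ S),
        char h (chartGen c.res S ⟨c ⟨σ, Or.inr hσ⟩, hS (c ⟨σ, Or.inr hσ⟩).2⟩) ∈
          nonZeroDivisors Γ(U.left, ⊤) ∧
        ∀ a (ha : a ∈ σ), char h (chartGen c.res S ⟨c ⟨σ, Or.inr hσ⟩, hS (c ⟨σ, Or.inr hσ⟩).2⟩) ∣
          char h (chartGen c.res S ⟨a, hS ha⟩))
      · rw [key S hS he]
        exact one_mem _
      · rw [key S hS he]
        exact fun a _ => one_dvd _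
    by_cases hσG : σ ∈ G
    · exact key' ⟨σ, hσG⟩ subset_rfl rfl
    · rcases H σ hσ hσG with ⟨S, hS, he⟩ | h
      · exact key' S hS he
      · exact h

lemma mem_basicOpen_of_span_eq_top {V : Scheme.{u}} {ι : Type*} (s : ι → Γ(V, ⊤))
    (h : Ideal.span (Set.range s) = ⊤) (v : V) : ∃ i, v ∈ V.basicOpen (s i) := by
  by_contra! h1
  have h2 : Ideal.span (Set.range s) ≤ (IsLocalRing.maximalIdeal (V.presheaf.stalk v)).comap
      (V.presheaf.germ ⊤ v trivial).hom := by
    rw [Ideal.span_le]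
    rintro _ ⟨i, rfl⟩
    have := h1 i
    rw [Scheme.mem_basicOpen_top] at this
    exact this
  rw [h, top_le_iff] at h2
  exact Ideal.comap_ne_top _ Ideal.IsPrime.ne_top' h2

/-- If functions `y a` generate the ideal of a non-zero-divisor `t`, then at every
point one of the quotients by `t` does not vanish. -/
lemma exists_quotient_ne_zero {V : Scheme.{u}} [IsAffine V] {ι : Type*} (y : ι → Γ(V, ⊤))
    {t : Γ(V, ⊤)} (ht : t ∈ nonZeroDivisors Γ(V, ⊤))
    (h : ofIdealTop (Ideal.span (Set.range y)) = ofIdealTop (Ideal.span {t})) (v : V) :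
    ∃ s : ι → Γ(V, ⊤), (∀ a, s a * t = y a) ∧ ∃ b, v ∈ V.basicOpen (s b) := by
  have hspan : Ideal.span (Set.range y) = Ideal.span {t} := by
    have h3 := congrArg (fun I => I.ideal ⟨⊤, isAffineOpen_top V⟩) h
    simp only [ofIdealTop_ideal] at h3
    have h4 : V.presheaf.map (homOfLE (le_top : (⊤ : V.Opens) ≤ ⊤)).op = 𝟙 _ :=
      V.presheaf.map_id _
    erw [h4] at h3
    change Ideal.map (RingHom.id _) _ = Ideal.map (RingHom.id _) _ at h3
    rwa [Ideal.map_id, Ideal.map_id] at h3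
  have hs (a) : ∃ s, s * t = y a :=
    Ideal.mem_span_singleton'.1 (hspan ▸ Ideal.subset_span ⟨a, rfl⟩)
  choose s hs using hs
  refine ⟨s, hs, mem_basicOpen_of_span_eq_top s ?_ v⟩
  have h3 : t ∈ Ideal.span (Set.range s) * Ideal.span {t} := by
    have h4 : t ∈ Ideal.span (Set.range y) := hspan ▸ Ideal.mem_span_singleton_self t
    refine (Ideal.span_le.2 ?_ : Ideal.span (Set.range y) ≤ _) h4
    rintro _ ⟨a, rfl⟩
    rw [← hs a]
    exact Ideal.mul_mem_mul (Ideal.subset_span ⟨a, rfl⟩) (Ideal.mem_span_singleton_self t)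
  obtain ⟨r, hr, hrt⟩ := Ideal.mem_mul_span_singleton.1 h3
  have hr1 : r = 1 := by
    rw [← mul_cancel_right_mem_nonZeroDivisors ht, one_mul]
    exact hrt
  rw [Ideal.eq_top_iff_one, ← hr1]
  exact hr

lemma isUnit_appTop_ι_basicOpen {V : Scheme.{u}} (s : Γ(V, ⊤)) :
    IsUnit ((V.basicOpen s).ι.appTop.hom s) := by
  refine RingedSpace.isUnit_of_isUnit_germ _ _ _ fun x hx => ?_
  refine (Scheme.mem_basicOpen_top _ _ x).1 ?_
  exact (Scheme.preimage_basicOpen_top (V.basicOpen s).ι s).le x.2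

variable [Finite E] (hS : IsStep G 𝒮)
include hS

/-- A morphism along which the inverse image of the centre becomes invertible is locally given by
coordinates one of which divides the others. -/
lemma exists_generates {W : Over (Spec (CommRingCat.of K))} (g : W ⟶ X)
    (hI : ((vanishingIdeal (A.totalCenter 𝒮)).comap g.left).IsInvertible) (w : W.left) :
    ∃ (U : Over (Spec (CommRingCat.of K))) (_ : IsAffine U.left) (j : U ⟶ W),
      IsOpenImmersion j.left ∧ w ∈ Set.range j.left ∧
      ∃ (c : Sel (G ∪ 𝒮)) (h : U ⟶ toricSpec K (chartMonoid c.res)),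
        h ≫ A.chart c.res = j ≫ g ∧ Generates c h := by
  obtain ⟨c, hc, hgw⟩ := A.exists_isNested (g.left w)
  obtain ⟨U, hU, hwU, hUO, t, ht, hIt⟩ :=
    hI.exists_affine w (g.left ⁻¹ᵁ (A.chart c).left.opensRange) hgw
  have hUaff : IsAffine U := hU
  let UO : Over (Spec (CommRingCat.of K)) := Over.mk (U.ι ≫ W.hom)
  let i : UO ⟶ W := Over.homMk U.ι rfl
  have hUOaff : IsAffine UO.left := hU
  obtain ⟨h, hh⟩ := exists_over_lift (A.chart c) (i ≫ g) (by
    rintro _ ⟨u, rfl⟩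
    exact hUO u.2)
  have hIh : ((vanishingIdeal (A.totalCenter 𝒮)).comap (A.chart c).left).comap h.left =
      ofIdealTop (Ideal.span {t}) := by
    have e : h.left ≫ (A.chart c).left = i.left ≫ g.left := congrArg (·.left) hh
    exact (comap_comp _ _ _).symm.trans ((congrArg _ e).trans ((comap_comp _ _ _).trans hIt))
  rcases A.comap_vanishingIdeal_totalCenter hS hc with ⟨h1, -⟩ | ⟨γ, hγ, D, had, h1, h2⟩
  · obtain ⟨c', rfl, hc'⟩ := Sel.exists_extension (𝒮 := 𝒮) c
      (fun σ a => ∃ S : G, σ ⊆ S ∧ (c S : E) = a) (fun σ hσ _ => by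
        obtain ⟨S, hS, hcS⟩ := h1 σ hσ
        exact ⟨_, hcS, S, hS, rfl⟩)
    exact ⟨UO, hUOaff, i, inferInstanceAs (IsOpenImmersion U.ι), ⟨⟨w, hwU⟩, rfl⟩, c', h, hh,
      generates_of_forall fun σ hσ hσG => Or.inl (hc' σ hσ hσG)⟩
  · let y (a : γ) : Γ(UO.left, ⊤) := char h (had.gen a)
    have hy' : ofIdealTop (Ideal.span (Set.range y)) = ofIdealTop (Ideal.span {t}) := by
      rw [← hIh, h2, comap_ofIdealTop, Ideal.map_span, ← Set.range_comp]
      rfl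
    obtain ⟨s, hs, b, hb⟩ := exists_quotient_ne_zero y ht hy' (⟨w, hwU⟩ : U)
    let U' : UO.left.Opens := UO.left.basicOpen (s b)
    have hU' : IsAffine U' := (isAffineOpen_top UO.left).basicOpen (s b)
    let UO' : Over (Spec (CommRingCat.of K)) := Over.mk (U'.ι ≫ UO.hom)
    let i' : UO' ⟶ UO := Over.homMk U'.ι rfl
    have hi' : IsOpenImmersion i'.left := inferInstanceAs (IsOpenImmersion U'.ι)
    have hUO'aff : IsAffine UO'.left := hU'
    have hunit : IsUnit (i'.left.appTop.hom (s b)) := isUnit_appTop_ι_basicOpen (s b)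
    obtain ⟨c', rfl, hc'⟩ := Sel.exists_extension (𝒮 := 𝒮) c
      (fun σ a => (σ = γ → a = b) ∧ (σ ≠ γ → ∃ S : G, σ ⊆ S ∧ (c S : E) = a)) (fun σ hσ _ => by
        by_cases hσγ : σ = γ
        · exact ⟨b, hσγ ▸ b.2, fun _ => rfl, fun h => absurd hσγ h⟩
        · obtain ⟨S, hS, hcS⟩ := h1 σ hσ hσγ
          exact ⟨_, hcS, fun h => absurd h hσγ, fun _ => ⟨S, hS, rfl⟩⟩)
    refine ⟨UO', hUO'aff, i' ≫ i, ?_, ⟨⟨⟨w, hwU⟩, hb⟩, rfl⟩, c', i' ≫ h, ?_,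
      generates_of_forall fun σ hσ hσG => ?_⟩
    · have : IsOpenImmersion i.left := inferInstanceAs (IsOpenImmersion U.ι)
      rw [Over.comp_left]
      infer_instance
    · rw [Category.assoc, hh, Category.assoc]
    · by_cases hσγ : σ = γ
      · subst hσγ
        right
        refine ⟨D, had.subset, ?_⟩
        have hbb : (⟨c' ⟨σ, Or.inr hσ⟩, had.subset (c' ⟨σ, Or.inr hσ⟩).2⟩ : (D : Set E)) =
          ⟨b, had.subset b.2⟩ := Subtype.ext ((hc' σ hσ hσG).1 rfl)
        rw [hbb]
        have hy (a : σ) : char (i' ≫ h) (chartGen c'.res D ⟨a, had.subset a.2⟩) =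
            i'.left.appTop.hom (s a) * i'.left.appTop.hom t := by
          rw [char_comp, ← map_mul, hs]
          rfl
        refine ⟨?_, fun a ha => ?_⟩
        · rw [hy b]
          exact mul_mem hunit.mem_nonZeroDivisors (appTop_mem_nonZeroDivisors i'.left ht)
        · rw [hy b, hy ⟨a, ha⟩, hunit.mul_left_dvd]
          exact dvd_mul_left _ _
      · exact Or.inl ((hc' σ hσ hσG).2 hσγ)

variable {f : X' ⟶ X}

/-- Uniqueness in the universal property of the blow-up. -/
lemma IsRefinement.lift_unique (hf : IsRefinement A A' f) {W : Over (Spec (CommRingCat.of K))}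
    {g : W ⟶ X} (hI : ((vanishingIdeal (A.totalCenter 𝒮)).comap g.left).IsInvertible)
    {l l' : W ⟶ X'} (hl : l ≫ f = g) (hl' : l' ≫ f = g) : l = l' := by
  choose U hU j hj hw c h hh H using exists_generates hS g hI
  refine hom_ext_of_cover U j hj (fun w => ⟨w, hw w⟩) fun w => ?_
  refine (H w).eq_of_comp_eq hf ?_ ?_
  · rw [Category.assoc, hl, hh]
  · rw [Category.assoc, hl', hh]

/-- Existence in the universal property of the blow-up: the lifts of the members of a cover glue, by
uniqueness on the intersections. -/
lemma IsRefinement.exists_lift (hf : IsRefinement A A' f) {W : Over (Spec (CommRingCat.of K))}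
    (g : W ⟶ X) (hI : ((vanishingIdeal (A.totalCenter 𝒮)).comap g.left).IsInvertible) :
    ∃ l : W ⟶ X', l ≫ f = g := by
  choose U hU j hj hw c h hh H using exists_generates hS g hI
  choose k hk using fun w => (H w).exists_lift
  have hl (w : W.left) : (k w ≫ A'.chart (c w)) ≫ f = j w ≫ g := by
    rw [Category.assoc, hf, reassoc_of% hk w, hh]
  let 𝒰 : W.left.OpenCover := Scheme.Cover.mkOfCovers (P := @IsOpenImmersion) W.left
    (fun i => (U i).left) (fun i => (j i).left) (fun z => ⟨z, hw z⟩) hj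
  have hglue : ∀ x y : W.left, pullback.fst (j x).left (j y).left ≫ (k x ≫ A'.chart (c x)).left =
      pullback.snd (j x).left (j y).left ≫ (k y ≫ A'.chart (c y)).left := by
    intro x y
    have := hj x
    have := hj y
    let V : Over (Spec (CommRingCat.of K)) :=
      Over.mk (pullback.fst (j x).left (j y).left ≫ (U x).hom)
    let p : V ⟶ U x := Over.homMk (pullback.fst (j x).left (j y).left) rfl
    let q : V ⟶ U y := Over.homMk (pullback.snd (j x).left (j y).left) (by
      change _ = pullback.fst (j x).left (j y).left ≫ (U x).hom
      rw [← Over.w (j x), ← Over.w (j y), pullback.condition_assoc])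
    have hpq : p ≫ j x = q ≫ j y := Over.OverMorphism.ext pullback.condition
    have hpj : IsOpenImmersion (p ≫ j x).left :=
      inferInstanceAs (IsOpenImmersion (pullback.fst (j x).left (j y).left ≫ (j x).left))
    have hIV : ((vanishingIdeal (A.totalCenter 𝒮)).comap (p ≫ j x ≫ g).left).IsInvertible := by
      have := hI.comap_of_isOpenImmersion (p ≫ j x).left
      rw [← comap_comp] at this
      exact this
    refine congrArg (·.left) (hf.lift_unique hS hIV (l := p ≫ k x ≫ A'.chart (c x))
      (l' := q ≫ k y ≫ A'.chart (c y)) ?_ ?_)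
    · rw [Category.assoc, hl]
    · rw [Category.assoc, hl, ← reassoc_of% hpq]
  have h1 (i) : (j i).left ≫ Scheme.Cover.glueMorphisms 𝒰
      (fun i => (k i ≫ A'.chart (c i)).left) hglue = (k i ≫ A'.chart (c i)).left :=
    Scheme.Cover.ι_glueMorphisms 𝒰 (fun i => (k i ≫ A'.chart (c i)).left) hglue i
  have h2 : Scheme.Cover.glueMorphisms 𝒰 (fun i => (k i ≫ A'.chart (c i)).left) hglue ≫ f.left =
      g.left := by
    refine Scheme.Cover.hom_ext 𝒰 _ _ fun i => ?_
    refine (Category.assoc _ _ _).symm.trans ((congrArg (· ≫ f.left) (h1 i)).trans ?_)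
    exact congrArg (·.left) (hl i)
  refine ⟨Over.homMk (Scheme.Cover.glueMorphisms 𝒰 _ hglue) ?_, Over.OverMorphism.ext h2⟩
  rw [← Over.w f, ← Category.assoc, h2, Over.w]

/-- The toric scheme of the refined family is a blow-up. -/
theorem IsRefinement.isBlowup (hf : IsRefinement A A' f) :
    Scheme.IsBlowup f.left (vanishingIdeal (A.totalCenter 𝒮)) where
  isInvertible := hf.isInvertible_comap hS
  existsUnique_lift W g hg := by
    let WO : Over (Spec (CommRingCat.of K)) := Over.mk (g ≫ X.hom)
    let gO : WO ⟶ X := Over.homMk g rfl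
    obtain ⟨l, hl⟩ := hf.exists_lift hS gO hg
    refine ⟨l.left, congrArg (·.left) hl, fun l' hl' => ?_⟩
    let lO : WO ⟶ X' := Over.homMk l' (by
      change l' ≫ X'.hom = g ≫ X.hom
      rw [← hl', Category.assoc, Over.w])
    exact congrArg (·.left) (hf.lift_unique hS (g := gO) hg (l := lO) (l' := l)
      (Over.OverMorphism.ext hl') hl)

end Atlas

end

attribute [local instance] MvPolynomial.gradedAlgebra
noncomputable section

open charLattice toricSpec Scheme.IdealSheafData

variable {K E : Type u} [Field K] {G 𝒮 : Set (Set E)}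

/-! ### Strict transforms and coordinate linear spaces -/

namespace Atlas

variable {X X' : Over (Spec (CommRingCat.of K))} {A : Atlas G X} {A' : Atlas (G ∪ 𝒮) X'}

/-- The generic point of a centre, in a chart. -/
lemma exists_generic_center (A : Atlas G X) {c : Sel G} {D : G} {γ : Set E} (h : IsAdapted c D γ) :
    ∃ x : X.left, x ∈ A.center γ ∧ (∀ (S : G), ∀ a ∈ (S : Set E), a ∉ γ → a ∈ A.nz S x) ∧
      ∀ y, (A.chart c).left y ∈ A.center γ → x ⤳ (A.chart c).left y := by
  obtain ⟨η, h1, h2⟩ := h.exists_generic K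
  refine ⟨(A.chart c).left η, ?_, fun S a ha haγ => ?_, fun y hy => ?_⟩
  · rw [A.chart_mem_center h]
    intro a ha
    exact h.gen_notMem a ((h1 _).1 ha)
  · rw [A.mem_nz_chart_iff c η S ⟨a, ha⟩, h1]
    intro e he
    exact IsAdapted.ratio_apply_of_ne (fun hea => haγ (by rw [hea] at he; exact he))
      (fun hea => h.notMem S (by rw [hea] at he; exact he))
  · exact (h2 y ((A.chart_mem_center h y).1 hy)).map (A.chart c).left.continuous

/-- Blowing up the centres of `𝒮` turns the centre of `δ` into its centre with respect to the refined
family, as the generic point of the latter lies over the complement of the blown up centres. -/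
lemma IsRefinement.strictTransform_center [Finite E] (hS : IsStep G 𝒮) {f : X' ⟶ X}
    (hf : IsRefinement A A' f) {δ : Set E} (hδ : ∀ S ∈ G ∪ 𝒮, δ ∪ S ∈ G ∪ 𝒮)
    (hγδ : ∀ γ ∈ 𝒮, ¬ γ ⊆ δ) :
    Scheme.strictTransform f.left (A.totalCenter 𝒮) (A.center δ) = A'.center δ := by
  apply le_antisymm
  · refine Closeds.closure_le.2 ?_
    rintro z ⟨hz1, hz2⟩ ⟨T, hT⟩ hδT a ha haT
    by_cases hTG : T ∈ G
    · rw [hf.nz_eq ⟨T, hTG⟩] at haT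
      exact hz1 ⟨T, hTG⟩ hδT a ha haT
    · have hz2' : f.left z ∉ A.center T := fun h =>
        hz2 (A.mem_totalCenter.2 ⟨T, hT.resolve_left hTG, h⟩)
      rw [mem_center] at hz2'
      push Not at hz2'
      obtain ⟨S, hTS, b, hbT, hbS⟩ := hz2'
      have h1 := A'.nz_eq_inter (S := ⟨T, hT⟩) (S' := ⟨S, Or.inl S.2⟩) hTS z
        ⟨b, by rw [hf.nz_eq S]; exact hbS, hbT⟩
      rw [h1] at haT
      exact hz1 S (hδT.trans hTS) a ha (by rw [← hf.nz_eq]; exact haT.1)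
  · intro z hz
    obtain ⟨c, hc, y, rfl⟩ := A'.exists_isNested z
    have hc' : ∀ S : (G ∪ 𝒮 : Set (Set E)), (c S : E) ∉ δ := by
      refine (hc.exists_or_forall_notMem hδ).resolve_left ?_
      rintro ⟨S, hδS, hcS⟩
      exact A'.chart_notMem_center hδS hcS y hz
    obtain ⟨D, hD⟩ := hc.isAdapted hS.isUnionClosed_union
    obtain ⟨x, hx, hxnz, hxy⟩ := A'.exists_generic_center (hD δ hδ hc')
    refine (hxy y hz).mem_closed (Closeds.isClosed _) (subset_closure ⟨?_, ?_⟩)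
    · intro S hδS a ha haS
      rw [← hf.nz_eq] at haS
      exact hx ⟨S, Or.inl S.2⟩ hδS a ha haS
    · intro hx'
      obtain ⟨γ, hγ, h1⟩ := A.mem_totalCenter.1 hx'
      obtain ⟨a, haγ, haδ⟩ := Set.not_subset.1 (hγδ γ hγ)
      refine h1 hS.isUnionClosed.top (Set.subset_univ _) a haγ ?_
      rw [← hf.nz_eq]
      exact hxnz ⟨Set.univ, Or.inl hS.isUnionClosed.univ_mem⟩ a trivial haδ

end Atlas

section pspace

variable [Finite E] (e₀ : E)

lemma mem_nz_pspaceAtlas (S : ({Set.univ} : Set (Set E))) (x : PSpace K E) (a : E) :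
    a ∈ (pspaceAtlas K e₀).nz S x ↔ (MvPolynomial.X a : MvPolynomial E K) ∉ x.asHomogeneousIdeal := by
  have hr (c : Sel ({Set.univ} : Set (Set E))) : x ∈ Set.range ((pspaceAtlas K e₀).chart c).left ↔
      (MvPolynomial.X (c ⟨Set.univ, rfl⟩ : E) : MvPolynomial E K) ∉ x.asHomogeneousIdeal := by
    have := (pspaceData K e₀).opensRange_chart c
    exact (SetLike.ext_iff.1 this x)
  have hST : S = ⟨Set.univ, rfl⟩ := Subtype.ext S.2
  subst hST
  constructor
  · rintro ⟨c, rfl, hc⟩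
    exact (hr c).1 hc
  · intro h
    exact ⟨fun S => ⟨a, by rw [S.2]; trivial⟩, rfl, (hr _).2 h⟩

lemma pspaceAtlas_center (γ : Set E) : (pspaceAtlas K e₀).center γ = PSpace.linearSpace K γ := by
  ext x
  change (∀ S : ({Set.univ} : Set (Set E)), γ ⊆ S → ∀ a ∈ γ, a ∉ (pspaceAtlas K e₀).nz S x) ↔
    (fun a => (MvPolynomial.X a : MvPolynomial E K)) '' γ ⊆ x.asHomogeneousIdeal
  rw [Set.image_subset_iff]
  constructor
  · intro h a ha
    have := h ⟨Set.univ, rfl⟩ (Set.subset_univ _) a ha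
    rw [mem_nz_pspaceAtlas, not_not] at this
    exact this
  · intro h S _ a ha
    rw [mem_nz_pspaceAtlas, not_not]
    exact h ha

lemma linearSpace_le_iff {γ δ : Set E} (hγ : γ ≠ Set.univ) :
    PSpace.linearSpace K γ ≤ PSpace.linearSpace K δ ↔ δ ⊆ γ := by
  constructor
  · intro h
    obtain ⟨b, hb⟩ := (Set.ne_univ_iff_exists_notMem γ).1 hγ
    let c : Sel ({Set.univ} : Set (Set E)) := fun S => ⟨b, by rw [S.2]; trivial⟩
    have had : IsAdapted c ⟨Set.univ, rfl⟩ γ := ⟨fun S => hb, Set.subset_univ _, fun S => by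
      have : ratio (c ⟨Set.univ, rfl⟩ : E) (c S) = 0 := ratio_self b
      rw [this]; exact zero_mem _⟩
    obtain ⟨x, hx, hxnz, -⟩ := (pspaceAtlas K b).exists_generic_center had
    rw [pspaceAtlas_center] at hx
    have hx' := h hx
    rw [← pspaceAtlas_center b] at hx'
    intro a ha
    by_contra haγ
    exact hx' ⟨Set.univ, rfl⟩ (Set.subset_univ _) a ha (hxnz ⟨Set.univ, rfl⟩ a trivial haγ)
  · intro h x hx
    exact (Set.image_mono h).trans hx

end pspace

/-! ### Iterated blow-ups -/

namespace AlgebraicGeometry.Scheme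

lemma IsBlowup.exists_iso {X Y Y' : Scheme.{u}} {f : Y ⟶ X} {f' : Y' ⟶ X} {I : X.IdealSheafData}
    (h : IsBlowup f I) (h' : IsBlowup f' I) : ∃ e : Y ≅ Y', e.hom ≫ f' = f := by
  obtain ⟨l, hl, -⟩ := h'.existsUnique_lift _ f h.isInvertible
  obtain ⟨l', hl', -⟩ := h.existsUnique_lift _ f' h'.isInvertible
  refine ⟨⟨l, l', ?_, ?_⟩, hl⟩
  · exact (h.existsUnique_lift _ f h.isInvertible).unique (by rw [Category.assoc, hl', hl])
      (Category.id_comp f)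
  · exact (h'.existsUnique_lift _ f' h'.isInvertible).unique (by rw [Category.assoc, hl, hl'])
      (Category.id_comp f')

lemma IsIteratedBlowup.isIso {Y X : Scheme.{u}} {f : Y ⟶ X} (h : IsIteratedBlowup f []) :
    IsIso f := by
  cases h; assumption

lemma IsIteratedBlowup.exists_cons {Z X : Scheme.{u}} {f : Z ⟶ X} {S : Set (Closeds X)}
    {L : List (Set (Closeds X))} (h : IsIteratedBlowup f (S :: L)) :
    ∃ (Y : Scheme.{u}) (f₁ : Y ⟶ X) (g : Z ⟶ Y), g ≫ f₁ = f ∧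
      IsBlowup f₁ (vanishingIdeal (sSup S)) ∧
      IsIteratedBlowup g (L.map fun S' => strictTransform f₁ (sSup S) '' S') := by
  cases h with
  | cons f₁ g _ _ hf hg => exact ⟨_, f₁, g, rfl, hf, hg⟩

end AlgebraicGeometry.Scheme

/-- The sets whose centres form the `k`-th stratum. -/
def levelSets {α : Type*} [PartialOrder α] (𝒞 : Set (Set E)) (L : Set E → α) (k : ℕ) :
    Set (Set E) := {γ ∈ 𝒞 | L γ ∈ stratum (L '' 𝒞) k}

/-- The set of all elements and the sets whose centres are in the strata before the `k`-th. -/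
def levelFamily {α : Type*} [PartialOrder α] (𝒞 : Set (Set E)) (L : Set E → α) : ℕ → Set (Set E)
  | 0 => {Set.univ}
  | k + 1 => levelFamily 𝒞 L k ∪ levelSets 𝒞 L k

section level

variable {α : Type*} [PartialOrder α]

lemma withoutMinimal_subset (S : Set α) (k : ℕ) : withoutMinimal S k ⊆ S := by
  induction k with
  | zero => exact subset_rfl
  | succ k ih => exact Set.sdiff_subset.trans ih

lemma withoutMinimal_antitone (S : Set α) : Antitone (withoutMinimal S) :=
  antitone_nat_of_succ_le fun _ => Set.sdiff_subset

lemma mem_withoutMinimal_of_le {S : Set α} {k : ℕ} {a b : α} (ha : a ∈ withoutMinimal S k)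
    (hab : a ≤ b) (hb : b ∈ S) : b ∈ withoutMinimal S k := by
  induction k with
  | zero => exact hb
  | succ k ih =>
    refine ⟨ih ha.1, fun hmin => ha.2 ?_⟩
    have : a = b := le_antisymm hab (hmin.2 ha.1 hab)
    rw [this]
    exact hmin

variable {𝒞 : Set (Set E)} {L : Set E → α}

lemma mem_levelFamily_iff {k : ℕ} {γ : Set E} : γ ∈ levelFamily 𝒞 L k ↔
    γ = Set.univ ∨ γ ∈ 𝒞 ∧ L γ ∉ withoutMinimal (L '' 𝒞) k := by
  induction k with
  | zero =>
    refine ⟨fun h => Or.inl h, fun h => h.resolve_right ?_⟩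
    rintro ⟨h1, h2⟩
    exact h2 ⟨γ, h1, rfl⟩
  | succ k ih =>
    change γ ∈ levelFamily 𝒞 L k ∨ γ ∈ 𝒞 ∧ Minimal _ _ ↔ _ ∨ _ ∧ ¬ (_ ∧ ¬ _)
    rw [ih]
    have h : Minimal (· ∈ withoutMinimal (L '' 𝒞) k) (L γ) → L γ ∈ withoutMinimal (L '' 𝒞) k :=
      fun h => h.1
    tauto

/-- The collection `𝒞` of non-empty proper sets is closed under union, up to the set of all elements,
and `L` is an antitone embedding. -/
structure IsUnionFamily (𝒞 : Set (Set E)) (L : Set E → α) : Prop where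
  nonempty : ∀ γ ∈ 𝒞, γ.Nonempty
  ne_univ : ∀ γ ∈ 𝒞, γ ≠ Set.univ
  union : ∀ γ ∈ 𝒞, ∀ δ ∈ 𝒞, γ ∪ δ = Set.univ ∨ γ ∪ δ ∈ 𝒞
  le_iff : ∀ γ ∈ 𝒞, ∀ δ ∈ 𝒞, L γ ≤ L δ ↔ δ ⊆ γ

namespace IsUnionFamily

variable (h : IsUnionFamily 𝒞 L)
include h

lemma union_mem {k : ℕ} {γ S : Set E} (hγ : γ ∈ 𝒞) (hS : S ∈ levelFamily 𝒞 L k) :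
    γ ∪ S ∈ levelFamily 𝒞 L k := by
  rw [mem_levelFamily_iff] at hS ⊢
  rcases hS with rfl | ⟨hS, hLS⟩
  · exact Or.inl (Set.union_univ γ)
  · rcases h.union γ hγ S hS with h1 | h1
    · exact Or.inl h1
    · refine Or.inr ⟨h1, fun h2 => hLS ?_⟩
      exact mem_withoutMinimal_of_le h2 ((h.le_iff _ h1 _ hS).2 Set.subset_union_right) ⟨S, hS, rfl⟩

/-- Every step of the iterated blow-up refines a union-closed family: the union of two different members
of the same stratum belongs to an earlier one. -/
lemma isStep [Nonempty E] (k : ℕ) : IsStep (levelFamily 𝒞 L k) (levelSets 𝒞 L k) where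
  isUnionClosed :=
    { univ_mem := mem_levelFamily_iff.2 (Or.inl rfl)
      empty_notMem := fun h1 => by
        rcases mem_levelFamily_iff.1 h1 with h2 | h2
        · exact Set.empty_ne_univ h2
        · exact Set.not_nonempty_empty (h.nonempty _ h2.1)
      union_mem := fun S hS T hT => by
        rcases mem_levelFamily_iff.1 hS with h2 | h2
        · rw [h2, Set.univ_union]
          exact mem_levelFamily_iff.2 (Or.inl rfl)
        · exact h.union_mem h2.1 hT }
  nonempty γ hγ := h.nonempty γ hγ.1
  union_mem γ hγ S hS := h.union_mem hγ.1 hS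
  union_mem' γ hγ δ hδ hne := by
    rw [mem_levelFamily_iff]
    rcases h.union γ hγ.1 δ hδ.1 with h1 | h1
    · exact Or.inl h1
    refine Or.inr ⟨h1, fun h2 => hne ?_⟩
    have h3 : γ ∪ δ ⊆ γ := (h.le_iff γ hγ.1 _ h1).1
      (hγ.2.2 h2 ((h.le_iff _ h1 γ hγ.1).2 Set.subset_union_left))
    have h4 : γ ∪ δ ⊆ δ := (h.le_iff δ hδ.1 _ h1).1
      (hδ.2.2 h2 ((h.le_iff _ h1 δ hδ.1).2 Set.subset_union_right))
    exact (Set.subset_union_left.trans h4).antisymm (Set.subset_union_right.trans h3)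

lemma not_subset {k i : ℕ} (hi : k < i) {γ δ : Set E} (hγ : γ ∈ levelSets 𝒞 L k)
    (hδ : δ ∈ levelSets 𝒞 L i) : ¬ γ ⊆ δ := by
  intro h1
  have h2 : L δ ∈ withoutMinimal (L '' 𝒞) (k + 1) := withoutMinimal_antitone _ hi hδ.2.1
  have h3 : L δ ≤ L γ := (h.le_iff δ hδ.1 γ hγ.1).2 h1
  have h4 : L δ = L γ := le_antisymm h3 (hγ.2.2 h2.1 h3)
  refine h2.2 ?_
  rw [h4]
  exact hγ.2

/-- All linear spaces belong to the first `Nat.card E` strata, as a chain of non-empty proper subsets has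
less than `Nat.card E` members. -/
lemma withoutMinimal_eq_empty [Finite E] : withoutMinimal (L '' 𝒞) (Nat.card E) = ∅ := by
  have key (k : ℕ) (γ) (hγ : γ ∈ 𝒞) (hk : L γ ∈ withoutMinimal (L '' 𝒞) k) :
      γ.ncard + k < Nat.card E := by
    induction k generalizing γ with
    | zero => exact Set.ncard_lt_card (h.ne_univ γ hγ)
    | succ k ih =>
      have h1 := hk.2
      rw [Set.mem_ofPred_eq, not_minimal_iff_exists_lt hk.1] at h1
      obtain ⟨b, hb, hbk⟩ := h1
      obtain ⟨δ, hδ, rfl⟩ := withoutMinimal_subset _ _ hbk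
      have h2 := ih δ hδ hbk
      have h3 : γ ⊂ δ := ⟨(h.le_iff δ hδ γ hγ).1 hb.le,
        fun h4 => hb.not_ge ((h.le_iff γ hγ δ hδ).2 h4)⟩
      have := Set.ncard_lt_ncard h3
      omega
  rw [Set.eq_empty_iff_forall_notMem]
  intro a ha
  obtain ⟨γ, hγ, rfl⟩ := withoutMinimal_subset _ _ ha
  have := key _ γ hγ ha
  omega

lemma levelFamily_card [Finite E] : levelFamily 𝒞 L (Nat.card E) = insert Set.univ 𝒞 := by
  ext γ
  rw [mem_levelFamily_iff, h.withoutMinimal_eq_empty]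
  simp

end IsUnionFamily

end level

end

noncomputable section

open charLattice toricSpec Scheme.IdealSheafData

variable {K E : Type u} [Field K] {α : Type*} [PartialOrder α] {𝒞 : Set (Set E)} {L : Set E → α}

namespace Atlas

/-- The strict transforms of the remaining strata are the centres in the refined family. -/
lemma IsRefinement.map_strictTransform [Finite E] [Nonempty E] (h : IsUnionFamily 𝒞 L) {k : ℕ}
    {X X' : Over (Spec (CommRingCat.of K))} {A : Atlas (levelFamily 𝒞 L k) X}
    {A' : Atlas (levelFamily 𝒞 L k ∪ levelSets 𝒞 L k) X'} {f : X' ⟶ X}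
    (hf : IsRefinement A A' f) (n : ℕ) :
    ((List.range' (k + 1) n).map fun i => A.center '' levelSets 𝒞 L i).map
      (fun S' => Scheme.strictTransform f.left (A.totalCenter (levelSets 𝒞 L k)) '' S') =
    (List.range' (k + 1) n).map fun i => A'.center '' levelSets 𝒞 L i := by
  rw [List.map_map]
  refine List.map_congr_left fun i hi => ?_
  have hki : k < i := (List.mem_range'_1.1 hi).1
  refine (Set.image_image _ _ _).trans (Set.image_congr fun δ hδ => ?_)
  exact hf.strictTransform_center (h.isStep k)
    (fun S hS => h.union_mem (k := k + 1) hδ.1 hS) fun γ hγ => h.not_subset hki hγ hδ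

/-- An iterated blow-up has an atlas, since a blow-up is unique up to isomorphism. -/
lemma exists_atlas_of_isIteratedBlowup [Finite E] [Nonempty E] (h : IsUnionFamily 𝒞 L) (n : ℕ) :
    ∀ {k m : ℕ} (_ : m = k + n) {X : Over (Spec (CommRingCat.of K))}
      (A : Atlas (levelFamily 𝒞 L k) X) {Y : Scheme.{u}} (f : Y ⟶ X.left),
      Scheme.IsIteratedBlowup f
        ((List.range' k n).map fun i => A.center '' levelSets 𝒞 L i) →
      ∃ A' : Atlas (levelFamily 𝒞 L m) (Over.mk (f ≫ X.hom)), A'.incl.left ≫ f = A.incl.left := by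
  induction n with
  | zero =>
    intro k m hm X A Y f hf
    subst hm
    have := hf.isIso
    let e : X ≅ Over.mk (f ≫ X.hom) := Over.isoMk (asIso f).symm (by simp)
    refine ⟨A.ofIso e, ?_⟩
    change (A.incl.left ≫ inv f) ≫ f = _
    rw [Category.assoc, IsIso.inv_hom_id, Category.comp_id]
  | succ n ih =>
    intro k m hm X A Y f hf
    rw [List.range'_succ, List.map_cons] at hf
    obtain ⟨Y₁, f₁, g, rfl, hf₁, hg⟩ := hf.exists_cons
    obtain ⟨X', ⟨A'⟩⟩ := exists_atlas K (levelFamily 𝒞 L k ∪ levelSets 𝒞 L k)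
      (h.isStep k).isUnionClosed_union.empty_notMem
    obtain ⟨φ, hφ⟩ := exists_isRefinement A A'
    obtain ⟨e, he⟩ := (hφ.isBlowup (h.isStep k)).exists_iso hf₁
    let eO : X' ≅ Over.mk (f₁ ≫ X.hom) := Over.isoMk e (by
      change e.hom ≫ f₁ ≫ X.hom = X'.hom
      rw [reassoc_of% he, Over.w])
    let fO : Over.mk (f₁ ≫ X.hom) ⟶ X := Over.homMk f₁ rfl
    have heO : eO.hom ≫ fO = φ := Over.OverMorphism.ext he
    let A₁ : Atlas (levelFamily 𝒞 L (k + 1)) (Over.mk (f₁ ≫ X.hom)) := A'.ofIso eO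
    have hA₁ : IsRefinement A A₁ fO := by
      intro c
      change (A'.chart c ≫ eO.hom) ≫ fO = _
      rw [Category.assoc, heO, hφ]
    have hg' := (hA₁.map_strictTransform h n)
    change List.map (fun S' => Scheme.strictTransform f₁ _ '' S') _ = _ at hg'
    rw [hg'] at hg
    obtain ⟨A₂, hA₂⟩ := ih (k := k + 1) (m := m) (by omega) A₁ g hg
    let e' : Over.mk (g ≫ f₁ ≫ X.hom) ≅ Over.mk ((g ≫ f₁) ≫ X.hom) :=
      Over.isoMk (Iso.refl _) (by simp)
    refine ⟨A₂.ofIso e', ?_⟩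
    change (A₂.incl.left ≫ 𝟙 _) ≫ g ≫ f₁ = _
    have hne : Nonempty (Sel (levelFamily 𝒞 L k ∪ levelSets 𝒞 L k)) :=
      (h.isStep (k + 1)).isUnionClosed.nonempty_sel
    have h1 : A₁.incl.left ≫ f₁ = A.incl.left := congrArg (·.left) hA₁.incl_comp
    rw [Category.comp_id, reassoc_of% hA₂, h1]

/-- Iterated blow-ups exist: the scheme of the refined family is a blow-up. -/
lemma exists_isIteratedBlowup [Finite E] [Nonempty E] (h : IsUnionFamily 𝒞 L) (n : ℕ) :
    ∀ {k : ℕ} {X : Over (Spec (CommRingCat.of K))} (A : Atlas (levelFamily 𝒞 L k) X),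
      ∃ (Y : Scheme.{u}) (f : Y ⟶ X.left), Scheme.IsIteratedBlowup f
        ((List.range' k n).map fun i => A.center '' levelSets 𝒞 L i) := by
  induction n with
  | zero => exact fun {k X} A => ⟨_, 𝟙 _, .nil _⟩
  | succ n ih =>
    intro k X A
    obtain ⟨X', ⟨A'⟩⟩ := exists_atlas K (levelFamily 𝒞 L k ∪ levelSets 𝒞 L k)
      (h.isStep k).isUnionClosed_union.empty_notMem
    obtain ⟨φ, hφ⟩ := exists_isRefinement A A'
    obtain ⟨Y, g, hg⟩ := ih (k := k + 1) A'
    refine ⟨Y, g ≫ φ.left, ?_⟩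
    rw [List.range'_succ, List.map_cons]
    refine .cons φ.left g _ _ (hφ.isBlowup (h.isStep k)) ?_
    rw [hφ.map_strictTransform h n]
    exact hg

end Atlas

/-- The strata of the coordinate linear spaces, as sets of centres in projective space. -/
lemma stratum_eq_image [Finite E] (e₀ : E) (𝒞 : Set (Set E)) (i : ℕ) :
    stratum (PSpace.linearSpace K '' 𝒞) i =
      (pspaceAtlas K e₀).center '' levelSets 𝒞 (PSpace.linearSpace K) i := by
  ext Z
  constructor
  · intro hZ
    obtain ⟨γ, hγ, rfl⟩ := withoutMinimal_subset _ _ hZ.1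
    exact ⟨γ, ⟨hγ, hZ⟩, pspaceAtlas_center e₀ γ⟩
  · rintro ⟨γ, hγ, rfl⟩
    rw [pspaceAtlas_center e₀ γ]
    exact hγ.2

lemma map_stratum_eq [Finite E] (e₀ : E) (𝒞 : Set (Set E)) (n : ℕ) :
    (List.range n).map (stratum (PSpace.linearSpace K '' 𝒞)) = (List.range' 0 n).map
      fun i => (pspaceAtlas K e₀).center '' levelSets 𝒞 (PSpace.linearSpace K) i := by
  rw [List.range_eq_range']
  exact List.map_congr_left fun i _ => stratum_eq_image e₀ 𝒞 i

/-- A collection of non-empty proper sets, closed under union up to the set of all elements. -/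
lemma isUnionFamily_linearSpace [Finite E] (K : Type u) [Field K] {𝒞 : Set (Set E)}
    (h1 : ∀ γ ∈ 𝒞, γ.Nonempty) (h2 : ∀ γ ∈ 𝒞, γ ≠ Set.univ)
    (h3 : ∀ γ ∈ 𝒞, ∀ δ ∈ 𝒞, γ ∪ δ = Set.univ ∨ γ ∪ δ ∈ 𝒞) :
    IsUnionFamily 𝒞 (PSpace.linearSpace K) :=
  ⟨h1, h2, h3, fun γ hγ _ _ => linearSpace_le_iff (h2 γ hγ)⟩

section

variable [Finite E] [Nonempty E] (h : IsUnionFamily 𝒞 (PSpace.linearSpace K))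
include h

theorem exists_isIteratedBlowup_pspace : ∃ (P : Scheme.{u}) (π : P ⟶ PSpace K E),
    Scheme.IsIteratedBlowup π ((List.range (Nat.card E)).map
      (stratum (PSpace.linearSpace K '' 𝒞))) := by
  obtain ⟨e₀⟩ := ‹Nonempty E›
  have := Atlas.exists_isIteratedBlowup h (Nat.card E) (k := 0) (pspaceAtlas K e₀)
  rw [map_stratum_eq e₀]
  exact this

/-- The iterated blow-up along the linear spaces of `𝒞` is the scheme of the family formed by `𝒞` and
the set of all coordinates. -/
theorem exists_atlas_of_isIteratedBlowup_pspace {P : Scheme.{u}} (π : P ⟶ PSpace K E)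
    (hπ : Scheme.IsIteratedBlowup π ((List.range (Nat.card E)).map
      (stratum (PSpace.linearSpace K '' 𝒞)))) :
    ∃ A : Atlas (insert Set.univ 𝒞) (Over.mk (π ≫ PSpace.toSpec K E)),
      ∀ e₀, A.incl.left ≫ π = torus.toPSpace K (Function.Embedding.refl E) e₀ := by
  obtain ⟨e₀⟩ := ‹Nonempty E›
  have := Atlas.exists_atlas_of_isIteratedBlowup h (Nat.card E) (k := 0) (m := Nat.card E)
    (Nat.zero_add _).symm (pspaceAtlas K e₀) π (by
      rw [map_stratum_eq e₀] at hπ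
      exact hπ)
  rw [h.levelFamily_card] at this
  obtain ⟨A, hA⟩ := this
  exact ⟨A, fun e₁ => hA.trans (pspaceAtlas_incl e₀ e₁)⟩

end

end

noncomputable section

open charLattice toricSpec

/-! ### The toric structure -/

namespace toricSpec

variable {K M N N' : Type u} [Field K] [AddCommGroup M] [AddCommMonoid N] [AddCommMonoid N']

/-- The action of the torus `Spec K[M]` on `Spec K[N]` with weights `h : N ⟶ M`. -/
def act (K : Type u) [Field K] (h : N →+ M) :
    toricSpec K M ⊗ toricSpec K N ⟶ toricSpec K N :=
  lift
    { toFun n := char (fst (toricSpec K M) (toricSpec K N)) (h n.toAdd) *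
        char (snd (toricSpec K M) (toricSpec K N)) n.toAdd
      map_one' := by simp
      map_mul' m n := by
        simp only [toAdd_mul, map_add, char_add]
        ring }

lemma char_act (h : N →+ M) (n : N) : char (act K h) n =
    char (fst (toricSpec K M) (toricSpec K N)) (h n) *
      char (snd (toricSpec K M) (toricSpec K N)) n := by
  rw [act, char_lift]; rfl

lemma char_comp_act {Z : Over (Spec (CommRingCat.of K))} (f : Z ⟶ toricSpec K M ⊗ toricSpec K N)
    (h : N →+ M) (n : N) :
    char (f ≫ act K h) n = char (f ≫ fst _ _) (h n) * char (f ≫ snd _ _) n := by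
  rw [char_comp, char_act, map_mul, ← char_comp, ← char_comp]

lemma char_whiskerRight_comp_act {Z : Over (Spec (CommRingCat.of K))} (a : Z ⟶ toricSpec K M)
    (h : N →+ M) (n : N) : char (a ▷ toricSpec K N ≫ act K h) n =
      char (fst _ _ ≫ a) (h n) * char (snd _ _) n := by
  rw [char_comp, char_act, map_mul, ← char_comp, ← char_comp, whiskerRight_fst, whiskerRight_snd]

lemma char_whiskerLeft_comp_act {Z : Over (Spec (CommRingCat.of K))} (b : Z ⟶ toricSpec K N)
    (h : N →+ M) (n : N) : char (toricSpec K M ◁ b ≫ act K h) n =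
      char (fst _ _) (h n) * char (snd _ _ ≫ b) n := by
  rw [char_comp, char_act, map_mul, ← char_comp, ← char_comp, whiskerLeft_fst, whiskerLeft_snd]

lemma one_act (h : N →+ M) :
    (MonObj.one (X := toricSpec K M) ▷ toricSpec K N) ≫ act K h = (λ_ (toricSpec K N)).hom := by
  refine hom_ext fun n => ?_
  rw [char_whiskerRight_comp_act, char_comp, char_one, map_one, one_mul, leftUnitor_hom]

lemma mul_act (h : N →+ M) : (MonObj.mul (X := toricSpec K M) ▷ toricSpec K N) ≫ act K h =
    (α_ (toricSpec K M) (toricSpec K M) (toricSpec K N)).hom ≫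
      (toricSpec K M ◁ act K h) ≫ act K h := by
  refine hom_ext fun n => ?_
  rw [char_whiskerRight_comp_act, char_comp, char_mul', map_mul, ← char_comp, ← char_comp,
    ← Category.assoc, char_comp_act, Category.assoc, Category.assoc, whiskerLeft_fst,
    whiskerLeft_snd, ← Category.assoc, char_comp_act, associator_hom_fst, Category.assoc,
    associator_hom_snd_fst, Category.assoc, associator_hom_snd_snd, mul_assoc]

lemma act_eq_mul : act K (AddMonoidHom.id M) = MonObj.mul (X := toricSpec K M) := by
  refine hom_ext fun n => ?_
  rw [char_act, char_mul']
  rfl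

lemma whiskerLeft_map_comp_act (g : N →+ N') (h : N →+ M) (h' : N' →+ M) (hg : h'.comp g = h) :
    toricSpec K M ◁ map K g ≫ act K h = act K h' ≫ map K g := by
  refine hom_ext fun n => ?_
  rw [char_whiskerLeft_comp_act, char_map, char_map, char_act, ← hg]
  rfl

end toricSpec

variable {K E : Type u} [Field K] {G : Set (Set E)}

lemma charLattice.eq_sum_smul_ratio [Fintype E] (m : charLattice E) (b : E) :
    m = ∑ a, (m : E →₀ ℤ) a • ratio a b := by
  have hdeg : ∑ a, (m : E →₀ ℤ) a = 0 := by
    have := m.2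
    rw [AddMonoidHom.mem_ker, Finsupp.degree_eq_sum] at this
    exact this
  apply Subtype.ext
  rw [AddSubgroup.val_finsetSum]
  change (m : E →₀ ℤ) = ∑ a, (m : E →₀ ℤ) a • (Finsupp.single a (1 : ℤ) - Finsupp.single b 1)
  simp only [smul_sub, Finset.sum_sub_distrib]
  rw [← Finset.sum_smul, hdeg, zero_smul, sub_zero]
  simp only [Finsupp.smul_single, smul_eq_mul, mul_one]
  exact (Finsupp.univ_sum_single (m : E →₀ ℤ)).symm

lemma charLattice.mem_closure_ratio [Finite E] (m : charLattice E) :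
    m ∈ AddSubmonoid.closure {m | ∃ a b : E, m = ratio a b} := by
  have := Fintype.ofFinite E
  rcases isEmpty_or_nonempty E with hE | ⟨⟨b⟩⟩
  · have : m = 0 := Subtype.ext (Finsupp.ext fun e => hE.elim e)
    rw [this]
    exact zero_mem _
  rw [eq_sum_smul_ratio m b]
  refine sum_mem fun a _ => ?_
  rcases Int.eq_nat_or_neg ((m : E →₀ ℤ) a) with ⟨n, h | h⟩
  · rw [h, natCast_zsmul]
    exact nsmul_mem (AddSubmonoid.subset_closure (s := {m | ∃ a b : E, m = ratio a b}) ⟨a, b, rfl⟩) _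
  · rw [h, neg_smul, ← smul_neg, natCast_zsmul, neg_ratio]
    exact nsmul_mem (AddSubmonoid.subset_closure (s := {m | ∃ a b : E, m = ratio a b}) ⟨b, a, rfl⟩) _

lemma exists_add_nsmul_mem {M : Type*} [AddCommMonoid M] {N : AddSubmonoid M} {T : Set M} {w : M}
    (hT : ∀ t ∈ T, t + w ∈ N) {m : M} (hm : m ∈ AddSubmonoid.closure T) :
    ∃ k : ℕ, m + k • w ∈ N := by
  induction hm using AddSubmonoid.closure_induction with
  | mem t ht => exact ⟨1, by rw [one_smul]; exact hT t ht⟩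
  | zero => exact ⟨0, by rw [zero_smul, add_zero]; exact zero_mem _⟩
  | add m m' _ _ h h' =>
    obtain ⟨k, hk⟩ := h
    obtain ⟨k', hk'⟩ := h'
    refine ⟨k + k', ?_⟩
    rw [add_smul, add_add_add_comm]
    exact add_mem hk hk'

/-- The generic torus is open in each chart. -/
lemma isOpenImmersion_map_subtype [Finite E] (hG : IsUnionClosed G) (c : Sel G) :
    IsOpenImmersion (toricSpec.map K (chartMonoid c).subtype).left := by
  classical
  have := Fintype.ofFinite E
  let w : chartMonoid c := ∑ a : E, chartGen c hG.top ⟨a, trivial⟩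
  have hw : (w : charLattice E) = ∑ a, ratio a (c hG.top : E) := AddSubmonoid.coe_finsetSum _ _ _
  refine map_isOpenImmersion (w := w) (v := -(w : charLattice E)) Subtype.val_injective
    (add_neg_cancel _) fun m => ?_
  obtain ⟨k, hk⟩ := exists_add_nsmul_mem (N := chartMonoid c) (w := (w : charLattice E)) (T := {m | ∃ a b : E, m = ratio a b}) (by
    rintro _ ⟨a, b, rfl⟩
    rw [hw, ← Finset.add_sum_erase _ _ (Finset.mem_univ b), ← add_assoc, ratio_add_ratio]
    exact add_mem (ratio_mem_chartMonoid c hG.top trivial)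
      (sum_mem fun e _ => ratio_mem_chartMonoid c hG.top trivial)) (mem_closure_ratio m)
  exact ⟨k, ⟨_, hk⟩, rfl⟩

namespace Atlas

variable {X : Over (Spec (CommRingCat.of K))} (A : Atlas G X)

lemma exists_act : ∃ act : torus K E ⊗ X ⟶ X, ∀ c, torus K E ◁ A.chart c ≫ act =
    toricSpec.act K (chartMonoid c).subtype ≫ A.chart c := by
  have := A.isSeparated
  refine A.exists_glue_prod _ (MonObj.mul (X := toricSpec K (charLattice E)) ≫ A.incl) fun c => ?_
  rw [← Category.assoc, whiskerLeft_map_comp_act _ _ (AddMonoidHom.id _) (AddMonoidHom.id_comp _),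
    act_eq_mul, Category.assoc, A.map_chart]

/-- The action of the torus. -/
def act : torus K E ⊗ X ⟶ X := A.exists_act.choose

lemma whiskerLeft_chart_comp_act (c : Sel G) : torus K E ◁ A.chart c ≫ A.act =
    toricSpec.act K (chartMonoid c).subtype ≫ A.chart c := A.exists_act.choose_spec c

lemma isOpenImmersion_incl [Finite E] (hG : IsUnionClosed G) : IsOpenImmersion A.incl.left := by
  obtain ⟨c⟩ := hG.nonempty_sel
  have := isOpenImmersion_map_subtype (K := K) hG c
  rw [← A.map_chart c, Over.comp_left]
  infer_instance

include A in
lemma smooth [Finite E] (hG : IsUnionClosed G) : Smooth X.hom := by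
  choose c hc hx using A.exists_isNested
  let 𝒰 : X.left.OpenCover := Scheme.Cover.mkOfCovers (P := @IsOpenImmersion) X.left
    (fun x => (toricSpec K (chartMonoid (c x))).left) (fun x => (A.chart (c x)).left)
    (fun x => ⟨x, hx x⟩) (fun x => inferInstance)
  have : IsZariskiLocalAtSource @Smooth.{u} :=
    HasRingHomProperty.instIsZariskiLocalAtSource (Q := RingHom.Smooth)
  refine (IsZariskiLocalAtSource.iff_of_openCover (P := @Smooth.{u}) 𝒰).2 fun x => ?_
  have h1 : (A.chart (c x)).left ≫ X.hom = (toricSpec K (chartMonoid (c x))).hom := Over.w _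
  refine (congrArg (fun f => Smooth f) h1).mpr ?_
  obtain ⟨σ, hσ, ⟨e⟩⟩ := (hc x).exists_equiv hG
  have h3 : Algebra.Smooth K (MvPolynomial σ K) :=
    ⟨inferInstance, inferInstance⟩
  have h2 : Algebra.Smooth K (AddMonoidAlgebra K (chartMonoid (c x))) :=
    Algebra.Smooth.of_equiv (A := MvPolynomial σ K) (AddMonoidAlgebra.domCongr K K e : MvPolynomial σ K ≃ₐ[K] _)
  change Smooth (Spec.map (CommRingCat.ofHom
    (algebraMap K (AddMonoidAlgebra K (chartMonoid (c x))))))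
  rw [HasRingHomProperty.Spec_iff (P := @Smooth.{u})]
  exact RingHom.smooth_algebraMap.2 h2

include A in
lemma quasiCompact [Finite E] : QuasiCompact X.hom := by
  have : CompactSpace X.left := by
    constructor
    have : (Set.univ : Set X.left) = ⋃ c, Set.range (A.chart c).left := by
      ext x
      simpa using A.covers x
    rw [this]
    refine isCompact_iUnion fun c => ?_
    have : CompactSpace (toricSpec K (chartMonoid c)).left :=
      inferInstanceAs (CompactSpace (Spec (.of (AddMonoidAlgebra K (chartMonoid c)))))
    exact isCompact_range (A.chart c).left.continuous
  infer_instance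

/-- The structure of a toric variety given by an atlas. -/
def toricStructure [Finite E] (hG : IsUnionClosed G) : ToricStructure (torus K E) X where
  isIntegral :=
    have := hG.nonempty_sel
    A.isIntegral
  isSeparated := A.isSeparated
  locallyOfFiniteType := by
    have := A.smooth hG
    infer_instance
  quasiCompact := A.quasiCompact
  incl := A.incl
  isOpenImmersion := A.isOpenImmersion_incl hG
  act := A.act
  one_act := by
    refine A.prod_hom_ext _ fun c => ?_
    rw [whisker_exchange_assoc, whiskerLeft_chart_comp_act]
    refine (Category.assoc _ _ _).symm.trans ?_
    refine (congrArg (· ≫ A.chart c) (toricSpec.one_act (chartMonoid c).subtype)).trans ?_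
    exact (leftUnitor_naturality _).symm
  mul_act := by
    refine A.prod_hom_ext _ fun c => ?_
    rw [whisker_exchange_assoc, whiskerLeft_chart_comp_act]
    refine (Category.assoc _ _ _).symm.trans ?_
    refine (congrArg (· ≫ A.chart c) (toricSpec.mul_act (chartMonoid c).subtype)).trans ?_
    have h1 := A.whiskerLeft_chart_comp_act c
    have h2 : (torus K E ⊗ torus K E) ◁ A.chart c ≫ (α_ (torus K E) (torus K E) X).hom =
      (α_ _ _ _).hom ≫ torus K E ◁ (torus K E ◁ A.chart c) := by simp
    rw [reassoc_of% h2, ← MonoidalCategory.whiskerLeft_comp_assoc, h1,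
      MonoidalCategory.whiskerLeft_comp_assoc, h1, Category.assoc, Category.assoc]
  act_incl := by
    obtain ⟨c⟩ := hG.nonempty_sel
    rw [← A.map_chart c, MonoidalCategory.whiskerLeft_comp, Category.assoc,
      whiskerLeft_chart_comp_act, ← Category.assoc,
      whiskerLeft_map_comp_act _ _ (AddMonoidHom.id _) (AddMonoidHom.id_comp _), act_eq_mul,
      Category.assoc]

end Atlas

end

noncomputable section

open charLattice toricSpec

/-! ### Products of tori, and orbits in affine toric schemes -/

namespace toricSpec

section pi

variable {K : Type u} [Field K] {n : ℕ} (M : Fin n → Type u) [∀ i, AddCommGroup (M i)]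

/-- The morphism from a product of tori to the torus of the product of the character lattices. -/
def piHom (K : Type u) [Field K] : (∏ᶜ fun i => toricSpec K (M i)) ⟶ toricSpec K (∀ i, M i) :=
  lift
    { toFun m := ∏ i, char (Pi.π (fun i => toricSpec K (M i)) i) (m.toAdd i)
      map_one' := by simp
      map_mul' m m' := by simp [char_add, Finset.prod_mul_distrib] }

lemma char_piHom (m : ∀ i, M i) :
    char (piHom M K) m = ∏ i, char (Pi.π (fun i => toricSpec K (M i)) i) (m i) := by
  rw [piHom, char_lift]
  rfl

lemma char_comp_piHom {Z : Over (Spec (CommRingCat.of K))}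
    (f : Z ⟶ ∏ᶜ fun i => toricSpec K (M i)) (m : ∀ i, M i) :
    char (f ≫ piHom M K) m = ∏ i, char (f ≫ Pi.π _ i) (m i) := by
  rw [char_comp, char_piHom, map_prod]
  refine Finset.prod_congr rfl fun i _ => ?_
  rw [char_comp]

/-- A finite product of tori. -/
def piIso (K : Type u) [Field K] :
    (∏ᶜ fun i => toricSpec K (M i)) ≅ toricSpec K (∀ i, M i) where
  hom := piHom M K
  inv := Pi.lift fun i => map K (AddMonoidHom.single M i)
  hom_inv_id := by
    refine Pi.hom_ext _ _ fun i => hom_ext fun m => ?_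
    rw [Category.assoc, Pi.lift_π, char_map, char_piHom, Category.id_comp]
    refine (Finset.prod_eq_single i (fun j _ hj => ?_) (fun h => absurd (Finset.mem_univ i) h)).trans ?_
    · change char _ (Pi.single i m j) = 1
      rw [Pi.single_eq_of_ne hj, char_zero]
    · change char _ (Pi.single i m i) = _
      rw [Pi.single_eq_same]
  inv_hom_id := by
    refine hom_ext fun m => ?_
    rw [char_comp_piHom]
    have h1 : charHom (𝟙 (toricSpec K (∀ i, M i))) (Multiplicative.ofAdd (∑ i, Pi.single i (m i))) =
        ∏ i, charHom (𝟙 (toricSpec K (∀ i, M i))) (Multiplicative.ofAdd (Pi.single i (m i))) := by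
      rw [ofAdd_sum, map_prod]
    rw [Finset.univ_sum_single] at h1
    refine Eq.trans ?_ h1.symm
    refine Finset.prod_congr rfl fun i _ => ?_
    rw [Pi.lift_π, char_map']
    rfl

lemma piIso_inv_comp_π (i : Fin n) : (piIso M K).inv ≫ Pi.π _ i =
    map K (AddMonoidHom.single M i) := Pi.lift_π _ _

end pi

lemma nonzeroAt_of_group {K M : Type u} [Field K] [AddCommGroup M] (y : (toricSpec K M).left) (m : M) :
    NonzeroAt y m := by
  have h : NonzeroAt y (m + -m) := by rw [add_neg_cancel]; exact nonzeroAt_zero y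
  exact (nonzeroAt_add.1 h).1

lemma isUnit_char_of_group {K M : Type u} [Field K] [AddCommGroup M]
    {Z : Over (Spec (CommRingCat.of K))} (f : Z ⟶ toricSpec K M) (m : M) : IsUnit (char f m) :=
  IsUnit.of_mul_eq_one (char f (-m)) (by rw [← char_add, add_neg_cancel, char_zero])

namespace Face

variable {K N Q : Type u} [Field K] [AddCommMonoid N] [AddCommMonoid Q] (F : Face N Q) (s : Q →+ N)

section

variable (h1 : ∀ q, F.mem (s q)) (h2 : ∀ q, F.toFun (s q) = q)
include h1 h2

lemma ringHom_surjective : Function.Surjective (F.ringHom K).toRingHom := by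
  intro x
  induction x using AddMonoidAlgebra.induction_on with
  | of q =>
    refine ⟨AddMonoidAlgebra.single (s q) 1, (F.ringHom_of_mem (h1 q) 1).trans ?_⟩
    rw [h2]
    rfl
  | add x y hx hy =>
    obtain ⟨x, rfl⟩ := hx
    obtain ⟨y, rfl⟩ := hy
    exact ⟨x + y, map_add _ _ _⟩
  | smul r x hx =>
    obtain ⟨x, rfl⟩ := hx
    exact ⟨r • x, map_smul (F.ringHom K) r x⟩

lemma isClosedImmersion_map : IsClosedImmersion (F.map K).left :=
  map_isClosedImmersion_of_surjective (K := K) (F.ringHom K).toRingHom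
    (F.ringHom_surjective s h1 h2)

/-- The range of the immersion of a face that is a direct summand. -/
lemma mem_range_map (h3 : ∀ n, F.mem n → s (F.toFun n) = n) (z : (toricSpec K N).left)
    (hz : ∀ n, NonzeroAt z n → F.mem n) : z ∈ Set.range (F.map K).left := by
  have hsurj := F.ringHom_surjective (K := K) s h1 h2
  have key (x : AddMonoidAlgebra K N) :
      x - AddMonoidAlgebra.mapDomainAlgHom K K s (F.ringHom K x) ∈ (id z : PrimeSpectrum _).asIdeal := by
    induction x using AddMonoidAlgebra.induction_on with
    | of m =>
      change AddMonoidAlgebra.single m 1 - AddMonoidAlgebra.mapDomainAlgHom K K s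
        (F.ringHom K (AddMonoidAlgebra.single m 1)) ∈ _
      by_cases hm : F.mem m
      · rw [Face.ringHom_of_mem _ hm]
        have : AddMonoidAlgebra.mapDomainAlgHom K K s (AddMonoidAlgebra.single (F.toFun m) (1 : K)) =
            AddMonoidAlgebra.single m 1 := by
          change AddMonoidAlgebra.mapDomain s _ = _
          rw [AddMonoidAlgebra.mapDomain_single, h3 m hm]
        rw [this, sub_self]
        exact zero_mem _
      · rw [Face.ringHom_of_notMem _ hm, map_zero, sub_zero]
        exact not_not.1 fun h => hm (hz m h)
    | add x y hx hy =>
      rw [map_add, map_add, add_sub_add_comm]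
      exact add_mem hx hy
    | smul r x hx =>
      rw [map_smul, map_smul, ← smul_sub]
      exact Submodule.smul_of_tower_mem _ r hx
  have h4 := range_comap_of_surjective (AddMonoidAlgebra K Q) (F.ringHom K).toRingHom hsurj
  refine (Set.ext_iff.1 h4 z).2 fun x hx => ?_
  have h5 := key x
  rwa [show F.ringHom K x = 0 from hx, map_zero, sub_zero] at h5

end

/-- Equivariance of the inclusion of a face. -/
lemma whiskerLeft_map_comp_act {M : Type u} [AddCommGroup M] (h : N →+ M) (h' : Q →+ M)
    (hh' : ∀ n, F.mem n → h' (F.toFun n) = h n) :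
    toricSpec K M ◁ F.map K ≫ act K h = act K h' ≫ F.map K := by
  refine hom_ext fun n => ?_
  rw [char_whiskerLeft_comp_act]
  by_cases hn : F.mem n
  · rw [F.char_map_of_mem _ hn, F.char_map_of_mem _ hn, char_act, hh' n hn]
  · rw [F.char_map_of_notMem _ hn, F.char_map_of_notMem _ hn, mul_zero]

end Face

end toricSpec

end

noncomputable section

open charLattice toricSpec

/-! ### Data describing the orbits -/

/-- A flag of members of `G`, and an injective family of elements in each difference of two
consecutive members, which meets the members of `G` that are not contained in the smaller one. -/
structure OrbitDatum {E : Type u} (G : Set (Set E)) where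
  p : ℕ
  flag : Fin (p + 2) → Set E
  flag_zero : flag 0 = Set.univ
  flag_last : flag (Fin.last (p + 1)) = ∅
  strictAnti : StrictAnti flag
  mem : ∀ i : Fin (p + 1), flag i.castSucc ∈ G
  piece : Fin (p + 1) → Type u
  edge : ∀ i, piece i ↪ E
  edge_mem : ∀ i e, edge i e ∈ flag i.castSucc
  edge_notMem : ∀ i e, edge i e ∉ flag i.succ
  meets : ∀ T ∈ G, ∀ i : Fin (p + 1), T ⊆ flag i.castSucc → ¬ T ⊆ flag i.succ → ∃ e, edge i e ∈ T

/-- The sum of the coefficients in `S`. -/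
def coeffSum {E : Type u} (S : Set E) : (E →₀ ℤ) →+ ℤ :=
  open Classical in Finsupp.liftAddHom fun a => if a ∈ S then AddMonoidHom.id ℤ else 0

open Classical in
lemma coeffSum_ratio {E : Type u} (S : Set E) (a b : E) : coeffSum S (ratio a b : E →₀ ℤ) =
    (if a ∈ S then 1 else 0) - (if b ∈ S then 1 else 0) := by
  change coeffSum S (Finsupp.single a 1 - Finsupp.single b 1) = _
  rw [map_sub, coeffSum, Finsupp.liftAddHom_apply_single, Finsupp.liftAddHom_apply_single]
  split_ifs <;> rfl

namespace OrbitDatum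

variable {K E : Type u} [Field K] {G : Set (Set E)} (d : OrbitDatum G)

/-- A member of the flag. -/
def set (i : Fin (d.p + 1)) : G := ⟨d.flag i.castSucc, d.mem i⟩

lemma edge_mem_flag_iff (i j : Fin (d.p + 1)) (e : d.piece i) :
    d.edge i e ∈ d.flag j.castSucc ↔ j ≤ i := by
  constructor
  · intro h
    by_contra! hij
    exact d.edge_notMem i e (d.strictAnti.antitone (Fin.succ_le_castSucc_iff.2 hij) h)
  · intro h
    exact d.strictAnti.antitone (Fin.castSucc_le_castSucc_iff.2 h) (d.edge_mem i e)

lemma edge_ne {i j : Fin (d.p + 1)} (hij : i ≠ j) (e : d.piece i) (e' : d.piece j) :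
    d.edge i e ≠ d.edge j e' := by
  intro h
  have h1 := (d.edge_mem_flag_iff i j e).1 (h ▸ d.edge_mem j e')
  have h2 := (d.edge_mem_flag_iff j i e').1 (h ▸ d.edge_mem i e)
  exact hij (le_antisymm h2 h1)

instance nonempty_piece (i : Fin (d.p + 1)) : Nonempty (d.piece i) := by
  obtain ⟨e, -⟩ := d.meets _ (d.mem i) i subset_rfl
    (fun h => (d.strictAnti (Fin.castSucc_lt_succ (i := i))).not_ge h)
  exact ⟨e⟩

instance finite_piece [Finite E] (i : Fin (d.p + 1)) : Finite (d.piece i) :=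
  Finite.of_injective _ (d.edge i).injective

lemma exists_level {T : Set E} (hT : T.Nonempty) :
    ∃ i : Fin (d.p + 1), T ⊆ d.flag i.castSucc ∧ ¬ T ⊆ d.flag i.succ := by
  by_contra! h
  have h1 (j : Fin (d.p + 2)) : T ⊆ d.flag j := by
    induction j using Fin.induction with
    | zero => rw [d.flag_zero]; exact Set.subset_univ T
    | succ i ih => exact h i ih
  have h2 := h1 (Fin.last (d.p + 1))
  rw [d.flag_last] at h2
  exact hT.ne_empty (Set.subset_empty_iff.1 h2)

/-- A choice of elements of the given families. -/
def IsAdmissible (c : Sel G) : Prop :=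
  ∀ T : G, ∃ i, (T : Set E) ⊆ d.flag i.castSucc ∧ ∃ e, d.edge i e = c T

lemma exists_isAdmissible (hG : ∅ ∉ G) : ∃ c, d.IsAdmissible c := by
  have h (T : G) : ∃ a : (T : Set E), ∃ i, (T : Set E) ⊆ d.flag i.castSucc ∧ ∃ e, d.edge i e = a := by
    obtain ⟨i, h1, h2⟩ := d.exists_level
      (Set.nonempty_iff_ne_empty.2 fun h : (T : Set E) = ∅ => hG (h ▸ T.2))
    obtain ⟨e, he⟩ := d.meets T T.2 i h1 h2
    exact ⟨⟨_, he⟩, i, h1, e, rfl⟩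
  choose c hc using h
  exact ⟨c, hc⟩

variable {d} in
lemma IsAdmissible.exists_edge_eq {c : Sel G} (hc : d.IsAdmissible c) (i : Fin (d.p + 1)) :
    ∃ e, d.edge i e = c (d.set i) := by
  obtain ⟨j, h1, e, he⟩ := hc (d.set i)
  have hji : j ≤ i := Fin.castSucc_le_castSucc_iff.1 (d.strictAnti.le_iff_ge.1 h1)
  have hij : i ≤ j := (d.edge_mem_flag_iff j i e).1 (he ▸ (c (d.set i)).2)
  obtain rfl := le_antisymm hij hji
  exact ⟨e, he⟩

/-- The monoid of the chart in which the coordinates of the given families are invertible. -/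
def monoid : AddSubmonoid (charLattice E) :=
  AddSubmonoid.closure {m | ∃ i, ∃ a ∈ d.flag i.castSucc, ∃ e, m = ratio a (d.edge i e)}

lemma ratio_mem_monoid (i : Fin (d.p + 1)) {a : E} (ha : a ∈ d.flag i.castSucc) (e : d.piece i) :
    ratio a (d.edge i e) ∈ d.monoid := AddSubmonoid.subset_closure ⟨i, a, ha, e, rfl⟩

variable {d} in
lemma IsAdmissible.chartMonoid_le {c : Sel G} (hc : d.IsAdmissible c) :
    chartMonoid c ≤ d.monoid := by
  rw [chartMonoid, AddSubmonoid.closure_le]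
  rintro _ ⟨T, a, ha, rfl⟩
  obtain ⟨i, h1, e, he⟩ := hc T
  rw [← he]
  exact d.ratio_mem_monoid i (h1 ha) e

section chart

variable {d} {c : Sel G} (hc : d.IsAdmissible c)

/-- The inclusion of monoids, which inverts the coordinates of the given families. -/
def IsAdmissible.incl : chartMonoid c →+ d.monoid := AddSubmonoid.inclusion hc.chartMonoid_le

variable [Finite E]
include hc

lemma IsAdmissible.exists_localizes : ∃ w : chartMonoid c, -(w : charLattice E) ∈ d.monoid ∧
    (∀ m : d.monoid, ∃ k : ℕ, (m : charLattice E) + k • (w : charLattice E) ∈ chartMonoid c) ∧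
    ∀ y : (toricSpec K (chartMonoid c)).left, (∀ i (e : d.piece i),
      NonzeroAt y (chartGen c (d.set i) ⟨d.edge i e, d.edge_mem i e⟩)) → NonzeroAt y w := by
  classical
  have hfin (i : Fin (d.p + 1)) : Fintype (d.piece i) := Fintype.ofFinite _
  let w : chartMonoid c := ∑ x : (Σ i, d.piece i),
    chartGen c (d.set x.1) ⟨d.edge x.1 x.2, d.edge_mem x.1 x.2⟩
  have hw : (w : charLattice E) = ∑ x : (Σ i, d.piece i), ratio (d.edge x.1 x.2) (c (d.set x.1)) :=
    AddSubmonoid.coe_finsetSum _ _ _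
  refine ⟨w, ?_, fun m => ?_, fun y hy => ?_⟩
  · rw [hw, ← Finset.sum_neg_distrib]
    refine sum_mem fun x _ => ?_
    rw [neg_ratio]
    exact d.ratio_mem_monoid x.1 (c (d.set x.1)).2 x.2
  · refine exists_add_nsmul_mem (N := chartMonoid c) (w := (w : charLattice E)) ?_ m.2
    rintro _ ⟨i, a, ha, e, rfl⟩
    rw [hw, ← Finset.add_sum_erase _ _ (Finset.mem_univ ⟨i, e⟩), ← add_assoc, ratio_add_ratio]
    exact add_mem (ratio_mem_chartMonoid c (d.set i) ha)
      (sum_mem fun x _ => ratio_mem_chartMonoid c (d.set x.1) (d.edge_mem x.1 x.2))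
  · exact (nonzeroAt_sum _ _).2 fun x _ => hy x.1 x.2

lemma IsAdmissible.isOpenImmersion_map : IsOpenImmersion (toricSpec.map K hc.incl).left := by
  obtain ⟨w, h1, h2, -⟩ := hc.exists_localizes (K := K)
  refine map_isOpenImmersion (w := w) (v := ⟨_, h1⟩)
    (AddSubmonoid.inclusion_injective hc.chartMonoid_le) (Subtype.ext (add_neg_cancel _)) fun m => ?_
  obtain ⟨k, hk⟩ := h2 m
  exact ⟨k, ⟨_, hk⟩, Subtype.ext rfl⟩

lemma IsAdmissible.mem_range_map {y : (toricSpec K (chartMonoid c)).left}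
    (hy : ∀ i (e : d.piece i),
      NonzeroAt y (chartGen c (d.set i) ⟨d.edge i e, d.edge_mem i e⟩)) :
    y ∈ Set.range (toricSpec.map K hc.incl).left := by
  obtain ⟨w, h1, h2, h3⟩ := hc.exists_localizes (K := K)
  refine (mem_range_map_iff (w := w) (v := ⟨_, h1⟩)
    (AddSubmonoid.inclusion_injective hc.chartMonoid_le) (Subtype.ext (add_neg_cancel _))
    (fun m => ?_) y).2 (h3 y hy)
  obtain ⟨k, hk⟩ := h2 m
  exact ⟨k, ⟨_, hk⟩, Subtype.ext rfl⟩

end chart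

/-! ### The torus of an orbit -/

/-- The character lattice of the orbit. -/
abbrev Lattice : Type u := ∀ i, charLattice (d.piece i)

/-- The homomorphism of lattices dual to the projection of the torus to its quotient. -/
def toLattice : d.Lattice →+ charLattice E :=
  ∑ i, (charLattice.map (d.edge i)).comp (Pi.evalAddMonoidHom (fun i => charLattice (d.piece i)) i)

lemma toLattice_apply (q : d.Lattice) : d.toLattice q = ∑ i, charLattice.map (d.edge i) (q i) := by
  simp [toLattice]

lemma _root_.charLattice.map_ratio {A B : Type u} (φ : B → A) (a b : B) :
    charLattice.map φ (ratio a b) = ratio (φ a) (φ b) := by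
  apply Subtype.ext
  change Finsupp.mapDomain φ (Finsupp.single a 1 - Finsupp.single b 1) = _
  rw [Finsupp.mapDomain_sub, Finsupp.mapDomain_single, Finsupp.mapDomain_single]
  rfl

lemma toLattice_single (i : Fin (d.p + 1)) (a b : d.piece i) :
    d.toLattice (Pi.single i (ratio a b)) = ratio (d.edge i a) (d.edge i b) := by
  rw [toLattice_apply]
  refine (Finset.sum_eq_single i (fun j _ hj => ?_)
    (fun h => absurd (Finset.mem_univ i) h)).trans ?_
  · rw [Pi.single_eq_of_ne hj, map_zero]
  · rw [Pi.single_eq_same, map_ratio]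

lemma toLattice_induction [Finite E] {N : AddSubmonoid (charLattice E)}
    (hN : ∀ i (a b : d.piece i), ratio (d.edge i a) (d.edge i b) ∈ N) (q : d.Lattice) :
    d.toLattice q ∈ N := by
  rw [toLattice_apply]
  refine sum_mem fun i _ => ?_
  have h := mem_closure_ratio (q i)
  generalize q i = m at h
  induction h using AddSubmonoid.closure_induction with
  | mem m hm =>
    obtain ⟨a, b, rfl⟩ := hm
    rw [map_ratio]
    exact hN i a b
  | zero => rw [map_zero]; exact zero_mem _
  | add m m' _ _ h h' => rw [map_add]; exact add_mem h h'

/-- A base point of each family. -/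
def base (i : Fin (d.p + 1)) : d.piece i := Classical.arbitrary _

/-- A retraction of `toLattice`: it forgets the other coefficients, and corrects the one at the base
point. -/
def retract : charLattice E →+ d.Lattice where
  toFun m i := ⟨Finsupp.comapDomain.addMonoidHom (d.edge i).injective m.1 - Finsupp.single (d.base i)
      (Finsupp.comapDomain.addMonoidHom (d.edge i).injective m.1).degree, by
    rw [AddMonoidHom.mem_ker, map_sub, Finsupp.degree_single, sub_self]⟩
  map_zero' := by
    funext i
    apply Subtype.ext
    change _ - _ = _
    rw [ZeroMemClass.coe_zero, map_zero, map_zero, Finsupp.single_zero, sub_zero]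
    rfl
  map_add' m m' := by
    funext i
    apply Subtype.ext
    change _ - _ = (_ - _) + (_ - _)
    rw [AddSubgroup.coe_add, map_add, map_add, Finsupp.single_add]
    abel

lemma retract_toLattice (q : d.Lattice) : d.retract (d.toLattice q) = q := by
  funext i
  have h : Finsupp.comapDomain.addMonoidHom (d.edge i).injective (d.toLattice q).1 = (q i).1 := by
    rw [toLattice_apply, AddSubgroup.val_finsetSum, map_sum]
    refine (Finset.sum_eq_single i (fun j _ hj => ?_)
      (fun h => absurd (Finset.mem_univ i) h)).trans ?_
    · ext e
      change Finsupp.mapDomain (d.edge j) (q j).1 (d.edge i e) = 0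
      refine Finsupp.mapDomain_of_notMem_range _ _ ?_
      rintro ⟨e', he'⟩
      exact d.edge_ne hj e' e he'
    · exact Finsupp.comapDomain_mapDomain _ (d.edge i).injective _
  apply Subtype.ext
  change _ - _ = _
  rw [h, (q i).2, Finsupp.single_zero, sub_zero]

/-- The face of the invertible monomials: those of degree zero in every member of the flag that do not
involve other elements than those of the given families. -/
def face : Face d.monoid d.Lattice where
  mem m := (∀ i : Fin (d.p + 1), coeffSum (d.flag i.castSucc) m.1 = 0) ∧
    ∀ a, (∀ i e, d.edge i e ≠ a) → (m.1 : E →₀ ℤ) a = 0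
  toFun m := d.retract m
  mem_zero := ⟨fun _ => map_zero _, fun _ _ => rfl⟩
  mem_add m n := by
    have h1 (m : d.monoid) (i : Fin (d.p + 1)) : 0 ≤ coeffSum (d.flag i.castSucc) m.1 := by
      obtain ⟨m, hm⟩ := m
      induction hm using AddSubmonoid.closure_induction with
      | mem m hm =>
        obtain ⟨j, a, ha, e, rfl⟩ := hm
        rw [coeffSum_ratio, d.edge_mem_flag_iff]
        by_cases hij : i ≤ j
        · rw [if_pos hij, if_pos (d.strictAnti.antitone (Fin.castSucc_le_castSucc_iff.2 hij) ha)]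
          rfl
        · rw [if_neg hij]
          split_ifs <;> simp
      | zero => exact (map_zero (coeffSum (d.flag i.castSucc))).ge
      | add m m' _ _ h h' =>
        exact (add_nonneg h h').trans_eq (map_add (coeffSum (d.flag i.castSucc)) _ _).symm
    have h2 (m : d.monoid) (a : E) (ha : ∀ i e, d.edge i e ≠ a) : 0 ≤ (m.1 : E →₀ ℤ) a := by
      obtain ⟨m, hm⟩ := m
      induction hm using AddSubmonoid.closure_induction with
      | mem m hm =>
        obtain ⟨j, b, hb, e, rfl⟩ := hm
        exact IsAdapted.ratio_apply_nonneg (ha j e).symm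
      | zero => rfl
      | add m m' _ _ h h' => exact add_nonneg h h'
    have h3 (i : Fin (d.p + 1)) : coeffSum (d.flag i.castSucc) (m + n).1 =
      coeffSum (d.flag i.castSucc) m.1 + coeffSum (d.flag i.castSucc) n.1 :=
        map_add (coeffSum (d.flag i.castSucc)) _ _
    have h4 (a : E) : ((m + n).1 : E →₀ ℤ) a = (m.1 : E →₀ ℤ) a + (n.1 : E →₀ ℤ) a := rfl
    constructor
    · rintro ⟨h5, h6⟩
      refine ⟨⟨fun i => ?_, fun a ha => ?_⟩, ⟨fun i => ?_, fun a ha => ?_⟩⟩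
      · have := h5 i; rw [h3] at this; have := h1 m i; have := h1 n i; omega
      · have := h6 a ha; rw [h4] at this; have := h2 m a ha; have := h2 n a ha; omega
      · have := h5 i; rw [h3] at this; have := h1 m i; have := h1 n i; omega
      · have := h6 a ha; rw [h4] at this; have := h2 m a ha; have := h2 n a ha; omega
    · rintro ⟨⟨h5, h6⟩, h7, h8⟩
      exact ⟨fun i => by rw [h3, h5, h7, add_zero], fun a ha => by rw [h4, h6 a ha, h8 a ha, add_zero]⟩
  toFun_zero := map_zero d.retract
  toFun_add m n _ _ := map_add d.retract m.1 n.1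

lemma face_mem_ratio_iff {i : Fin (d.p + 1)} {a : E} (ha : a ∈ d.flag i.castSucc) (e : d.piece i) :
    d.face.mem ⟨_, d.ratio_mem_monoid i ha e⟩ ↔ ∃ e', d.edge i e' = a := by
  constructor
  · rintro ⟨h1, h2⟩
    by_cases hae : a = d.edge i e
    · exact ⟨e, hae.symm⟩
    by_contra! h3
    obtain ⟨j, e', he'⟩ : ∃ j e', d.edge j e' = a := by
      by_contra! h4
      have := h2 a h4
      rw [IsAdapted.ratio_apply_self hae] at this
      exact one_ne_zero this
    subst he'
    have hij : i ≤ j := (d.edge_mem_flag_iff j i e').1 ha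
    rcases eq_or_ne i j with rfl | hne
    · exact h3 e' rfl
    · have h4 := h1 j
      rw [coeffSum_ratio, d.edge_mem_flag_iff, d.edge_mem_flag_iff, if_pos le_rfl,
        if_neg (hij.lt_of_ne hne).not_ge] at h4
      exact one_ne_zero h4
  · rintro ⟨e', rfl⟩
    refine ⟨fun j => ?_, fun a ha => ?_⟩
    · rw [coeffSum_ratio, d.edge_mem_flag_iff, d.edge_mem_flag_iff, sub_self]
    · exact IsAdapted.ratio_apply_of_ne (ha i e').symm (ha i e).symm

variable [Finite E]

lemma toLattice_mem_monoid (q : d.Lattice) : d.toLattice q ∈ d.monoid :=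
  d.toLattice_induction (fun i a b => d.ratio_mem_monoid i (d.edge_mem i a) b) q

/-- The splitting of the face. -/
def split : d.Lattice →+ d.monoid := d.toLattice.codRestrict d.monoid d.toLattice_mem_monoid

lemma face_mem_split (q : d.Lattice) : d.face.mem (d.split q) := by
  let N : AddSubmonoid d.monoid :=
    { carrier := {m | d.face.mem m}
      zero_mem' := d.face.mem_zero
      add_mem' := fun h h' => (d.face.mem_add _ _).2 ⟨h, h'⟩ }
  have h := d.toLattice_induction (N := N.map d.monoid.subtype) (fun i a b =>
    ⟨⟨_, d.ratio_mem_monoid i (d.edge_mem i a) b⟩, (d.face_mem_ratio_iff (d.edge_mem i a) b).2 ⟨a, rfl⟩, rfl⟩) q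
  obtain ⟨m, hm, hmq⟩ := h
  have : m = d.split q := Subtype.ext hmq
  exact this ▸ hm

lemma face_toFun_split (q : d.Lattice) : d.face.toFun (d.split q) = q := d.retract_toLattice q

lemma split_face_toFun (m : d.monoid) (hm : d.face.mem m) : d.split (d.face.toFun m) = m := by
  suffices h : ∃ q, d.split q = m by
    obtain ⟨q, rfl⟩ := h
    rw [face_toFun_split]
  obtain ⟨m, hm'⟩ := m
  induction hm' using AddSubmonoid.closure_induction with
  | mem m hm' =>
    obtain ⟨i, a, ha, e, rfl⟩ := hm'
    obtain ⟨e', rfl⟩ := (d.face_mem_ratio_iff ha e).1 hm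
    refine ⟨Pi.single i (ratio e' e), Subtype.ext ?_⟩
    exact d.toLattice_single i e' e
  | zero => exact ⟨0, map_zero _⟩
  | add m m' h h' hm1 hm2 =>
    obtain ⟨h3, h4⟩ := (d.face.mem_add ⟨m, h⟩ ⟨m', h'⟩).1 hm
    obtain ⟨q, hq⟩ := hm1 h3
    obtain ⟨q', hq'⟩ := hm2 h4
    exact ⟨q + q', by rw [map_add, hq, hq']; rfl⟩

end OrbitDatum

end

noncomputable section

open charLattice toricSpec

/-! ### Orbits -/

namespace OrbitDatum

variable {K E : Type u} [Field K] {G : Set (Set E)} (d : OrbitDatum G)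

/-- An admissible choice. -/
def choice (hG : ∅ ∉ G) : Sel G := (d.exists_isAdmissible hG).choose

lemma isAdmissible_choice (hG : ∅ ∉ G) : d.IsAdmissible (d.choice hG) :=
  (d.exists_isAdmissible hG).choose_spec

variable {X : Over (Spec (CommRingCat.of K))} (A : Atlas G X) (hG : ∅ ∉ G)

/-- The inclusion of the torus of the orbit in the chart of an admissible choice. -/
def toChart (K : Type u) [Field K] : toricSpec K d.Lattice ⟶ toricSpec K (chartMonoid (d.choice hG)) :=
  d.face.map K ≫ toricSpec.map K (d.isAdmissible_choice hG).incl

/-- The inclusion of the orbit. -/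
def immersion : toricSpec K d.Lattice ⟶ X := d.toChart hG K ≫ A.chart (d.choice hG)

/-- The set of points where the non-vanishing coordinates in the members of the flag are those of the
given families. -/
def orbit : Set X.left := {x | ∀ i, A.nz (d.set i) x = Set.range (d.edge i)}

lemma nonzeroAt_toChart (y : (toricSpec K d.Lattice).left) (m : chartMonoid (d.choice hG)) :
    NonzeroAt ((d.toChart hG K).left y) m ↔ d.face.mem ((d.isAdmissible_choice hG).incl m) := by
  change NonzeroAt ((toricSpec.map K (d.isAdmissible_choice hG).incl).left
    ((d.face.map K).left y)) m ↔ _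
  rw [nonzeroAt_map, Face.nonzeroAt_map]
  exact ⟨fun h => h.1, fun h => ⟨h, nonzeroAt_of_group y _⟩⟩

lemma immersion_mem_orbit (y : (toricSpec K d.Lattice).left) :
    (d.immersion A hG).left y ∈ d.orbit A := by
  intro i
  obtain ⟨e, he⟩ := (d.isAdmissible_choice hG).exists_edge_eq i
  ext a
  by_cases ha : a ∈ d.flag i.castSucc
  · refine (A.mem_nz_chart_iff (d.choice hG) ((d.toChart hG K).left y) (d.set i) ⟨a, ha⟩).trans ?_
    rw [nonzeroAt_toChart]
    have h1 : (d.isAdmissible_choice hG).incl (chartGen (d.choice hG) (d.set i) ⟨a, ha⟩) =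
        ⟨_, d.ratio_mem_monoid i ha e⟩ := by
      apply Subtype.ext
      change ratio a (d.choice hG (d.set i) : E) = _
      rw [← he]
    rw [h1]
    exact d.face_mem_ratio_iff ha e
  · refine iff_of_false (fun h => ha (A.nz_subset _ _ h)) ?_
    rintro ⟨e, rfl⟩
    exact ha (d.edge_mem i e)

variable [Finite E]

/-- The image is the whole orbit: a point of the orbit lies in the chart of any admissible choice, and
there it lies in the open part of the closed stratum of the face. -/
lemma range_immersion : Set.range (d.immersion A hG).left = d.orbit A := by
  apply subset_antisymm
  · rintro _ ⟨y, rfl⟩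
    exact d.immersion_mem_orbit A hG y
  intro x hx
  have hc := d.isAdmissible_choice hG
  obtain ⟨y, rfl⟩ : x ∈ Set.range (A.chart (d.choice hG)).left := by
    rw [A.mem_range_iff]
    intro T
    obtain ⟨i, h1, e, he⟩ := hc T
    have h2 : d.edge i e ∈ A.nz (d.set i) x := by rw [hx i]; exact ⟨e, rfl⟩
    rw [A.nz_eq_inter (S := T) (S' := d.set i) h1 x ⟨_, h2, he ▸ (d.choice hG T).2⟩, ← he]
    exact ⟨h2, he ▸ (d.choice hG T).2⟩
  have hnz (i : Fin (d.p + 1)) (a : E) (ha : a ∈ d.flag i.castSucc) :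
      NonzeroAt y (chartGen (d.choice hG) (d.set i) ⟨a, ha⟩) ↔ ∃ e, d.edge i e = a := by
    rw [← A.mem_nz_chart_iff (d.choice hG) y (d.set i) ⟨a, ha⟩, hx i]
    rfl
  obtain ⟨z, rfl⟩ := hc.mem_range_map (y := y) (fun i e => (hnz i _ _).2 ⟨e, rfl⟩)
  obtain ⟨t, rfl⟩ := d.face.mem_range_map d.split d.face_mem_split d.face_toFun_split
    d.split_face_toFun z (by
      rintro ⟨m, hm⟩ h
      induction hm using AddSubmonoid.closure_induction with
      | mem m hm =>
        obtain ⟨i, a, ha, e, rfl⟩ := hm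
        rw [d.face_mem_ratio_iff ha e, ← hnz i a ha, nonzeroAt_map]
        have h1 : hc.incl (chartGen (d.choice hG) (d.set i) ⟨a, ha⟩) =
            ⟨_, d.ratio_mem_monoid i ha e⟩ +
              hc.incl (chartGen (d.choice hG) (d.set i) ⟨d.edge i e, d.edge_mem i e⟩) :=
          Subtype.ext (ratio_add_ratio _ _ _).symm
        rw [h1, nonzeroAt_add]
        refine ⟨h, ?_⟩
        rw [← nonzeroAt_map]
        exact (hnz i _ _).2 ⟨e, rfl⟩
      | zero => exact d.face.mem_zero
      | add m m' hm hm' h1 h2 =>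
        have h3 : (⟨m + m', add_mem hm hm'⟩ : d.monoid) = ⟨m, hm⟩ + ⟨m', hm'⟩ := rfl
        rw [h3, d.face.mem_add]
        have h4 := (nonzeroAt_add (y := z) (m := ⟨m, hm⟩) (n := ⟨m', hm'⟩)).1 h
        exact ⟨h1 h4.1, h2 h4.2⟩)
  exact ⟨t, rfl⟩

lemma isImmersion : IsImmersion (d.immersion A hG).left := by
  have h1 := d.face.isClosedImmersion_map (K := K) d.split d.face_mem_split d.face_toFun_split
  have h2 := (d.isAdmissible_choice hG).isOpenImmersion_map (K := K)
  change IsImmersion (((d.face.map K).left ≫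
    (toricSpec.map K (d.isAdmissible_choice hG).incl).left) ≫ (A.chart (d.choice hG)).left)
  infer_instance

lemma whiskerLeft_immersion_comp_act : torus K E ◁ d.immersion A hG ≫ A.act =
    toricSpec.act K d.toLattice ≫ d.immersion A hG := by
  have h1 : toricSpec K (charLattice E) ◁ d.face.map K ≫ toricSpec.act K d.monoid.subtype =
      toricSpec.act K d.toLattice ≫ d.face.map K :=
    d.face.whiskerLeft_map_comp_act _ _ fun n hn => congrArg Subtype.val (d.split_face_toFun n hn)
  have h2 : toricSpec K (charLattice E) ◁ toricSpec.map K (d.isAdmissible_choice hG).incl ≫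
      toricSpec.act K (chartMonoid (d.choice hG)).subtype =
      toricSpec.act K d.monoid.subtype ≫ toricSpec.map K (d.isAdmissible_choice hG).incl :=
    whiskerLeft_map_comp_act _ _ _ rfl
  have h3 := reassoc_of% h1
  have h4 := reassoc_of% h2
  rw [immersion, toChart, MonoidalCategory.whiskerLeft_comp, MonoidalCategory.whiskerLeft_comp,
    Category.assoc, Category.assoc, A.whiskerLeft_chart_comp_act]
  refine (congrArg (_ ≫ ·) (h4 (A.chart _))).trans ((h3 _).trans ?_)
  simp only [Category.assoc]

/-- To two points of the torus of the orbit, this morphism assigns a group element that transports the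
first one to the second one, together with the first point. -/
def shear (K : Type u) [Field K] : toricSpec K d.Lattice ⊗ toricSpec K d.Lattice ⟶
    torus K E ⊗ toricSpec K d.Lattice :=
  CartesianMonoidalCategory.lift
    (toricSpec.lift (N := charLattice E)
      { toFun m := char (snd (toricSpec K d.Lattice) (toricSpec K d.Lattice)) (d.retract m.toAdd) *
          char (fst (toricSpec K d.Lattice) (toricSpec K d.Lattice)) (-d.retract m.toAdd)
        map_one' := by simp
        map_mul' m m' := by
          simp only [toAdd_mul, map_add, neg_add, char_add]
          ring }) (fst _ _)

lemma shear_snd : d.shear K ≫ snd _ _ = fst _ _ := lift_snd _ _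

lemma shear_comp_act : d.shear K ≫ toricSpec.act K d.toLattice = snd _ _ := by
  refine toricSpec.hom_ext fun q => ?_
  have h (m : charLattice E) : char (d.shear K ≫ fst _ _) m =
      char (snd (toricSpec K d.Lattice) (toricSpec K d.Lattice)) (d.retract m) *
          char (fst (toricSpec K d.Lattice) (toricSpec K d.Lattice)) (-d.retract m) := by
    rw [shear, lift_fst, char_lift]
    rfl
  rw [char_comp_act, shear_snd, h, retract_toLattice, mul_assoc, ← char_add, neg_add_cancel,
    char_zero, mul_one]

end OrbitDatum

/-- The torus does not change the set of non-vanishing coordinates. -/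
lemma Atlas.nz_act {K E : Type u} [Field K] {G : Set (Set E)}
    {X : Over (Spec (CommRingCat.of K))} (A : Atlas G X) (S : G) (z : (torus K E ⊗ X).left) :
    A.nz S (A.act.left z) = A.nz S ((snd (torus K E) X).left z) := by
  obtain ⟨c, z, rfl⟩ := A.covers_whiskerLeft (torus K E) z
  have h1 : A.act.left ((torus K E ◁ A.chart c).left z) =
      (A.chart c).left ((toricSpec.act K (chartMonoid c).subtype).left z) :=
    congrArg (fun φ : torus K E ⊗ toricSpec K (chartMonoid c) ⟶ X => φ.left z)
      (A.whiskerLeft_chart_comp_act c)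
  have h2 : (snd (torus K E) X).left ((torus K E ◁ A.chart c).left z) =
      (A.chart c).left ((snd (torus K E) (toricSpec K (chartMonoid c))).left z) :=
    congrArg (fun φ : torus K E ⊗ toricSpec K (chartMonoid c) ⟶ X => φ.left z)
      (whiskerLeft_snd (torus K E) (A.chart c))
  rw [h1, h2]
  ext a
  by_cases ha : a ∈ (S : Set E)
  · rw [A.mem_nz_chart_iff c _ S ⟨a, ha⟩, A.mem_nz_chart_iff c _ S ⟨a, ha⟩,
      nonzeroAt_iff_mem_basicOpen, nonzeroAt_iff_mem_basicOpen, char_act, Scheme.basicOpen_mul,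
      Scheme.basicOpen_of_isUnit _ (isUnit_char_of_group _ _), top_inf_eq]
  · exact ⟨fun h => absurd (A.nz_subset _ _ h) ha, fun h => absurd (A.nz_subset _ _ h) ha⟩

namespace OrbitDatum

variable {K E : Type u} [Field K] {G : Set (Set E)} (d : OrbitDatum G)
  {X : Over (Spec (CommRingCat.of K))} (A : Atlas G X) [Finite E]

/-- The orbit of a point is the set of all points with the same non-vanishing coordinates. -/
lemma image_act_eq (hG : ∅ ∉ G) {x : X.left} (hx : x ∈ d.orbit A) :
    A.act.left '' ((snd (torus K E) X).left ⁻¹' {x}) = d.orbit A := by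
  apply subset_antisymm
  · rintro _ ⟨z, rfl, rfl⟩ i
    rw [A.nz_act, hx i]
  · intro y hy
    rw [← d.range_immersion A hG] at hx hy
    obtain ⟨x, rfl⟩ := hx
    obtain ⟨y, rfl⟩ := hy
    obtain ⟨w, hw1, hw2⟩ := Scheme.Pullback.exists_preimage_pullback
      (f := (toricSpec K d.Lattice).hom) (g := (toricSpec K d.Lattice).hom) x y
      (Subsingleton.elim (α := PrimeSpectrum K) _ _)
    refine ⟨(torus K E ◁ d.immersion A hG).left ((d.shear K).left w), ?_, ?_⟩
    · have h1 : (d.shear K ≫ torus K E ◁ d.immersion A hG) ≫ snd _ _ =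
          fst _ _ ≫ d.immersion A hG := by
        rw [Category.assoc, whiskerLeft_snd, ← Category.assoc, shear_snd]
      have h2 := congrArg (fun φ : toricSpec K d.Lattice ⊗ toricSpec K d.Lattice ⟶ X => φ.left w) h1
      refine Eq.trans h2 ?_
      exact congrArg (d.immersion A hG).left hw1
    · have h1 : (d.shear K ≫ torus K E ◁ d.immersion A hG) ≫ A.act =
          snd _ _ ≫ d.immersion A hG := by
        rw [Category.assoc, whiskerLeft_immersion_comp_act, ← Category.assoc, shear_comp_act]
      have h2 := congrArg (fun φ : toricSpec K d.Lattice ⊗ toricSpec K d.Lattice ⟶ X => φ.left w) h1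
      refine Eq.trans h2 ?_
      exact congrArg (d.immersion A hG).left hw2

lemma orbit_nonempty (hG : ∅ ∉ G) : (d.orbit A).Nonempty := by
  rw [← d.range_immersion A hG]
  exact Set.range_nonempty _

end OrbitDatum

end

noncomputable section

open charLattice toricSpec

/-! ### Coordinate projections -/

lemma PSpace.ofCoords_congr {K A R : Type u} [Field K] [CommRing R] [Algebra K R] {w w' : A → R}
    (e : w = w') (h : ∃ a, IsUnit (w a)) (h' : ∃ a, IsUnit (w' a)) :
    ofCoords (K := K) w h = ofCoords w' h' := by
  subst e
  rfl

lemma isUnit_single_chartGen_self (K : Type u) [Field K] {E : Type u} {G : Set (Set E)} (c : Sel G)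
    (S : G) :
    IsUnit (AddMonoidAlgebra.single (chartGen c S (c S)) 1 : AddMonoidAlgebra K (chartMonoid c)) := by
  rw [Atlas.chartGen_self, ← AddMonoidAlgebra.one_def]
  exact isUnit_one

namespace Atlas

variable {K E : Type u} [Field K] {G : Set (Set E)} {X : Over (Spec (CommRingCat.of K))}

/-- The morphism from a chart to the projective space with coordinates in a member of `G`. -/
def chartToPSpace (K : Type u) [Field K] (c : Sel G) (S : G) :
    toricSpec K (chartMonoid c) ⟶ Over.mk (PSpace.toSpec K (S : Set E)) :=
  Over.homMk (PSpace.ofCoords (fun a => AddMonoidAlgebra.single (chartGen c S a) 1)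
    ⟨c S, isUnit_single_chartGen_self K c S⟩) (PSpace.ofCoords_toSpec _ _)

/-- The inclusion of the torus in projective space. -/
def torusToPSpace (K : Type u) [Field K] {A : Type u} (e₀ : A) :
    torus K A ⟶ Over.mk (PSpace.toSpec K A) :=
  Over.homMk (torus.toPSpace K (Function.Embedding.refl A) e₀) (PSpace.ofCoords_toSpec _ _)

lemma map_subtype_comp_chartToPSpace (c : Sel G) (S : G) (e₀ : (S : Set E)) :
    toricSpec.map K (chartMonoid c).subtype ≫ chartToPSpace K c S =
      torus.proj K (fun e : (S : Set E) => (e : E)) ≫ torusToPSpace K (A := (S : Set E)) e₀ := by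
  apply Over.OverMorphism.ext
  change Spec.map (CommRingCat.ofHom (AddMonoidAlgebra.mapDomainAlgHom K K
      (chartMonoid c).subtype).toRingHom) ≫
      PSpace.ofCoords _ ⟨c S, isUnit_single_chartGen_self K c S⟩ =
    Spec.map (CommRingCat.ofHom (AddMonoidAlgebra.mapDomainAlgHom K K
      (charLattice.map (fun e : (S : Set E) => (e : E)))).toRingHom) ≫ torus.toPSpace K _ e₀
  rw [torus.toPSpace_eq _ e₀ (c S), torus.toPSpace]
  refine (PSpace.Spec_map_ofCoords _ _ _
    ⟨c S, (isUnit_single_chartGen_self K c S).map _⟩).trans (Eq.trans ?_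
    (PSpace.Spec_map_ofCoords _ _ _ ⟨c S, (torus.isUnit_coords (Function.Embedding.refl
      (S : Set E)) (c S) (c S)).map _⟩).symm)
  refine PSpace.ofCoords_congr (funext fun a => ?_) _ _
  have h := torus.coords_apply (K := K) (Function.Embedding.refl (S : Set E)) (c S) a
  refine Eq.trans ?_ (congrArg _ h).symm
  refine (AddMonoidAlgebra.mapDomain_single ..).trans
    (Eq.trans ?_ (AddMonoidAlgebra.mapDomain_single ..).symm)
  rw [map_ratio]
  rfl

instance isSeparated_toSpec (B : Type u) : IsSeparated (Over.mk (PSpace.toSpec K B)).hom := by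
  change IsSeparated (PSpace.toSpec K B)
  rw [PSpace.toSpec]
  infer_instance

variable (A : Atlas G X) (hG : ∅ ∉ G)

include hG in
lemma exists_projection (S : G) : ∃ q : X ⟶ Over.mk (PSpace.toSpec K (S : Set E)),
    ∀ c, A.chart c ≫ q = chartToPSpace K c S := by
  obtain ⟨e₀, he₀⟩ := Set.nonempty_iff_ne_empty.2 fun h : (S : Set E) = ∅ => hG (h ▸ S.2)
  exact A.exists_glue _ _ fun c => map_subtype_comp_chartToPSpace c S ⟨e₀, he₀⟩

/-- The coordinate projection to the projective space with coordinates in a member of `G`. -/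
def projection (S : G) : X ⟶ Over.mk (PSpace.toSpec K (S : Set E)) :=
  (A.exists_projection hG S).choose

lemma chart_comp_projection (c : Sel G) (S : G) :
    A.chart c ≫ A.projection hG S = chartToPSpace K c S := (A.exists_projection hG S).choose_spec c

lemma incl_comp_projection (S : G) (hne : Nonempty (Sel G)) (e₀ : (S : Set E)) :
    A.incl ≫ A.projection hG S =
      torus.proj K (fun e : (S : Set E) => (e : E)) ≫ torusToPSpace K (A := (S : Set E)) e₀ := by
  obtain ⟨c⟩ := hne
  rw [← A.map_chart c, Category.assoc, A.chart_comp_projection, map_subtype_comp_chartToPSpace]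

end Atlas

namespace OrbitDatum

variable {K E : Type u} [Field K] {G : Set (Set E)} (d : OrbitDatum G)
  {X : Over (Spec (CommRingCat.of K))} (A : Atlas G X) [Finite E]

lemma face_toFun_ratio (i : Fin (d.p + 1)) (a b : d.piece i) :
    d.face.toFun ⟨_, d.ratio_mem_monoid i (d.edge_mem i a) b⟩ = Pi.single i (ratio a b) := by
  rw [← d.face_toFun_split (Pi.single i (ratio a b))]
  exact congrArg d.face.toFun (Subtype.ext (d.toLattice_single i a b).symm)

/-- On the torus of an orbit, the projection to a member of the flag is the projection to a factor. -/
lemma immersion_comp_projection (hG : ∅ ∉ G) (i : Fin (d.p + 1))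
    (φ : d.piece i ↪ (d.set i : Set E)) (hφ : ∀ e, (φ e : E) = d.edge i e) (e₀ : d.piece i) :
    (d.immersion A hG).left ≫ (A.projection hG (d.set i)).left =
      (toricSpec.map K (AddMonoidHom.single (fun i => charLattice (d.piece i)) i)).left ≫
        torus.toPSpace K φ e₀ := by
  have hc := d.isAdmissible_choice hG
  obtain ⟨e₁, he₁⟩ := hc.exists_edge_eq i
  let w (a : (d.set i : Set E)) : AddMonoidAlgebra K (chartMonoid (d.choice hG)) :=
    AddMonoidAlgebra.single (chartGen (d.choice hG) (d.set i) a) 1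
  have hu : ∃ a, IsUnit (w a) := ⟨_, isUnit_single_chartGen_self K (d.choice hG) (d.set i)⟩
  have hu1 : ∃ a, IsUnit (AddMonoidAlgebra.mapDomainAlgHom K K hc.incl (w a)) :=
    hu.imp fun a h => h.map _
  have hu2 : ∃ a, IsUnit (d.face.ringHom K (AddMonoidAlgebra.mapDomainAlgHom K K hc.incl (w a))) :=
    hu1.imp fun a h => h.map _
  have h1 : d.immersion A hG ≫ A.projection hG (d.set i) =
      d.toChart hG K ≫ Atlas.chartToPSpace K (d.choice hG) (d.set i) := by
    rw [immersion, Category.assoc, A.chart_comp_projection hG]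
  refine (congrArg (fun φ : toricSpec K d.Lattice ⟶ Over.mk (PSpace.toSpec K (d.set i : Set E)) =>
    φ.left) h1).trans ?_
  change (Spec.map (CommRingCat.ofHom (d.face.ringHom K).toRingHom) ≫
    Spec.map (CommRingCat.ofHom (AddMonoidAlgebra.mapDomainAlgHom K K hc.incl).toRingHom)) ≫
      PSpace.ofCoords w hu =
    Spec.map (CommRingCat.ofHom (AddMonoidAlgebra.mapDomainAlgHom K K
      (AddMonoidHom.single (fun i => charLattice (d.piece i)) i)).toRingHom) ≫ torus.toPSpace K φ e₀
  rw [torus.toPSpace_eq _ e₀ e₁, torus.toPSpace, Category.assoc]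
  refine (congrArg (_ ≫ ·) (PSpace.Spec_map_ofCoords _ w hu hu1)).trans ?_
  refine (PSpace.Spec_map_ofCoords _ _ hu1 hu2).trans (Eq.trans ?_
    (PSpace.Spec_map_ofCoords _ _ _ ⟨φ e₁, (torus.isUnit_coords φ e₁ e₁).map _⟩).symm)
  refine PSpace.ofCoords_congr (funext fun a => ?_) _ _
  have h2 : AddMonoidAlgebra.mapDomainAlgHom K K hc.incl
      (AddMonoidAlgebra.single (chartGen (d.choice hG) (d.set i) a) 1) =
      AddMonoidAlgebra.single ⟨_, d.ratio_mem_monoid i a.2 e₁⟩ 1 := by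
    refine (AddMonoidAlgebra.mapDomain_single ..).trans ?_
    congr 1
    apply Subtype.ext
    change ratio (a : E) (d.choice hG (d.set i) : E) = _
    rw [← he₁]
  refine (congrArg (d.face.ringHom K) h2).trans ?_
  by_cases ha : a ∈ Set.range φ
  · obtain ⟨e, rfl⟩ := ha
    refine Eq.trans ?_ (congrArg _ (torus.coords_apply φ e₁ e)).symm
    refine Eq.trans ?_ (AddMonoidAlgebra.mapDomain_single ..).symm
    have h3 : (⟨_, d.ratio_mem_monoid i (φ e).2 e₁⟩ : d.monoid) =
        ⟨_, d.ratio_mem_monoid i (d.edge_mem i e) e₁⟩ := 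
      Subtype.ext (congrArg (fun a => ratio a (d.edge i e₁)) (hφ e))
    rw [h3, Face.ringHom_of_mem _ ((d.face_mem_ratio_iff (d.edge_mem i e) e₁).2 ⟨e, rfl⟩), face_toFun_ratio]
    rfl
  · refine Eq.trans ?_ ((congrArg _ (torus.coords_of_notMem φ e₁ ha)).trans (map_zero _)).symm
    refine Face.ringHom_of_notMem _ (fun h => ha ?_) 1
    obtain ⟨e, he⟩ := (d.face_mem_ratio_iff a.2 e₁).1 h
    exact ⟨e, Subtype.ext ((hφ e).trans he)⟩

end OrbitDatum

end

noncomputable section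

open charLattice toricSpec

/-! ### Every point lies in one orbit -/

lemma IsUnionClosed.sUnion_mem {E : Type u} [Finite E] {G : Set (Set E)} (hG : IsUnionClosed G)
    {𝒯 : Set (Set E)} (h : 𝒯 ⊆ G) (hne : 𝒯.Nonempty) : ⋃₀ 𝒯 ∈ G := by
  have hfin : 𝒯.Finite := Set.toFinite 𝒯
  induction 𝒯, hfin using Set.Finite.induction_on with
  | empty => exact absurd hne Set.not_nonempty_empty
  | @insert T 𝒯 _ _ ih =>
    rw [Set.sUnion_insert]
    rcases 𝒯.eq_empty_or_nonempty with rfl | hne'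
    · rw [Set.sUnion_empty, Set.union_empty]
      exact h (Set.mem_insert _ _)
    · exact hG.union_mem _ (h (Set.mem_insert _ _)) _ (ih ((Set.subset_insert _ _).trans h) hne')

namespace Atlas

variable {K E : Type u} [Field K] {G : Set (Set E)} {X : Over (Spec (CommRingCat.of K))}
  (A : Atlas G X)

/-- The union of the members of `G` in `S` on which all coordinates relative to `S` vanish at `x`. -/
def next (x : X.left) (S : Set E) : Set E :=
  ⋃₀ {T | T ∈ G ∧ T ⊆ S ∧ ∀ h : S ∈ G, Disjoint T (A.nz ⟨S, h⟩ x)}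

/-- The flag of a point: it is eventually empty. -/
def flagSeq (x : X.left) : ℕ → Set E
  | 0 => Set.univ
  | n + 1 => A.next x (flagSeq x n)

lemma next_subset (x : X.left) (S : Set E) : A.next x S ⊆ S :=
  Set.sUnion_subset fun _ h => h.2.1

lemma next_disjoint (x : X.left) (S : G) : Disjoint (A.next x S) (A.nz S x) :=
  Set.disjoint_sUnion_left.2 fun _ h => h.2.2 S.2

lemma next_ssubset (x : X.left) (S : G) : A.next x S ⊂ S := by
  refine (A.next_subset x S).ssubset_of_ne fun h => ?_
  obtain ⟨a, ha⟩ := A.nz_nonempty S x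
  have h1 := A.next_disjoint x S
  rw [h] at h1
  exact Set.disjoint_left.1 h1 (A.nz_subset S x ha) ha

variable {A} in
lemma _root_.OrbitDatum.flag_succ (d : OrbitDatum G) {x : X.left} (hx : x ∈ d.orbit A)
    (i : Fin (d.p + 1)) : d.flag i.succ = A.next x (d.flag i.castSucc) := by
  apply subset_antisymm
  · rcases Fin.eq_castSucc_or_eq_last i.succ with ⟨j, hj⟩ | hj
    · refine Set.subset_sUnion_of_mem ⟨hj ▸ d.mem j,
        d.strictAnti.antitone Fin.castSucc_lt_succ.le, fun _ => ?_⟩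
      rw [Set.disjoint_right]
      intro a ha
      rw [show A.nz ⟨_, _⟩ x = _ from hx i] at ha
      obtain ⟨e, rfl⟩ := ha
      exact d.edge_notMem i e
    · rw [hj, d.flag_last]
      exact Set.empty_subset _
  · refine Set.sUnion_subset fun T hT => ?_
    by_contra h
    obtain ⟨e, he⟩ := d.meets T hT.1 i hT.2.1 h
    refine Set.disjoint_left.1 (hT.2.2 (d.mem i)) he ?_
    rw [show A.nz ⟨_, _⟩ x = _ from hx i]
    exact ⟨e, rfl⟩

variable {A} in
/-- The flag of an orbit datum is determined by any point of the orbit. -/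
lemma _root_.OrbitDatum.flag_eq (d : OrbitDatum G) {x : X.left} (hx : x ∈ d.orbit A)
    (i : Fin (d.p + 2)) : d.flag i = A.flagSeq x i := by
  induction i using Fin.induction with
  | zero => exact d.flag_zero
  | succ i ih =>
    rw [d.flag_succ hx, ih]
    rfl

variable {A} in
lemma _root_.OrbitDatum.p_le (d d' : OrbitDatum G) {x : X.left} (hx : x ∈ d.orbit A)
    (hx' : x ∈ d'.orbit A) : d.p ≤ d'.p := by
  by_contra! h
  have h1 := d'.flag_eq hx' (Fin.last _)
  have h2 := d.flag_eq hx ⟨d'.p + 1, by omega⟩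
  have h3 := d.strictAnti (show (⟨d'.p + 1, by omega⟩ : Fin (d.p + 2)) < Fin.last _ from
    Nat.succ_lt_succ h)
  rw [h2, ← show A.flagSeq x (Fin.last (d'.p + 1)) = A.flagSeq x (d'.p + 1) from rfl, ← h1,
    d'.flag_last] at h3
  exact h3.not_ge (Set.empty_subset _)

/-- Every point lies in the orbit of the datum that is given by its flag and by the non-vanishing
coordinates. -/
lemma exists_orbitDatum [Finite E] [Nonempty E] (hG : IsUnionClosed G) (x : X.left) :
    ∃ d : OrbitDatum G, x ∈ d.orbit A := by
  classical
  have hmem (n : ℕ) : A.flagSeq x n ∈ G ∨ A.flagSeq x n = ∅ := by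
    cases n with
    | zero => exact Or.inl hG.univ_mem
    | succ n =>
      rcases Set.eq_empty_or_nonempty {T | T ∈ G ∧ T ⊆ A.flagSeq x n ∧
        ∀ h : A.flagSeq x n ∈ G, Disjoint T (A.nz ⟨_, h⟩ x)} with h | h
      · right
        rw [flagSeq, next, h, Set.sUnion_empty]
      · exact Or.inl (hG.sUnion_mem (fun T hT => hT.1) h)
  have hex : ∃ n, A.flagSeq x n = ∅ := by
    by_contra! h
    have hanti : StrictAnti (A.flagSeq x) := strictAnti_nat_of_succ_lt fun n =>
      A.next_ssubset x ⟨_, (hmem n).resolve_right (h n).ne_empty⟩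
    exact not_injective_infinite_finite _ hanti.injective
  obtain ⟨p, hp⟩ : ∃ p, Nat.find hex = p + 1 := by
    refine Nat.exists_eq_succ_of_ne_zero fun h => ?_
    have := Nat.find_spec hex
    rw [h] at this
    exact (Set.univ_nonempty (α := E)).ne_empty this
  have hflag (i : Fin (p + 1)) : A.flagSeq x i ∈ G :=
    (hmem i).resolve_right (Nat.find_min hex (by omega))
  refine ⟨
    { p := p
      flag := fun i => A.flagSeq x i
      flag_zero := rfl
      flag_last := by
        have := Nat.find_spec hex
        rwa [hp] at this
      strictAnti := Fin.strictAnti_iff_succ_lt.2 fun i => A.next_ssubset x ⟨_, hflag i⟩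
      mem := hflag
      piece := fun i => A.nz ⟨_, hflag i⟩ x
      edge := fun i => Function.Embedding.subtype _
      edge_mem := fun i e => A.nz_subset _ x e.2
      edge_notMem := fun i e h => Set.disjoint_left.1 (A.next_disjoint x ⟨_, hflag i⟩) h e.2
      meets := fun T hT i h1 h2 => ?_ }, fun i => Subtype.range_coe.symm⟩
  by_contra! h
  refine h2 (Set.subset_sUnion_of_mem ⟨hT, h1, fun h3 => ?_⟩)
  exact Set.disjoint_left.2 fun a ha ha' => h ⟨a, ha'⟩ ha

end Atlas

end

noncomputable section

/-! ### Cycles in graphs -/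

lemma Finsupp.mapDomain_filter_comp {α β M : Type*} [AddCommMonoid M] (f : α → β) (p : β → Prop)
    [DecidablePred p] (x : α →₀ M) :
    Finsupp.mapDomain f (x.filter fun a => p (f a)) = (Finsupp.mapDomain f x).filter p := by
  induction x using Finsupp.induction_linear with
  | zero => rw [Finsupp.mapDomain_zero, Finsupp.filter_zero, Finsupp.filter_zero,
      Finsupp.mapDomain_zero]
  | add x y hx hy =>
    rw [Finsupp.filter_add, Finsupp.mapDomain_add, Finsupp.mapDomain_add, Finsupp.filter_add, hx, hy]
  | single a r =>
    rw [Finsupp.mapDomain_single]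
    by_cases hp : p (f a)
    · rw [Finsupp.filter_single_of_pos (fun a => p (f a)) hp, Finsupp.filter_single_of_pos p hp,
        Finsupp.mapDomain_single]
    · rw [Finsupp.filter_single_of_neg (fun a => p (f a)) hp, Finsupp.filter_single_of_neg p hp,
        Finsupp.mapDomain_zero]

lemma Finsupp.mapDomain_val_eq_zero_iff {α M : Type*} [AddCommMonoid M] {p : α → Prop}
    (y : {a // p a} →₀ M) : Finsupp.mapDomain Subtype.val y = 0 ↔ y = 0 :=
  ⟨fun h => Finsupp.mapDomain_injective Subtype.val_injective (h.trans Finsupp.mapDomain_zero.symm),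
    fun h => h ▸ Finsupp.mapDomain_zero⟩

namespace HEGraph

variable (Γ : HEGraph.{u})

lemma boundary_eq : Γ.boundary = Finsupp.lmapDomain ℚ ℚ (Sum.inr ∘ Γ.pE) -
    Finsupp.lmapDomain ℚ ℚ (Sum.inl ∘ Γ.pV) := by
  refine Finsupp.lhom_ext fun h r => ?_
  rw [boundary, Finsupp.linearCombination_single, LinearMap.sub_apply, Finsupp.lmapDomain_apply,
    Finsupp.lmapDomain_apply, Finsupp.mapDomain_single, Finsupp.mapDomain_single, smul_sub,
    Finsupp.smul_single_one, Finsupp.smul_single_one]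
  rfl

/-- A chain is a cycle if the coefficients over every edge and those over every vertex have sum
zero. -/
lemma mem_ker_boundary {x : Γ.HE →₀ ℚ} : x ∈ LinearMap.ker Γ.boundary ↔
    Finsupp.mapDomain Γ.pE x = 0 ∧ Finsupp.mapDomain Γ.pV x = 0 := by
  rw [LinearMap.mem_ker, boundary_eq, LinearMap.sub_apply, Finsupp.lmapDomain_apply,
    Finsupp.lmapDomain_apply, Finsupp.mapDomain_comp, Finsupp.mapDomain_comp]
  constructor
  · intro h
    constructor
    · ext e
      have := DFunLike.congr_fun h (Sum.inr e)
      rwa [Finsupp.sub_apply, Finsupp.mapDomain_apply Sum.inr_injective,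
        Finsupp.mapDomain_of_notMem_range (f := Sum.inl) _ _ (fun ⟨_, hv⟩ => Sum.inl_ne_inr hv),
        sub_zero] at this
    · ext v
      have := DFunLike.congr_fun h (Sum.inl v)
      rwa [Finsupp.sub_apply, Finsupp.mapDomain_apply Sum.inl_injective,
        Finsupp.mapDomain_of_notMem_range (f := Sum.inr) _ _ (fun ⟨_, hv⟩ => Sum.inr_ne_inl hv), zero_sub,
        Finsupp.zero_apply, neg_eq_zero] at this
  · rintro ⟨h1, h2⟩
    rw [h1, h2, Finsupp.mapDomain_zero, Finsupp.mapDomain_zero, sub_zero]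

variable {Γ} in
lemma mapDomain_val_mem_ker {A : Set Γ.E} (x : (Γ.sub A).HE →₀ ℚ) :
    Finsupp.mapDomain Subtype.val x ∈ LinearMap.ker Γ.boundary ↔
      x ∈ LinearMap.ker (Γ.sub A).boundary := by
  rw [mem_ker_boundary, mem_ker_boundary, ← Finsupp.mapDomain_comp, ← Finsupp.mapDomain_comp]
  have h1 : Γ.pE ∘ (Subtype.val : (Γ.sub A).HE → Γ.HE) = Subtype.val ∘ (Γ.sub A).pE := rfl
  have h2 : Γ.pV ∘ (Subtype.val : (Γ.sub A).HE → Γ.HE) = Subtype.val ∘ (Γ.sub A).pV := rfl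
  rw [h1, h2, Finsupp.mapDomain_comp, Finsupp.mapDomain_comp]
  rw [Finsupp.mapDomain_val_eq_zero_iff, Finsupp.mapDomain_val_eq_zero_iff]

lemma exists_eq_mapDomain_val {A : Set Γ.E} {x : Γ.HE →₀ ℚ} (hx : ∀ h, x h ≠ 0 → Γ.pE h ∈ A) :
    ∃ y : (Γ.sub A).HE →₀ ℚ, Finsupp.mapDomain Subtype.val y = x := by
  refine ⟨x.comapDomain Subtype.val Subtype.val_injective.injOn,
    Finsupp.mapDomain_comapDomain _ Subtype.val_injective _ fun h hh => ?_⟩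
  exact ⟨⟨h, hx h (Finsupp.mem_support_iff.1 hh)⟩, rfl⟩

/-- The edge `e` lies on a cycle in `A`. -/
def OnCycle (A : Set Γ.E) (e : Γ.E) : Prop :=
  ∃ x ∈ LinearMap.ker Γ.boundary, (∀ h, x h ≠ 0 → Γ.pE h ∈ A) ∧ ∃ h, Γ.pE h = e ∧ x h ≠ 0

variable {Γ} in
lemma OnCycle.mono {A B : Set Γ.E} (hAB : A ⊆ B) {e : Γ.E} (h : Γ.OnCycle A e) : Γ.OnCycle B e := by
  obtain ⟨x, h1, h2, h3⟩ := h
  exact ⟨x, h1, fun h hh => hAB (h2 h hh), h3⟩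

lemma h1_sub (A : Set Γ.E) : (Γ.sub A).h1 = Module.finrank ℚ
    ((LinearMap.ker (Γ.sub A).boundary).map (Finsupp.lmapDomain ℚ ℚ Subtype.val)) :=
  (LinearEquiv.finrank_eq (Submodule.equivMapOfInjective _
    (Finsupp.mapDomain_injective Subtype.val_injective) _))

/-- A graph is core if and only if every edge lies on a cycle. -/
lemma isCore_iff : Γ.IsCore ↔ ∀ e, Γ.OnCycle Set.univ e := by
  have := Γ.finite_HE
  refine forall_congr' fun e => ?_
  have hle : (LinearMap.ker (Γ.sub {e}ᶜ).boundary).map (Finsupp.lmapDomain ℚ ℚ Subtype.val) ≤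
      LinearMap.ker Γ.boundary := by
    rintro _ ⟨x, hx, rfl⟩
    exact (mapDomain_val_mem_ker x).2 hx
  rw [h1_sub, h1]
  constructor
  · intro h
    by_contra h'
    refine h.ne (congrArg (fun W : Submodule ℚ (Γ.HE →₀ ℚ) => Module.finrank ℚ W)
      (le_antisymm hle fun x hx => ?_))
    have h1 : ∀ h, x h ≠ 0 → Γ.pE h ∈ ({e}ᶜ : Set Γ.E) :=
      fun h hh he => h' ⟨x, hx, fun _ _ => trivial, h, he, hh⟩
    obtain ⟨y, rfl⟩ := Γ.exists_eq_mapDomain_val h1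
    exact ⟨y, (mapDomain_val_mem_ker y).1 hx, rfl⟩
  · rintro ⟨x, hx, -, h, he, hh⟩
    refine Submodule.finrank_lt_finrank_of_lt (lt_of_le_of_ne hle fun heq => ?_)
    rw [← heq] at hx
    obtain ⟨y, -, rfl⟩ := hx
    refine hh (Finsupp.mapDomain_of_notMem_range _ _ ?_)
    rintro ⟨h', rfl⟩
    exact h'.2 he

lemma isCore_sub_iff (A : Set Γ.E) : (Γ.sub A).IsCore ↔ ∀ e ∈ A, Γ.OnCycle A e := by
  rw [isCore_iff]
  constructor
  · intro h e he
    obtain ⟨x, hx, -, h', he', hh⟩ := h ⟨e, he⟩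
    refine ⟨_, (mapDomain_val_mem_ker x).2 hx, fun h0 hh0 => ?_, h'.1, congrArg Subtype.val he', ?_⟩
    · by_contra h1
      refine hh0 (Finsupp.mapDomain_of_notMem_range _ _ ?_)
      rintro ⟨h2, rfl⟩
      exact h1 h2.2
    · rwa [Finsupp.mapDomain_apply Subtype.val_injective]
  · rintro h ⟨e, he⟩
    obtain ⟨x, hx, hA, h', rfl, hh⟩ := h e he
    obtain ⟨y, rfl⟩ := Γ.exists_eq_mapDomain_val hA
    exact ⟨y, (mapDomain_val_mem_ker y).1 hx, fun _ _ => trivial, ⟨h', he⟩, rfl,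
      by rwa [← Finsupp.mapDomain_apply Subtype.val_injective y ⟨h', he⟩]⟩

lemma isForest_iff : Γ.IsForest ↔ ∀ x ∈ LinearMap.ker Γ.boundary, x = 0 := by
  have := Γ.finite_HE
  rw [IsForest, h1, Submodule.finrank_eq_zero, Submodule.eq_bot_iff]

lemma isForest_sub_iff (A : Set Γ.E) : (Γ.sub A).IsForest ↔
    ∀ x ∈ LinearMap.ker Γ.boundary, (∀ h, x h ≠ 0 → Γ.pE h ∈ A) → x = 0 := by
  rw [isForest_iff]
  constructor
  · intro h x hx hA
    obtain ⟨y, rfl⟩ := Γ.exists_eq_mapDomain_val hA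
    rw [h y ((mapDomain_val_mem_ker y).1 hx), Finsupp.mapDomain_zero]
  · intro h x hx
    refine Finsupp.mapDomain_injective Subtype.val_injective
      ((h _ ((mapDomain_val_mem_ker x).2 hx) fun h0 hh0 => ?_).trans Finsupp.mapDomain_zero.symm)
    by_contra h1
    refine hh0 (Finsupp.mapDomain_of_notMem_range _ _ ?_)
    rintro ⟨h2, rfl⟩
    exact h1 h2.2

/-! ### Cycles in contractions -/

/-- Two vertices with the same image in the contraction differ by the boundary of a path in `A`. -/
lemma exists_path (A : Set Γ.E) {v w : Γ.V}
    (h : (Quot.mk (Γ.Linked A) v) = Quot.mk (Γ.Linked A) w) : ∃ a : Γ.HE →₀ ℚ,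
      (∀ h, a h ≠ 0 → Γ.pE h ∈ A) ∧ Finsupp.mapDomain Γ.pE a = 0 ∧
        Finsupp.mapDomain Γ.pV a = Finsupp.single v 1 - Finsupp.single w 1 := by
  classical
  have h' := Quot.eqvGen_exact h
  induction h' with
  | rel v w hvw =>
    obtain ⟨h1, h2, hA, h12, rfl, rfl⟩ := hvw
    refine ⟨Finsupp.single h1 1 - Finsupp.single h2 1, fun h hh => ?_, ?_, ?_⟩
    · by_cases hh1 : h1 = h
      · exact hh1 ▸ hA
      by_cases hh2 : h2 = h
      · exact hh2 ▸ h12 ▸ hA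
      · rw [Finsupp.sub_apply, Finsupp.single_eq_of_ne (Ne.symm hh1),
          Finsupp.single_eq_of_ne (Ne.symm hh2), sub_zero] at hh
        exact absurd rfl hh
    · rw [Finsupp.mapDomain_sub, Finsupp.mapDomain_single, Finsupp.mapDomain_single, h12, sub_self]
    · rw [Finsupp.mapDomain_sub, Finsupp.mapDomain_single, Finsupp.mapDomain_single]
  | refl v => exact ⟨0, fun h hh => absurd rfl hh, Finsupp.mapDomain_zero,
      by rw [Finsupp.mapDomain_zero, sub_self]⟩
  | symm v w _ ih =>
    obtain ⟨a, h1, h2, h3⟩ := ih h.symm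
    refine ⟨-a, fun h hh => h1 h (by simpa using hh), ?_, ?_⟩
    · rw [← zero_sub, Finsupp.mapDomain_sub, h2, Finsupp.mapDomain_zero, sub_zero]
    · rw [← zero_sub, Finsupp.mapDomain_sub, h3, Finsupp.mapDomain_zero, zero_sub, neg_sub]
  | trans u v w huv hvw ih ih' =>
    obtain ⟨a, h1, h2, h3⟩ := ih (Quot.eqvGen_sound huv)
    obtain ⟨b, h4, h5, h6⟩ := ih' (Quot.eqvGen_sound hvw)
    refine ⟨a + b, fun h hh => ?_, ?_, ?_⟩
    · by_contra hA
      have ha : a h = 0 := by_contra fun h0 => hA (h1 h h0)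
      have hb : b h = 0 := by_contra fun h0 => hA (h4 h h0)
      exact hh (by rw [Finsupp.add_apply, ha, hb, add_zero])
    · rw [Finsupp.mapDomain_add, h2, h5, add_zero]
    · rw [Finsupp.mapDomain_add, h3, h6, sub_add_sub_cancel]

/-- A chain of vertices that vanishes in the contraction is the boundary of a chain in `A`. -/
lemma exists_boundary (A : Set Γ.E) (g : Γ.V →₀ ℚ)
    (hg : Finsupp.mapDomain (Quot.mk (Γ.Linked A)) g = 0) : ∃ a : Γ.HE →₀ ℚ,
      (∀ h, a h ≠ 0 → Γ.pE h ∈ A) ∧ Finsupp.mapDomain Γ.pE a = 0 ∧ Finsupp.mapDomain Γ.pV a = g := by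
  let W : Submodule ℚ (Γ.V →₀ ℚ) := (Finsupp.supported ℚ ℚ (Γ.pE ⁻¹' A) ⊓
    LinearMap.ker (Finsupp.lmapDomain ℚ ℚ Γ.pE)).map (Finsupp.lmapDomain ℚ ℚ Γ.pV)
  have h1 (g : Γ.V →₀ ℚ) :
      g - Finsupp.mapDomain Quot.out (Finsupp.mapDomain (Quot.mk (Γ.Linked A)) g) ∈ W := by
    induction g using Finsupp.induction_linear with
    | zero => simp
    | add f g hf hg =>
      rw [Finsupp.mapDomain_add, Finsupp.mapDomain_add, add_sub_add_comm]
      exact add_mem hf hg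
    | single v r =>
      rw [Finsupp.mapDomain_single, Finsupp.mapDomain_single, ← Finsupp.smul_single_one v,
        ← Finsupp.smul_single_one _ r, ← smul_sub]
      refine W.smul_mem r ?_
      obtain ⟨a, ha, hE, hV⟩ := Γ.exists_path A (Quot.out_eq (Quot.mk (Γ.Linked A) v)).symm
      exact ⟨a, ⟨fun h hh => ha h (Finsupp.mem_support_iff.1 hh), hE⟩, hV⟩
  have h2 := h1 g
  rw [hg, Finsupp.mapDomain_zero, sub_zero] at h2
  obtain ⟨a, ⟨ha, hE⟩, hV⟩ := h2
  exact ⟨a, fun h hh => ha (Finsupp.mem_support_iff.2 hh), hE, hV⟩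

lemma mapDomain_val_mem_ker_contract {A : Set Γ.E} (x : (Γ.contract A).HE →₀ ℚ) :
    x ∈ LinearMap.ker (Γ.contract A).boundary ↔
      Finsupp.mapDomain Γ.pE (Finsupp.mapDomain Subtype.val x) = 0 ∧
        Finsupp.mapDomain (Quot.mk (Γ.Linked A))
          (Finsupp.mapDomain Γ.pV (Finsupp.mapDomain Subtype.val x)) = 0 := by
  rw [mem_ker_boundary, ← Finsupp.mapDomain_comp, ← Finsupp.mapDomain_comp, ← Finsupp.mapDomain_comp]
  have h1 : Γ.pE ∘ (Subtype.val : (Γ.contract A).HE → Γ.HE) = Subtype.val ∘ (Γ.contract A).pE := rfl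
  have h2 : (Quot.mk (Γ.Linked A) ∘ Γ.pV) ∘ (Subtype.val : (Γ.contract A).HE → Γ.HE) =
    Subtype.val ∘ (Γ.contract A).pV := rfl
  rw [h1, h2, Finsupp.mapDomain_comp, Finsupp.mapDomain_comp]
  rw [Finsupp.mapDomain_val_eq_zero_iff, Finsupp.mapDomain_val_eq_zero_iff]

/-- Every cycle in the contraction is the restriction of a cycle. -/
lemma exists_lift_of_contract {A : Set Γ.E} {y : (Γ.contract A).HE →₀ ℚ}
    (hy : y ∈ LinearMap.ker (Γ.contract A).boundary) :
    ∃ x ∈ LinearMap.ker Γ.boundary, ∀ h : (Γ.contract A).HE, x h.1 = y h := by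
  rw [mapDomain_val_mem_ker_contract] at hy
  obtain ⟨a, ha, hE, hV⟩ := Γ.exists_boundary A _ hy.2
  refine ⟨Finsupp.mapDomain Subtype.val y - a, ?_, fun h => ?_⟩
  · rw [mem_ker_boundary, Finsupp.mapDomain_sub, Finsupp.mapDomain_sub, hE, hV, hy.1, sub_self,
      sub_self]
    exact ⟨rfl, rfl⟩
  · have h0 : a h.1 = 0 := by_contra fun h0 => h.2 (ha _ h0)
    rw [Finsupp.sub_apply, h0, sub_zero, Finsupp.mapDomain_apply Subtype.val_injective]

/-- The restriction of a cycle is a cycle in the contraction. -/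
lemma restrict_mem_ker {A : Set Γ.E} {x : Γ.HE →₀ ℚ} (hx : x ∈ LinearMap.ker Γ.boundary) :
    (x.comapDomain Subtype.val Subtype.val_injective.injOn : (Γ.contract A).HE →₀ ℚ) ∈
      LinearMap.ker (Γ.contract A).boundary := by
  classical
  rw [mem_ker_boundary] at hx
  have hb : Finsupp.mapDomain Subtype.val
      (x.comapDomain Subtype.val Subtype.val_injective.injOn : (Γ.contract A).HE →₀ ℚ) =
      x.filter (fun h => Γ.pE h ∉ A) := by
    ext h
    by_cases hA : Γ.pE h ∈ A
    · rw [Finsupp.filter_apply_neg (fun h => Γ.pE h ∉ A) _ (not_not.2 hA)]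
      refine Finsupp.mapDomain_of_notMem_range _ _ ?_
      rintro ⟨h', rfl⟩
      exact h'.2 hA
    · rw [Finsupp.filter_apply_pos (fun h => Γ.pE h ∉ A) _ hA]
      exact Finsupp.mapDomain_apply Subtype.val_injective _ (⟨h, hA⟩ : (Γ.contract A).HE)
  have hfil (p : Γ.E → Prop) [DecidablePred p] : Finsupp.mapDomain Γ.pE
      (x.filter (fun h => p (Γ.pE h))) = 0 := by
    rw [Finsupp.mapDomain_filter_comp, hx.1]
    exact Finsupp.filter_zero _
  rw [mapDomain_val_mem_ker_contract, hb]
  refine ⟨hfil (· ∉ A), ?_⟩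
  -- The part of the chain in `A` vanishes in the contraction, as the half-edges of an edge in `A`
  -- have the same vertex there.
  have ha : Finsupp.mapDomain (Quot.mk (Γ.Linked A)) (Finsupp.mapDomain Γ.pV
      (x.filter (fun h => Γ.pE h ∈ A))) = 0 := by
    rw [← Finsupp.mapDomain_comp]
    have h1 : Finsupp.mapDomain (Quot.mk (Γ.Linked A) ∘ Γ.pV) (x.filter (fun h => Γ.pE h ∈ A)) =
        Finsupp.mapDomain ((fun e => Quot.mk (Γ.Linked A) (Γ.pV (Γ.pE_surjective e).choose)) ∘ Γ.pE)
          (x.filter (fun h => Γ.pE h ∈ A)) := by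
      refine Finsupp.mapDomain_congr fun h hh => Quot.sound ?_
      rw [Finsupp.support_filter, Finset.mem_filter] at hh
      exact ⟨h, _, hh.2, (Γ.pE_surjective (Γ.pE h)).choose_spec, rfl, rfl⟩
    rw [h1, Finsupp.mapDomain_comp, hfil (· ∈ A), Finsupp.mapDomain_zero]
  have h2 := x.filter_add_filter_not (fun h => Γ.pE h ∈ A)
  have h3 := hx.2
  rw [← h2, Finsupp.mapDomain_add] at h3
  have h4 := congrArg (Finsupp.mapDomain (Quot.mk (Γ.Linked A))) h3
  rwa [Finsupp.mapDomain_add, ha, zero_add, Finsupp.mapDomain_zero] at h4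

end HEGraph

end

noncomputable section

/-! ### Flags of core subgraphs -/

lemma OrbitDatum.range_edge {E : Type u} {G : Set (Set E)} (d : OrbitDatum G) (i : Fin (d.p + 1)) :
    Set.range (d.edge i) =
      d.flag i.castSucc \ (d.flag i.succ ∪ {a | ∀ i e, d.edge i e ≠ a}) := by
  ext a
  constructor
  · rintro ⟨e, rfl⟩
    exact ⟨d.edge_mem i e, fun h => h.elim (d.edge_notMem i e) fun h => h i e rfl⟩
  · rintro ⟨h1, h2⟩
    rw [Set.mem_union, not_or] at h2
    obtain ⟨j, e, rfl⟩ : ∃ j e, d.edge j e = a := by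
      by_contra! h
      exact h2.2 h
    rcases ((d.edge_mem_flag_iff j i e).1 h1).eq_or_lt with rfl | h
    · exact ⟨e, rfl⟩
    · exact absurd (d.strictAnti.antitone (Fin.succ_le_castSucc_iff.2 h) (d.edge_mem j e)) h2.1

namespace HEGraph

variable (Γ : HEGraph.{u})

instance finite_E : Finite Γ.E :=
  have := Γ.finite_HE
  Finite.of_surjective _ Γ.pE_surjective

/-- The non-empty proper core subgraphs. -/
def properCores : Set (Set Γ.E) := {γ | γ.Nonempty ∧ γ ≠ Set.univ ∧ (Γ.sub γ).IsCore}

variable {Γ}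

lemma mem_insert_properCores_iff (hΓ : Γ.IsCore) [Nonempty Γ.E] {T : Set Γ.E} :
    T ∈ insert Set.univ Γ.properCores ↔ T.Nonempty ∧ ∀ e ∈ T, Γ.OnCycle T e := by
  constructor
  · rintro (rfl | ⟨h1, -, h2⟩)
    · exact ⟨Set.univ_nonempty, fun e _ => Γ.isCore_iff.1 hΓ e⟩
    · exact ⟨h1, (Γ.isCore_sub_iff T).1 h2⟩
  · rintro ⟨h1, h2⟩
    by_cases h : T = Set.univ
    · exact Or.inl h
    · exact Or.inr ⟨h1, h, (Γ.isCore_sub_iff T).2 h2⟩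

/-- The union of two core subgraphs is core. -/
lemma isUnionClosed_insert_properCores (hΓ : Γ.IsCore) [Nonempty Γ.E] :
    IsUnionClosed (insert Set.univ Γ.properCores) where
  univ_mem := Set.mem_insert _ _
  empty_notMem h := Set.not_nonempty_empty ((mem_insert_properCores_iff hΓ).1 h).1
  union_mem S hS T hT := by
    rw [mem_insert_properCores_iff hΓ] at hS hT ⊢
    refine ⟨hS.1.mono Set.subset_union_left, ?_⟩
    rintro e (he | he)
    · exact (hS.2 e he).mono Set.subset_union_left
    · exact (hT.2 e he).mono Set.subset_union_right

lemma isUnionFamily_coreLinearSpaces (K : Type u) [Field K] (hΓ : Γ.IsCore) [Nonempty Γ.E] :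
    IsUnionFamily Γ.properCores (PSpace.linearSpace K) := by
  refine isUnionFamily_linearSpace K (fun γ h => h.1) (fun γ h => h.2.1) fun γ hγ γ' hγ' => ?_
  exact (isUnionClosed_insert_properCores hΓ).union_mem γ (Or.inr hγ) γ' (Or.inr hγ')

lemma coreLinearSpaces_eq (K : Type u) [Field K] :
    Γ.coreLinearSpaces K = PSpace.linearSpace K '' Γ.properCores := by
  ext L
  constructor
  · rintro ⟨γ, h1, h2, h3, rfl⟩
    exact ⟨γ, ⟨h1, h2, h3⟩, rfl⟩
  · rintro ⟨γ, ⟨h1, h2, h3⟩, rfl⟩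
    exact ⟨γ, h1, h2, h3, rfl⟩

/-- The set of edges in the support of a cycle is a core subgraph. -/
lemma onCycle_support {x : Γ.HE →₀ ℚ} (hx : x ∈ LinearMap.ker Γ.boundary) :
    ∀ e ∈ {e | ∃ h, x h ≠ 0 ∧ Γ.pE h = e}, Γ.OnCycle {e | ∃ h, x h ≠ 0 ∧ Γ.pE h = e} e := by
  rintro e ⟨h, hh, he⟩
  exact ⟨x, hx, fun h hh => ⟨h, hh, rfl⟩, h, he, hh⟩

/-- The image of `F` in `S // S'` is a forest if and only if all core subgraphs of `S` that are
contained in the union of `S'` and `F` are contained in `S'`. -/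
lemma isForest_contract_iff (S S' F : Set Γ.E) :
    (((Γ.sub S).contract {e | e.1 ∈ S'}).sub {e | e.1.1 ∈ F}).IsForest ↔
      ∀ T ⊆ S, T ⊆ S' ∪ F → (∀ e ∈ T, Γ.OnCycle T e) → T ⊆ S' := by
  rw [isForest_sub_iff]
  constructor
  · intro hF T hTS hT hcore e he
    by_contra he'
    obtain ⟨x, hx, hxT, h, rfl, hh⟩ := hcore e he
    obtain ⟨y, rfl⟩ := Γ.exists_eq_mapDomain_val fun h hh => hTS (hxT h hh)
    have hy (h : (Γ.sub S).HE) : Finsupp.mapDomain Subtype.val y h.1 = y h :=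
      Finsupp.mapDomain_apply Subtype.val_injective y h
    have h1 := (Γ.sub S).restrict_mem_ker (A := {e | e.1 ∈ S'}) ((mapDomain_val_mem_ker y).1 hx)
    have h2 := hF _ h1 (fun h' hh' => ?_)
    · refine hh ((hy ⟨h, hTS he⟩).trans ?_)
      exact DFunLike.congr_fun h2 (⟨⟨h, hTS he⟩, he'⟩ : ((Γ.sub S).contract {e | e.1 ∈ S'}).HE)
    · refine (hT (hxT h'.1.1 ?_)).resolve_left h'.2
      rw [hy]
      exact hh'
  · intro hT y hy hyF
    obtain ⟨x, hx, hxy⟩ := (Γ.sub S).exists_lift_of_contract hy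
    have hx' (h : (Γ.sub S).HE) : Finsupp.mapDomain Subtype.val x h.1 = x h :=
      Finsupp.mapDomain_apply Subtype.val_injective x h
    have h1 := (mapDomain_val_mem_ker x).2 hx
    have hS (h : Γ.HE) (hh : Finsupp.mapDomain Subtype.val x h ≠ 0) : Γ.pE h ∈ S := by
      by_contra hS
      refine hh (Finsupp.mapDomain_of_notMem_range _ _ ?_)
      rintro ⟨h', rfl⟩
      exact hS h'.2
    have h2 := hT {e | ∃ h, Finsupp.mapDomain Subtype.val x h ≠ 0 ∧ Γ.pE h = e} ?_ ?_
      (onCycle_support h1)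
    · ext h
      by_contra hh
      refine h.2 (h2 ⟨h.1.1, ?_, rfl⟩)
      rw [hx', hxy]
      exact hh
    · rintro e ⟨h, hh, rfl⟩
      exact hS h hh
    · rintro e ⟨h, hh, rfl⟩
      by_cases h' : Γ.pE h ∈ S'
      · exact Or.inl h'
      · refine Or.inr (hyF (⟨⟨h, hS h hh⟩, h'⟩ : ((Γ.sub S).contract {e | e.1 ∈ S'}).HE) ?_)
        rw [← hxy, ← hx']
        exact hh

namespace FlaggedForest

variable (hΓ : Γ.IsCore) [Nonempty Γ.E] (d : Γ.FlaggedForest)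

/-- The orbit datum of a flag of core subgraphs and a forest. -/
def toDatum : OrbitDatum (insert Set.univ Γ.properCores) where
  p := d.p
  flag := d.flag
  flag_zero := d.flag_zero
  flag_last := d.flag_last
  strictAnti := d.strictAnti
  mem i := by
    by_cases hi : i = 0
    · subst hi
      exact Or.inl d.flag_zero
    · have h0 : i.castSucc ≠ 0 := fun h => hi (Fin.castSucc_eq_zero_iff.1 h)
      refine Or.inr ⟨?_, ?_, d.core _ h0 (Fin.castSucc_lt_last i).ne⟩
      · refine Set.nonempty_iff_ne_empty.2 fun h => ?_
        exact (Fin.castSucc_lt_last i).ne (d.strictAnti.injective (h.trans d.flag_last.symm))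
      · exact fun h => h0 (d.strictAnti.injective (h.trans d.flag_zero.symm))
  piece i := (d.piece i).E
  edge i := (d.pieceEdge i).trans (Function.Embedding.subtype _)
  edge_mem i e := e.1.1.2
  edge_notMem i e := e.1.2
  meets T hT i h1 h2 := by
    rw [mem_insert_properCores_iff hΓ] at hT
    have h3 : ¬ T ⊆ d.flag i.succ ∪ d.F :=
      fun h3 => h2 ((isForest_contract_iff _ _ _).1 (d.compatible i) T h1 h3 hT.2)
    obtain ⟨a, ha, h4⟩ := Set.not_subset.1 h3
    rw [Set.mem_union, not_or] at h4
    exact ⟨⟨⟨⟨a, h1 ha⟩, h4.1⟩, h4.2⟩, ha⟩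

lemma F_eq : d.F = {a | ∀ i e, (d.toDatum hΓ).edge i e ≠ a} := by
  ext a
  constructor
  · rintro ha i e rfl
    exact e.2 ha
  · intro h
    by_contra ha
    obtain ⟨i, h1, h2⟩ := (d.toDatum hΓ).exists_level (Set.singleton_nonempty a)
    rw [Set.singleton_subset_iff] at h1 h2
    exact h i ⟨⟨⟨a, h1⟩, h2⟩, ha⟩ rfl

variable {K : Type u} [Field K] {X : Over (Spec (CommRingCat.of K))}
  (A : Atlas (insert Set.univ Γ.properCores) X)

/-- Different flagged forests have different orbits. -/
lemma eq_of_mem_orbit (d d' : Γ.FlaggedForest) {x : X.left} (hx : x ∈ (d.toDatum hΓ).orbit A)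
    (hx' : x ∈ (d'.toDatum hΓ).orbit A) : d = d' := by
  have hF (d : Γ.FlaggedForest) (hx : x ∈ (d.toDatum hΓ).orbit A) :
      d.F = {a | ∀ i, a ∉ A.nz ((d.toDatum hΓ).set i) x} := by
    rw [d.F_eq hΓ]
    ext a
    refine forall_congr' fun i => ?_
    rw [hx i, Set.mem_range, not_exists]
  have hp : d.p = d'.p :=
    le_antisymm ((d.toDatum hΓ).p_le _ hx hx') ((d'.toDatum hΓ).p_le _ hx' hx)
  have hflag := (d.toDatum hΓ).flag_eq hx
  have hflag' := (d'.toDatum hΓ).flag_eq hx'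
  have h1 := hF d hx
  have h2 := hF d' hx'
  obtain ⟨p, flag, _, _, _, _, F, _, _⟩ := d
  obtain ⟨p', flag', _, _, _, _, F', _, _⟩ := d'
  obtain rfl : p = p' := hp
  obtain rfl : flag = flag' := funext fun i => (hflag i).trans (hflag' i).symm
  obtain rfl : F = F' := h1.trans h2.symm
  rfl

/-- The flagged forest of an orbit datum. -/
def ofDatum (D : OrbitDatum (insert Set.univ Γ.properCores)) : Γ.FlaggedForest where
  p := D.p
  flag := D.flag
  flag_zero := D.flag_zero
  flag_last := D.flag_last
  strictAnti := D.strictAnti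
  core i h0 hlast := by
    obtain ⟨j, rfl⟩ := (Fin.eq_castSucc_or_eq_last i).resolve_right hlast
    exact (Γ.isCore_sub_iff _).2 ((mem_insert_properCores_iff hΓ).1 (D.mem j)).2
  F := {a | ∀ i e, D.edge i e ≠ a}
  forest := by
    rw [isForest_sub_iff]
    intro x hx hF
    by_contra hne
    obtain ⟨h, hh⟩ := Finsupp.ne_iff.1 hne
    have hT : {e | ∃ h, x h ≠ 0 ∧ Γ.pE h = e}.Nonempty := ⟨_, h, hh, rfl⟩
    obtain ⟨i, h1, h2⟩ := D.exists_level hT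
    obtain ⟨e, h', hh', he⟩ :=
      D.meets _ ((mem_insert_properCores_iff hΓ).2 ⟨hT, onCycle_support hx⟩) i h1 h2
    exact hF h' hh' i e he.symm
  compatible i := by
    refine (isForest_contract_iff _ _ _).2 fun T hTS hT hcore => ?_
    by_contra h2
    have hT' : T.Nonempty := Set.nonempty_iff_ne_empty.2 fun h => h2 (h ▸ Set.empty_subset _)
    obtain ⟨e, he⟩ := D.meets T ((mem_insert_properCores_iff hΓ).2 ⟨hT', hcore⟩) i hTS h2
    exact (hT he).elim (D.edge_notMem i e) fun h => h i e rfl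

/-- Every point lies in the orbit of a flagged forest. -/
lemma exists_mem_orbit (x : X.left) :
    ∃ d : Γ.FlaggedForest, x ∈ (d.toDatum hΓ).orbit A := by
  obtain ⟨D, hD⟩ := A.exists_orbitDatum (isUnionClosed_insert_properCores hΓ) x
  refine ⟨ofDatum hΓ D, fun i => ?_⟩
  rw [OrbitDatum.range_edge, ← F_eq]
  exact (hD i).trans (D.range_edge i)

end FlaggedForest

end HEGraph

end

noncomputable section

open charLattice toricSpec

/-! ### The tori of the pieces -/

lemma torus.char_proj_comp_mul {K A B : Type u} [Field K] {Y : Over (Spec (CommRingCat.of K))}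
    (φ : B → A) (g : Y ⟶ torus K B) (m : charLattice B) :
    char ((torus.proj K φ ⊗ₘ g) ≫ MonObj.mul (X := torus K B)) m =
      char (fst (torus K A) Y) (charLattice.map φ m) * char (snd (torus K A) Y ≫ g) m := by
  have h1 : torus.proj K φ ⊗ₘ g = CartesianMonoidalCategory.lift
      (fst (torus K A) Y ≫ torus.proj K φ) (snd (torus K A) Y ≫ g) :=
    (CartesianMonoidalCategory.lift_fst_comp_snd_comp _ _).symm
  rw [h1]
  refine (toricSpec.char_mul (M := charLattice B) _ _ m).trans (congrArg (· * _) ?_)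
  exact toricSpec.char_map (fst (torus K A) Y) (charLattice.map φ) m

namespace HEGraph.FlaggedForest

variable {Γ : HEGraph.{u}} (hΓ : Γ.IsCore) [Nonempty Γ.E] (d : Γ.FlaggedForest)
  {K : Type u} [Field K]

/-- The product of the tori of the pieces is the torus of the orbit datum. -/
def pieceIso (K : Type u) [Field K] : d.pieceTorus K ≅ toricSpec K (d.toDatum hΓ).Lattice :=
  toricSpec.piIso (fun i : Fin (d.p + 1) => charLattice (d.piece i).E) K

lemma pieceIso_hom_comp_map (i : Fin (d.p + 1)) : (d.pieceIso hΓ K).hom ≫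
    toricSpec.map K (AddMonoidHom.single (fun i => charLattice ((d.toDatum hΓ).piece i)) i) =
      Pi.π (fun i => torus K (d.piece i).E) i :=
  (Iso.eq_inv_comp _).1
    (toricSpec.piIso_inv_comp_π (fun i : Fin (d.p + 1) => charLattice (d.piece i).E) i).symm

lemma char_comp_pieceIso {Z : Over (Spec (CommRingCat.of K))} (f : Z ⟶ d.pieceTorus K)
    (m : (d.toDatum hΓ).Lattice) : char (f ≫ (d.pieceIso hΓ K).hom) m =
      ∏ i : Fin (d.p + 1), char (f ≫ Pi.π (fun i => torus K (d.piece i).E) i) (m i) :=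
  toricSpec.char_comp_piHom (M := fun i : Fin (d.p + 1) => charLattice (d.piece i).E) f m

lemma pieceAct_comp_π (i : Fin (d.p + 1)) :
    d.pieceAct K ≫ Pi.π (fun i => torus K (d.piece i).E) i =
      (torus.proj K (fun e => (d.pieceEdge i e).1) ⊗ₘ Pi.π (fun i => torus K (d.piece i).E) i) ≫
        MonObj.mul (X := torus K (d.piece i).E) := Pi.lift_π _ _

/-- The action through the homomorphisms that forget coordinates is the one given by the
homomorphism of character lattices. -/
lemma pieceAct_comp_pieceIso : d.pieceAct K ≫ (d.pieceIso hΓ K).hom =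
    torus K Γ.E ◁ (d.pieceIso hΓ K).hom ≫ toricSpec.act K (d.toDatum hΓ).toLattice := by
  refine toricSpec.hom_ext fun m => ?_
  have h1 (i : Fin (d.p + 1)) : char (d.pieceAct K ≫ Pi.π (fun i => torus K (d.piece i).E) i) (m i) =
      char (fst (torus K Γ.E) (d.pieceTorus K)) (charLattice.map ((d.toDatum hΓ).edge i) (m i)) *
        char (snd (torus K Γ.E) (d.pieceTorus K) ≫ Pi.π (fun i => torus K (d.piece i).E) i) (m i) := by
    rw [pieceAct_comp_π]
    exact torus.char_proj_comp_mul _ _ (m i)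
  rw [char_comp_pieceIso, toricSpec.char_whiskerLeft_comp_act, char_comp_pieceIso,
    Finset.prod_congr rfl fun i _ => h1 i, Finset.prod_mul_distrib, OrbitDatum.toLattice_apply]
  refine congrArg (· * _) ?_
  exact (map_prod (toricSpec.charHom (fst (torus K Γ.E) (d.pieceTorus K))) (fun i : Fin (d.p + 1) =>
    Multiplicative.ofAdd (charLattice.map ((d.toDatum hΓ).edge i) (m i))) Finset.univ).symm

variable {X : Over (Spec (CommRingCat.of K))} (A : Atlas (insert Set.univ Γ.properCores) X)

/-- The immersion of the product of the tori of the pieces. -/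
def immersion : d.pieceTorus K ⟶ X := (d.pieceIso hΓ K).hom ≫
  (d.toDatum hΓ).immersion A (isUnionClosed_insert_properCores hΓ).empty_notMem

lemma isIso_pieceIso_left : IsIso (d.pieceIso hΓ K).hom.left :=
  inferInstanceAs (IsIso ((Over.forget _).map (d.pieceIso hΓ K).hom))

lemma range_immersion : Set.range (d.immersion hΓ A).left = (d.toDatum hΓ).orbit A := by
  have := d.isIso_pieceIso_left hΓ (K := K)
  rw [← (d.toDatum hΓ).range_immersion A (isUnionClosed_insert_properCores hΓ).empty_notMem]
  refine (Set.range_comp ((d.toDatum hΓ).immersion A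
    (isUnionClosed_insert_properCores hΓ).empty_notMem).left (d.pieceIso hΓ K).hom.left).trans ?_
  rw [(d.pieceIso hΓ K).hom.left.surjective.range_eq, Set.image_univ]

lemma isImmersion : IsImmersion (d.immersion hΓ A).left := by
  have := d.isIso_pieceIso_left hΓ (K := K)
  have := (d.toDatum hΓ).isImmersion A (isUnionClosed_insert_properCores hΓ).empty_notMem
  change IsImmersion ((d.pieceIso hΓ K).hom.left ≫
    ((d.toDatum hΓ).immersion A (isUnionClosed_insert_properCores hΓ).empty_notMem).left)
  infer_instance

lemma pieceAct_comp_immersion :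
    d.pieceAct K ≫ d.immersion hΓ A = (torus K Γ.E ◁ d.immersion hΓ A) ≫ A.act := by
  have h := (d.toDatum hΓ).whiskerLeft_immersion_comp_act A
    (isUnionClosed_insert_properCores hΓ).empty_notMem
  have h1 := reassoc_of% d.pieceAct_comp_pieceIso hΓ (K := K)
  rw [immersion, MonoidalCategory.whiskerLeft_comp, Category.assoc, h]
  exact h1 _

lemma bijOn_range_immersion : Set.BijOn
    (fun d : Γ.FlaggedForest => Set.range (d.immersion hΓ A).left) Set.univ
    (A.toricStructure (isUnionClosed_insert_properCores hΓ)).orbits := by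
  have hG := (isUnionClosed_insert_properCores hΓ).empty_notMem
  simp only [range_immersion]
  refine ⟨fun d _ => ?_, fun d _ d' _ h => ?_, ?_⟩
  · obtain ⟨x, hx⟩ := (d.toDatum hΓ).orbit_nonempty A hG
    exact ⟨x, (d.toDatum hΓ).image_act_eq A hG hx⟩
  · obtain ⟨x, hx⟩ := (d.toDatum hΓ).orbit_nonempty A hG
    exact eq_of_mem_orbit hΓ A d d' hx (h.subset hx)
  · rintro _ ⟨x, rfl⟩
    obtain ⟨d, hd⟩ := exists_mem_orbit hΓ A x
    exact ⟨d, trivial, ((d.toDatum hΓ).image_act_eq A hG hd).symm⟩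

end HEGraph.FlaggedForest

end

theorem mainTheorem4 {K : Type u} [Field K] (Γ : HEGraph.{u}) (hΓ : Γ.IsCore)
    (hE : Nonempty Γ.E) :
    (∃ (P : Scheme.{u}) (π : P ⟶ PSpace K Γ.E), Γ.IsCoreBlowup K π) ∧
    ∀ (P : Scheme.{u}) (π : P ⟶ PSpace K Γ.E), Γ.IsCoreBlowup K π →
      Smooth (π ≫ PSpace.toSpec K Γ.E) ∧
      ∃ s : ToricStructure (torus K Γ.E) (Over.mk (π ≫ PSpace.toSpec K Γ.E)),
        (∀ e₀ : Γ.E, s.incl.left ≫ π = torus.toPSpace K (Function.Embedding.refl Γ.E) e₀) ∧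
        ∃ ι : ∀ d : Γ.FlaggedForest, d.pieceTorus K ⟶ Over.mk (π ≫ PSpace.toSpec K Γ.E),
          Set.BijOn (fun d => Set.range (ι d).left) Set.univ s.orbits ∧
          ∀ d : Γ.FlaggedForest,
            IsImmersion (ι d).left ∧
            d.pieceAct K ≫ ι d = (torus K Γ.E ◁ ι d) ≫ s.act ∧
            ∀ i : Fin (d.p + 1),
              Nonempty (d.piece i).E ∧
              ∃ q : P ⟶ PSpace K (Γ.sub (d.flag i.castSucc)).E,
                (∀ e₀ : (Γ.sub (d.flag i.castSucc)).E,
                  s.incl.left ≫ q = (torus.proj K (fun e => e.1)).left ≫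
                    torus.toPSpace K (Function.Embedding.refl _) e₀) ∧
                ∀ e₀ : (d.piece i).E,
                  (ι d).left ≫ q = (Pi.π (fun i => torus K (d.piece i).E) i).left ≫
                    torus.toPSpace K (d.pieceEdge i) e₀ := by
  have hG := HEGraph.isUnionClosed_insert_properCores hΓ
  have hL := HEGraph.isUnionFamily_coreLinearSpaces K hΓ
  unfold HEGraph.IsCoreBlowup
  rw [HEGraph.coreLinearSpaces_eq]
  refine ⟨exists_isIteratedBlowup_pspace hL, fun P π hπ => ?_⟩
  obtain ⟨A, hA⟩ := exists_atlas_of_isIteratedBlowup_pspace hL π hπ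
  refine ⟨A.smooth hG, A.toricStructure hG, hA, fun d => d.immersion hΓ A,
    HEGraph.FlaggedForest.bijOn_range_immersion hΓ A, fun d => ⟨d.isImmersion hΓ A,
    d.pieceAct_comp_immersion hΓ A, fun i => ⟨(d.toDatum hΓ).nonempty_piece i,
    (A.projection hG.empty_notMem ((d.toDatum hΓ).set i)).left, fun e₀ => ?_, fun e₀ => ?_⟩⟩⟩
  · exact congrArg (fun φ : torus K Γ.E ⟶ Over.mk (PSpace.toSpec K (d.flag i.castSucc)) => φ.left)
      (A.incl_comp_projection hG.empty_notMem ((d.toDatum hΓ).set i) hG.nonempty_sel e₀)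
  · have h1 := (d.toDatum hΓ).immersion_comp_projection A hG.empty_notMem i (d.pieceEdge i)
      (fun _ => rfl) e₀
    have h2 := congrArg (fun φ : d.pieceTorus K ⟶ torus K (d.piece i).E => φ.left)
      (d.pieceIso_hom_comp_map hΓ (K := K) i)
    refine (congrArg ((d.pieceIso hΓ K).hom.left ≫ ·) h1).trans ?_
    exact (Category.assoc _ _ _).symm.trans (congrArg (· ≫ torus.toPSpace K (d.pieceEdge i) e₀) h2)
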